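/- Let $R$ be a ring with identity, $\mathrm{Ch}(R)$ the category of (unbounded) chain complexes of left $R$-modules, $K(R)$ its chain homotopy category and $\mathcal{D}(R)$ the derived category of $R$. A short exact sequence of left $R$-modules is pure if it stays exact under $M\otimes_R-$ for every right $R$-module $M$; a module is pure-injective if it is injective with respect to pure exact sequences. Let $\mathrm{Ch}(R)_{pur}$ be the exact category $\mathrm{Ch}(R)$ with the short exact sequences that are pure exact in each degree. Let $\mathcal{KF}$ be the class of K-flat complexes (those $W$ such that $E\otimes_R W$ is acyclic for every acyclic complex $E$ of right $R$-modules), $\mathcal{E}$ the class of acyclic complexes, and $dw\mathcal{PI}$ the class of complexes with a pure-injective module in each degree. (1) $(\mathcal{KF},\mathcal{E},dw\mathcal{PI})$ is a Hovey triple in $\mathrm{Ch}(R)_{pur}$: the class $\mathcal{E}$ is thick (closed under retracts and with the two-out-of-three property on degreewise pure exact sequences), and $(\mathcal{KF},\mathcal{E}\cap dw\mathcal{PI})$ and $(\mathcal{KF}\cap\mathcal{E},dw\mathcal{PI})$ are complete cotorsion pairs in $\mathrm{Ch}(R)_{pur}$. It represents a cofibrantly generated abelian model structure $\mathfrak{M}$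 on $\mathrm{Ch}(R)_{pur}$: the cofibrant, trivial and fibrant objects are the complexes in $\mathcal{KF}$, $\mathcal{E}$ and $dw\mathcal{PI}$ respectively, the cofibrations (trivial cofibrations) are the degreewise pure monomorphisms with cokernel in $\mathcal{KF}$ (in $\mathcal{KF}\cap\mathcal{E}$), and the fibrations (trivial fibrations) are the degreewise pure epimorphisms with kernel in $dw\mathcal{PI}$ (in $\mathcal{E}\cap dw\mathcal{PI}$). (2) The homotopy category $\mathrm{Ho}(\mathfrak{M})$, the localization of $\mathrm{Ch}(R)$ at the weak equivalences, is a triangulated category, with the shift induced by that of complexes and with the triangles isomorphic to images of mapping cone triangles as distinguished triangles. The full subcategory $K(\mathcal{PI})\cap K\text{-Flat}$ of $K(R)$, which consists of the complexes homotopy equivalent to a K-flat complex with pure-injective components, is a triangulated subcategory of $K(R)$. There are equivalences of triangulated categories $$\mathcal{D}(R)\;\simeq\;\mathrm{Ho}(\mathfrak{M})\;\simeq\;K(\mathcal{PI})\cap K\text{-Flat},$$ where the first is compatible with the localization functors from $\mathrm{Ch}(R)$, and the composite is induced by the canonical functor $K(R)\to\mathcal{D}(R)$. So $\mathcal{D}(R)$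 is equivalent to the chain homotopy category of K-flat complexes with pure-injective components. (3) If $R$ is commutative, then $\mathfrak{M}$ is monoidal with respect to the usual (closed) tensor product of complexes: the pushout-product of two cofibrations is a cofibration, which is trivial if one of the two is, and for every cofibrant replacement $q:U\to S^0(R)$ of the unit and every cofibrant $X$ the maps $q\otimes X$ and $X\otimes q$ are weak equivalences. -/

import Mathlib

open CategoryTheory Limits MonoidalCategory HomotopicalAlgebra
open scoped TensorProduct

universe w v u

noncomputable section

namespace KFlatModel

/-! ### The tensor product of a right module and a left module over an arbitrary ring -/

section Tensor

variable (R : Type u) [Ring R]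

/-- The subgroup of `M ⊗_ℤ N` generated by the elements `(m r) ⊗ n - m ⊗ (r n)`, for a right
`R`-module `M` (a module over `Rᵐᵒᵖ`) and a left `R`-module `N`. -/
def balancedRelations (M : Type u) [AddCommGroup M] [Module Rᵐᵒᵖ M]
    (N : Type u) [AddCommGroup N] [Module R N] : Submodule ℤ (M ⊗[ℤ] N) :=
  Submodule.span ℤ
    {x | ∃ (m : M) (r : R) (n : N), x = (MulOpposite.op r • m) ⊗ₜ[ℤ] n - m ⊗ₜ[ℤ] (r • n)}

/-- The abelian group `M ⊗_R N`, for a right `R`-module `M` and a left `R`-module `N`. -/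
abbrev BalancedTensor (M : Type u) [AddCommGroup M] [Module Rᵐᵒᵖ M]
    (N : Type u) [AddCommGroup N] [Module R N] : Type u :=
  (M ⊗[ℤ] N) ⧸ balancedRelations R M N

variable {M M' M'' : Type u} [AddCommGroup M] [Module Rᵐᵒᵖ M] [AddCommGroup M'] [Module Rᵐᵒᵖ M']
  [AddCommGroup M''] [Module Rᵐᵒᵖ M'']
  {N N' N'' : Type u} [AddCommGroup N] [Module R N] [AddCommGroup N'] [Module R N']
  [AddCommGroup N''] [Module R N'']

lemma balancedRelations_le (f : M →ₗ[Rᵐᵒᵖ] M') (g : N →ₗ[R] N') :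
    balancedRelations R M N ≤ (balancedRelations R M' N').comap
      (TensorProduct.map f.toAddMonoidHom.toIntLinearMap g.toAddMonoidHom.toIntLinearMap) := by
  refine Submodule.span_le.2 ?_
  rintro _ ⟨m, r, n, rfl⟩
  refine Submodule.subset_span ⟨f m, r, g n, ?_⟩
  simp

/-- The map `f ⊗_R g`, which sends the class of `m ⊗ n` to that of `f m ⊗ g n`. -/
def balancedMap (f : M →ₗ[Rᵐᵒᵖ] M') (g : N →ₗ[R] N') :
    BalancedTensor R M N →ₗ[ℤ] BalancedTensor R M' N' :=
  Submodule.mapQ _ _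
    (TensorProduct.map f.toAddMonoidHom.toIntLinearMap g.toAddMonoidHom.toIntLinearMap)
    (balancedRelations_le R f g)

/-- The class of `m ⊗ n` in `M ⊗_R N`. -/
def btmul (m : M) (n : N) : BalancedTensor R M N :=
  (balancedRelations R M N).mkQ (m ⊗ₜ[ℤ] n)

@[simp]
lemma balancedMap_btmul (f : M →ₗ[Rᵐᵒᵖ] M') (g : N →ₗ[R] N') (m : M) (n : N) :
    balancedMap R f g (btmul R m n) = btmul R (f m) (g n) := rfl

lemma btmul_zero (m : M) : btmul R m (0 : N) = 0 := by simp [btmul]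

lemma zero_btmul (n : N) : btmul R (0 : M) n = 0 := by simp [btmul]

lemma balanced_ext {A : Type u} [AddCommGroup A] {f g : BalancedTensor R M N →ₗ[ℤ] A}
    (h : ∀ m n, f (btmul R m n) = g (btmul R m n)) : f = g :=
  Submodule.linearMap_qext _ (TensorProduct.ext' h)

/-- The bifunctor `(M, N) ↦ M ⊗_R N` from right and left `R`-modules to abelian groups. -/
def tensorBifunctor : ModuleCat.{u} Rᵐᵒᵖ ⥤ ModuleCat.{u} R ⥤ ModuleCat.{u} ℤ where
  obj M :=
    { obj := fun N => ModuleCat.of ℤ (BalancedTensor R M N)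
      map := fun g => ModuleCat.ofHom (balancedMap R LinearMap.id g.hom)
      map_id := fun N => ModuleCat.hom_ext (balanced_ext R fun _ _ => rfl)
      map_comp := fun g g' => ModuleCat.hom_ext (balanced_ext R fun _ _ => rfl) }
  map f :=
    { app := fun N => ModuleCat.ofHom (balancedMap R f.hom LinearMap.id)
      naturality := fun N N' g => ModuleCat.hom_ext (balanced_ext R fun _ _ => rfl) }
  map_id M := by
    ext N : 2
    exact ModuleCat.hom_ext (balanced_ext R fun _ _ => rfl)
  map_comp f f' := by
    ext N : 2
    exact ModuleCat.hom_ext (balanced_ext R fun _ _ => rfl)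

instance : (tensorBifunctor R).PreservesZeroMorphisms where
  map_zero M M' := by
    ext N : 2
    exact ModuleCat.hom_ext (balanced_ext R fun _ n => zero_btmul R n)

instance (M : ModuleCat.{u} Rᵐᵒᵖ) : ((tensorBifunctor R).obj M).PreservesZeroMorphisms where
  map_zero _ _ := ModuleCat.hom_ext (balanced_ext R fun m _ => btmul_zero R m)

end Tensor

/-! ### Purity, pure-injectivity and K-flatness -/

section Classes

variable (R : Type u) [Ring R]

/-- Complexes of left `R`-modules, indexed cohomologically by `X^n = X_{-n}`. -/
abbrev Ch : Type (u + 1) := CochainComplex (ModuleCat.{u} R) ℤ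

/-- The tensor product `E ⊗_R W` of a complex of right modules and a complex of left modules:
`⨁_{i+j=n} E^i ⊗_R W^j` in degree `n`, with `d (x ⊗ y) = dx ⊗ y + (-1)^|x| x ⊗ dy`. -/
abbrev complexTensor (E : CochainComplex (ModuleCat.{u} Rᵐᵒᵖ) ℤ) (W : Ch R) :
    CochainComplex (ModuleCat.{u} ℤ) ℤ :=
  HomologicalComplex.mapBifunctor E W (tensorBifunctor R) (ComplexShape.up ℤ)

/-- The pure exact sequences of left `R`-modules: the short exact sequences that remain exact
under `M ⊗_R -` for every right `R`-module `M`. -/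
def pureExact : ObjectProperty (ShortComplex (ModuleCat.{u} R)) := fun S =>
  S.ShortExact ∧
    ∀ M : ModuleCat.{u} Rᵐᵒᵖ, (S.map ((tensorBifunctor R).obj M)).ShortExact

/-- The pure-injective modules: those that are injective with respect to the pure exact
sequences. -/
def pureInjective : ObjectProperty (ModuleCat.{u} R) := fun I =>
  ∀ S : ShortComplex (ModuleCat.{u} R), pureExact R S →
    ∀ g : S.X₁ ⟶ I, ∃ h : S.X₂ ⟶ I, S.f ≫ h = g

/-- The degreewise pure exact structure on complexes. -/
def dwPureExact : ObjectProperty (ShortComplex (Ch R)) := fun S =>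
  ∀ n : ℤ, pureExact R (S.map (HomologicalComplex.eval _ _ n))

/-- The complexes with a pure-injective module in each degree. -/
def dwPureInjective : ObjectProperty (Ch R) := fun X => ∀ n : ℤ, pureInjective R (X.X n)

/-- The acyclic complexes. -/
def acyclic : ObjectProperty (Ch R) := fun X => X.Acyclic

/-- The K-flat complexes. -/
def kFlat : ObjectProperty (Ch R) := fun W =>
  ∀ E : CochainComplex (ModuleCat.{u} Rᵐᵒᵖ) ℤ, E.Acyclic → (complexTensor R E W).Acyclic

/-- The objects of the chain homotopy category that are isomorphic in it to a K-flat complex with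
pure-injective components. -/
def kFlatPureInjective : ObjectProperty (HomotopyCategory (ModuleCat.{u} R) (ComplexShape.up ℤ)) :=
  (kFlat R ⊓ dwPureInjective R).map (HomotopyCategory.quotient _ _)

end Classes

/-! ### Cotorsion pairs, Hovey triples and abelian model structures

Here `ex` is a class of short exact sequences in an abelian category, the exact structure. -/

section Model

variable {C : Type u} [Category.{v} C] [Abelian C]

/-- The vanishing of the Yoneda group `Ext¹(X, Y)` of the exact structure: every admissible
sequence `0 ⟶ Y ⟶ Z ⟶ X ⟶ 0` splits. -/
def ExtVanishes (ex : ObjectProperty (ShortComplex C)) (X Y : C) : Prop :=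
  ∀ ⦃Z : C⦄ (f : Y ⟶ Z) (g : Z ⟶ X) (h : f ≫ g = 0),
    ex (ShortComplex.mk f g h) → Nonempty (ShortComplex.mk f g h).Splitting

/-- `(A, B)` is a complete cotorsion pair: each class is the Ext-orthogonal of the other, and each
object `X` has admissible sequences `0 ⟶ b ⟶ a ⟶ X ⟶ 0` and `0 ⟶ X ⟶ b ⟶ a ⟶ 0` with `a` in `A`
and `b` in `B`. -/
structure IsCompleteCotorsionPair (ex : ObjectProperty (ShortComplex C))
    (A B : ObjectProperty C) : Prop where
  left_iff (X : C) : A X ↔ ∀ Y, B Y → ExtVanishes ex X Y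
  right_iff (Y : C) : B Y ↔ ∀ X, A X → ExtVanishes ex X Y
  enough_projectives (X : C) : ∃ (b a : C) (f : b ⟶ a) (g : a ⟶ X) (h : f ≫ g = 0),
    ex (ShortComplex.mk f g h) ∧ A a ∧ B b
  enough_injectives (X : C) : ∃ (b a : C) (f : X ⟶ b) (g : b ⟶ a) (h : f ≫ g = 0),
    ex (ShortComplex.mk f g h) ∧ A a ∧ B b

/-- A class is thick if it is closed under retracts and, when two of the three terms of an
admissible sequence belong to it, so does the third. -/
structure IsThick (ex : ObjectProperty (ShortComplex C)) (W : ObjectProperty C) : Prop where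
  retract {X Y : C} (r : Retract X Y) : W Y → W X
  first (S : ShortComplex C) : ex S → W S.X₂ → W S.X₃ → W S.X₁
  middle (S : ShortComplex C) : ex S → W S.X₁ → W S.X₃ → W S.X₂
  last (S : ShortComplex C) : ex S → W S.X₁ → W S.X₂ → W S.X₃

/-- `(Q, W, F)` is a Hovey triple for the exact structure. -/
structure IsHoveyTriple (ex : ObjectProperty (ShortComplex C)) (Q W F : ObjectProperty C) :
    Prop where
  thick : IsThick ex W
  cotorsion : IsCompleteCotorsionPair ex Q (W ⊓ F)
  cotorsion' : IsCompleteCotorsionPair ex (Q ⊓ W) F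

/-- `f` is an admissible monomorphism whose cokernel belongs to `P`. -/
def AdmissibleMono (ex : ObjectProperty (ShortComplex C)) (P : ObjectProperty C)
    {X Y : C} (f : X ⟶ Y) : Prop :=
  ∃ (Z : C) (g : Y ⟶ Z) (h : f ≫ g = 0), ex (ShortComplex.mk f g h) ∧ P Z

/-- `g` is an admissible epimorphism whose kernel belongs to `P`. -/
def AdmissibleEpi (ex : ObjectProperty (ShortComplex C)) (P : ObjectProperty C)
    {Y Z : C} (g : Y ⟶ Z) : Prop :=
  ∃ (X : C) (f : X ⟶ Y) (h : f ≫ g = 0), ex (ShortComplex.mk f g h) ∧ P X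

/-- The model structure is abelian with respect to the exact structure, and its cofibrant, trivial
and fibrant objects are those of `Q`, `W` and `F`: the (trivial) cofibrations are the admissible
monomorphisms with (trivially) cofibrant cokernel, and the (trivial) fibrations are the admissible
epimorphisms with (trivially) fibrant kernel. -/
structure IsAbelianModelStructure [ModelCategory C] (ex : ObjectProperty (ShortComplex C))
    (Q W F : ObjectProperty C) : Prop where
  cofibrant_iff (X : C) : IsCofibrant X ↔ Q X
  trivial_iff (X : C) : WeakEquivalence (initial.to X) ↔ W X
  fibrant_iff (X : C) : IsFibrant X ↔ F X
  cofibrations_iff {X Y : C} (f : X ⟶ Y) : cofibrations C f ↔ AdmissibleMono ex Q f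
  trivialCofibrations_iff {X Y : C} (f : X ⟶ Y) :
    trivialCofibrations C f ↔ AdmissibleMono ex (Q ⊓ W) f
  fibrations_iff {X Y : C} (f : X ⟶ Y) : fibrations C f ↔ AdmissibleEpi ex F f
  trivialFibrations_iff {X Y : C} (f : X ⟶ Y) :
    trivialFibrations C f ↔ AdmissibleEpi ex (W ⊓ F) f

end Model

/-- There are sets `I` and `J` of morphisms that permit the small object argument and such that
the fibrations are the maps with the right lifting property with respect to `J`, and the trivial
fibrations those with the right lifting property with respect to `I`. -/
def IsCofibrantlyGenerated (C : Type u) [Category.{v} C] [ModelCategory C] : Prop :=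
  ∃ I J : MorphismProperty C,
    I.HasSmallObjectArgument.{v} ∧ J.HasSmallObjectArgument.{v} ∧
      fibrations C = J.rlp ∧ trivialFibrations C = I.rlp

/-- A monoidal model category: the tensor product is closed, the pushout-product `i □ j` of two
cofibrations is a cofibration, which is trivial if `i` or `j` is, and tensoring a cofibrant
replacement of the unit with a cofibrant object gives a weak equivalence. -/
structure IsMonoidalModelCategory (C : Type u) [Category.{v} C] [MonoidalCategory C]
    [ModelCategory C] : Prop where
  closed : Nonempty (MonoidalClosed C)
  pushoutProduct {A B X Y : C} (i : A ⟶ B) (j : X ⟶ Y) :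
    cofibrations C i → cofibrations C j →
      cofibrations C
        ((MonoidalCategory.Arrow.pushoutProduct.obj (Arrow.mk i)).obj (Arrow.mk j)).hom
  pushoutProduct_left {A B X Y : C} (i : A ⟶ B) (j : X ⟶ Y) :
    trivialCofibrations C i → cofibrations C j →
      trivialCofibrations C
        ((MonoidalCategory.Arrow.pushoutProduct.obj (Arrow.mk i)).obj (Arrow.mk j)).hom
  pushoutProduct_right {A B X Y : C} (i : A ⟶ B) (j : X ⟶ Y) :
    cofibrations C i → trivialCofibrations C j →
      trivialCofibrations C
        ((MonoidalCategory.Arrow.pushoutProduct.obj (Arrow.mk i)).obj (Arrow.mk j)).hom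
  unit_left {U X : C} (q : U ⟶ 𝟙_ C) :
    IsCofibrant U → WeakEquivalence q → IsCofibrant X → WeakEquivalence (q ▷ X)
  unit_right {U X : C} (q : U ⟶ 𝟙_ C) :
    IsCofibrant U → WeakEquivalence q → IsCofibrant X → WeakEquivalence (X ◁ q)

/-! ### The homotopy category as a triangulated category -/

/-- A triangulated structure on the localization of a category of complexes at a class `W`, for
which the localization functor is additive and commutes with shifts, and whose distinguished
triangles are those isomorphic to the images of the mapping cone triangles
`X ⟶ Y ⟶ cone f ⟶ X⟦1⟧`. -/
class TriangulatedLocalization {A : Type u} [Category.{v} A] [Abelian A]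
    (W : MorphismProperty (CochainComplex A ℤ)) where
  [preadditive : Preadditive W.Localization]
  [hasZeroObject : HasZeroObject W.Localization]
  [hasShift : HasShift W.Localization ℤ]
  [shift_additive : ∀ n : ℤ, (shiftFunctor W.Localization n).Additive]
  [pretriangulated : Pretriangulated W.Localization]
  [isTriangulated : IsTriangulated W.Localization]
  [additive : W.Q.Additive]
  [commShift : W.Q.CommShift ℤ]
  mem_distTriang_iff (T : Pretriangulated.Triangle W.Localization) :
    T ∈ Pretriangulated.distinguishedTriangles ↔
      ∃ (X Y : CochainComplex A ℤ) (f : X ⟶ Y),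
        Nonempty (T ≅ W.Q.mapTriangle.obj (CochainComplex.mappingCone.triangle f))

attribute [reducible] TriangulatedLocalization.preadditive TriangulatedLocalization.hasShift
  TriangulatedLocalization.pretriangulated TriangulatedLocalization.commShift

attribute [instance] TriangulatedLocalization.preadditive TriangulatedLocalization.hasZeroObject
  TriangulatedLocalization.hasShift TriangulatedLocalization.shift_additive
  TriangulatedLocalization.pretriangulated TriangulatedLocalization.isTriangulated
  TriangulatedLocalization.additive TriangulatedLocalization.commShift

/-- The homotopy category of a model structure. -/
abbrev Ho (C : Type u) [Category.{v} C] [ModelCategory C] := (weakEquivalences C).Localization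

end KFlatModel

end

/-! Character duality turns statements about tensor products into statements about homomorphism
complexes. If `E` is a complex of right modules and `E⁺` is its complex of character modules, then
the characters of `E ⊗_R W` form the complex `Hom(W, E⁺)`, up to signs. So `W` is K-flat if and only
if `Hom(W, E⁺)` is acyclic for every acyclic `E` (`kFlat_iff_orth`). The components of `E⁺` are
pure-injective, so `Hom(-, E⁺)` sends degreewise pure exact sequences to exact ones, and the
relation `Orth` has the two-out-of-three property in its first variable.

Two facts carry the cotorsion pairs. The acyclic K-flat complexes are exactly the pure acyclic ones
(`kFlat_acyclic_iff`): for such a complex `W` the evaluation map to the double dual is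
null-homotopic, and every map to a character module extends over the double dual. Secondly, a pure
acyclic complex with pure-injective components is contractible (`PureAcyclic.contractible`). For
this, every map to a module of cycles is lifted, by induction on the number of relations of its
source: a module with infinitely many relations is the union of a well-ordered chain of quotients
with fewer relations, and the telescope of the chain is a pure presentation whose kernel is filtered
by quotients of the same kind (`homLifts_of_periodic`).

Sets of generators exist because pure-injectivity can be tested on a set of pure monomorphisms
(`pureInjective_of_extendsAlongSmall`). The free complexes on these, together with the finitely
presented modules, detect degreewise pure epimorphisms with pure-injective kernel; a sphere
inclusion detects acyclicity of the kernel. The small object argument then covers a pure acyclic (or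
K-flat) complex by one in the left class, with a kernel that is contractible by the two facts above.
This yields `PureAcyclic.orth` and `kFlat.orth`, hence the Hovey triple and the model structure.

The weak equivalences are the quasi-isomorphisms, so the homotopy category is the derived category.
Each complex is connected by quasi-isomorphisms to a K-flat complex with pure-injective components.
The cone of a quasi-isomorphism between K-flat complexes is pure acyclic and has no nonzero maps in
`K(R)` to such a complex, so maps between these complexes are the same in `K(R)` and in the derived
category. Over a commutative ring, tensoring with a complex preserves degreewise pure exact
sequences, and the cokernel of a pushout-product is the tensor product of the cokernels. -/

noncomputable section

namespace KFlatModel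

/-! ### Character modules -/

section Hom

variable (R : Type u) [Ring R]

/-- The left `R`-module of additive maps from a right `R`-module to an abelian group. -/
def RightHom (M : Type u) [AddCommGroup M] [Module Rᵐᵒᵖ M] (A : Type*) [AddCommGroup A] :=
  M →+ A

section

variable (M : Type u) [AddCommGroup M] [Module Rᵐᵒᵖ M] (A : Type*) [AddCommGroup A]

instance : AddCommGroup (RightHom R M A) := inferInstanceAs (AddCommGroup (M →+ A))

instance : FunLike (RightHom R M A) M A := inferInstanceAs (FunLike (M →+ A) M A)

instance : AddMonoidHomClass (RightHom R M A) M A :=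
  inferInstanceAs (AddMonoidHomClass (M →+ A) M A)

instance : SMul R (RightHom R M A) where
  smul r φ := AddMonoidHom.comp (φ : M →+ A)
    (DistribSMul.toAddMonoidHom M (MulOpposite.op r))

variable {M A}

@[simp] lemma RightHom.smul_apply (r : R) (φ : RightHom R M A) (m : M) :
    (r • φ) m = φ (MulOpposite.op r • m) := rfl

@[simp] lemma RightHom.add_apply (φ ψ : RightHom R M A) (m : M) : (φ + ψ) m = φ m + ψ m := rfl

@[simp] lemma RightHom.zero_apply (m : M) : (0 : RightHom R M A) m = 0 := rfl

@[ext] lemma RightHom.ext {φ ψ : RightHom R M A} (h : ∀ m, φ m = ψ m) : φ = ψ :=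
  DFunLike.ext _ _ h

instance : Module R (RightHom R M A) where
  one_smul φ := by ext; simp
  mul_smul r s φ := by ext; simp [mul_smul]
  smul_zero r := by ext; simp
  smul_add r φ ψ := by ext; simp
  add_smul r s φ := by ext; simp [add_smul]
  zero_smul φ := by ext; simp

variable {M' : Type u} [AddCommGroup M'] [Module Rᵐᵒᵖ M'] {A' : Type*} [AddCommGroup A']

/-- Precomposition with a linear map and postcomposition with an additive map. -/
def RightHom.map (f : M' →ₗ[Rᵐᵒᵖ] M) (g : A →+ A') : RightHom R M A →ₗ[R] RightHom R M' A' where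
  toFun φ := (g.comp (φ : M →+ A)).comp f.toAddMonoidHom
  map_add' φ ψ := by ext m; exact map_add g _ _
  map_smul' r φ := by
    ext m
    change g (φ (MulOpposite.op r • f m)) = g (φ (f (MulOpposite.op r • m)))
    rw [map_smul f]

/-- The tensor-hom adjunction, as a bijection between additive maps on `M ⊗_R N` and linear maps
on `N`. -/
def tensorCurry {N : Type u} [AddCommGroup N] [Module R N] :
    (BalancedTensor R M N →+ A) ≃ (N →ₗ[R] RightHom R M A) where
  toFun φ :=
    { toFun n := (φ.comp (balancedRelations R M N).mkQ.toAddMonoidHom).comp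
        ((TensorProduct.mk ℤ M N).flip n).toAddMonoidHom
      map_add' n n' := by
        ext m
        change φ (btmul R m (n + n')) = φ (btmul R m n) + φ (btmul R m n')
        simp [btmul, TensorProduct.tmul_add]
      map_smul' r n := by
        ext m
        change φ (btmul R m (r • n)) = φ (btmul R (MulOpposite.op r • m) n)
        have h : btmul R (MulOpposite.op r • m) n = btmul R m (r • n) :=
          (Submodule.Quotient.eq _).2 (Submodule.subset_span ⟨m, r, n, rfl⟩)
        rw [h] }
  invFun g := ((balancedRelations R M N).liftQ
    (TensorProduct.lift (LinearMap.flip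
      (AddMonoidHom.toIntLinearMap
        { toFun n := AddMonoidHom.toIntLinearMap (AddMonoidHomClass.toAddMonoidHom (g n))
          map_zero' := by ext m; exact congr($(map_zero g) m)
          map_add' x y := by ext m; exact congr($(map_add g x y) m) }))) (by
        refine Submodule.span_le.2 ?_
        rintro _ ⟨m, r, n, rfl⟩
        refine LinearMap.mem_ker.2 ((map_sub _ _ _).trans ?_)
        change g n (MulOpposite.op r • m) - g (r • n) m = 0
        rw [map_smul g, RightHom.smul_apply, sub_self])).toAddMonoidHom
  left_inv φ := by
    have : ∀ (f g : BalancedTensor R M N →ₗ[ℤ] A), (∀ m n, f (btmul R m n) = g (btmul R m n)) →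
        f = g := fun f g h => Submodule.linearMap_qext _ (TensorProduct.ext' h)
    exact AddMonoidHom.toIntLinearMap_injective (this _ φ.toIntLinearMap fun m n => rfl)
  right_inv g := by ext; rfl

lemma balanced_hom_ext {N : Type u} [AddCommGroup N] [Module R N] {f g : BalancedTensor R M N →+ A}
    (h : ∀ m n, f (btmul R m n) = g (btmul R m n)) : f = g :=
  (tensorCurry R).injective (by ext n m; exact h m n)

end

/-- The right adjoint `Hom_ℤ(M, -)` of `M ⊗_R -`. -/
def rightHomFunctor (M : ModuleCat.{u} Rᵐᵒᵖ) : ModuleCat.{u} ℤ ⥤ ModuleCat.{u} R where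
  obj A := ModuleCat.of R (RightHom R M A)
  map g := ModuleCat.ofHom (RightHom.map R LinearMap.id g.hom.toAddMonoidHom)

/-- The tensor-hom adjunction. -/
def tensorAdjunction (M : ModuleCat.{u} Rᵐᵒᵖ) : (tensorBifunctor R).obj M ⊣ rightHomFunctor R M :=
  Adjunction.mkOfHomEquiv
    { homEquiv N A :=
        { toFun f := ModuleCat.ofHom (tensorCurry R f.hom.toAddMonoidHom)
          invFun g := ModuleCat.ofHom
            { toFun := (tensorCurry R).symm g.hom
              map_add' := map_add _
              map_smul' n x := by
                rw [map_zsmul]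
                exact (int_smul_eq_zsmul A.isModule n _).symm }
          left_inv f := by
            exact ModuleCat.hom_ext (LinearMap.toAddMonoidHom_injective
              (balanced_hom_ext R fun _ _ => rfl))
          right_inv g := by ext; rfl }
      homEquiv_naturality_left_symm f g := by
        exact ModuleCat.hom_ext (LinearMap.toAddMonoidHom_injective
          (balanced_hom_ext R fun _ _ => rfl))
      homEquiv_naturality_right f g := by ext; rfl }

instance (M : ModuleCat.{u} Rᵐᵒᵖ) :
    PreservesColimitsOfSize.{w, v} ((tensorBifunctor R).obj M) :=
  (tensorAdjunction R M).leftAdjoint_preservesColimits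

end Hom

/-! ### Exactness and characters -/

section Exact

variable {A B C : Type*} [AddCommGroup A] [AddCommGroup B] [AddCommGroup C]

/-- `AddCircle (1 : ℚ)` is `ℚ/ℤ`, which is divisible and hence injective; `φ` descends to `B ⧸
g.ker`, which embeds in `C`. -/
lemma exists_character_extension (g : B →+ C) (φ : B →+ AddCircle (1 : ℚ))
    (h : ∀ b, g b = 0 → φ b = 0) : ∃ ψ : C →+ AddCircle (1 : ℚ), ψ.comp g = φ := by
  let φ' : B ⧸ g.ker →+ AddCircle (1 : ℚ) := QuotientAddGroup.lift _ φ (fun b hb => h b hb)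
  obtain ⟨ψ, hψ⟩ := (Module.Baer.of_divisible
    (AddCircle (1 : ℚ))).extension_property_addMonoidHom (QuotientAddGroup.kerLift g)
    (QuotientAddGroup.kerLift_injective g) φ'
  exact ⟨ψ, by ext b; exact DFunLike.congr_fun hψ (b : B ⧸ g.ker)⟩

/-- For the converse, an element of the kernel of `g` outside the range of `f` is detected by a
character of `B ⧸ f.range`, and a character that factors through `g` would vanish on it. -/
lemma exact_iff_character (f : A →+ B) (g : B →+ C) (hfg : ∀ a, g (f a) = 0) :
    Function.Exact f g ↔ ∀ φ : B →+ AddCircle (1 : ℚ), φ.comp f = 0 →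
      ∃ ψ : C →+ AddCircle (1 : ℚ), ψ.comp g = φ := by
  constructor
  · intro h φ hφ
    refine exists_character_extension g φ fun b hb => ?_
    obtain ⟨a, rfl⟩ := (h b).1 hb
    exact DFunLike.congr_fun hφ a
  · refine fun h b => ⟨fun hb => ?_, by rintro ⟨a, rfl⟩; exact hfg a⟩
    by_contra hb'
    have : (b : B ⧸ f.range) ≠ 0 := fun h0 => hb' ((QuotientAddGroup.eq_zero_iff _).1 h0)
    obtain ⟨c, hc⟩ := CharacterModule.exists_character_apply_ne_zero_of_ne_zero this
    let c' : (B ⧸ f.range) →+ AddCircle (1 : ℚ) := c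
    obtain ⟨ψ, hψ⟩ := h (c'.comp (QuotientAddGroup.mk' f.range)) (by
      ext a
      have : (f a : B ⧸ f.range) = 0 := (QuotientAddGroup.eq_zero_iff _).2 ⟨a, rfl⟩
      change c' (f a : B ⧸ f.range) = 0
      rw [this, map_zero])
    refine hc ?_
    have := DFunLike.congr_fun hψ b
    change ψ (g b) = c' b at this
    rw [hb, map_zero] at this
    exact this.symm

lemma injective_iff_character (g : B →+ C) :
    Function.Injective g ↔ ∀ φ : B →+ AddCircle (1 : ℚ),
      ∃ ψ : C →+ AddCircle (1 : ℚ), ψ.comp g = φ := by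
  constructor
  · exact fun h φ => exists_character_extension g φ fun b hb => by
      rw [(injective_iff_map_eq_zero g).1 h b hb, map_zero]
  · refine fun h => (injective_iff_map_eq_zero g).2 fun b hb => ?_
    refine CharacterModule.eq_zero_of_character_apply fun c => ?_
    obtain ⟨ψ, hψ⟩ := h c
    have := DFunLike.congr_fun hψ b
    change ψ (g b) = c b at this
    rw [← this, hb, map_zero]

end Exact

/-! ### Pure monomorphisms -/

section Pure

variable (R : Type u) [Ring R]

/-- The character module `Hom_ℤ(M, ℚ/ℤ)` of a right module. -/
abbrev leftDual (M : ModuleCat.{u} Rᵐᵒᵖ) : ModuleCat.{u} R :=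
  ModuleCat.of R (RightHom R M (AddCircle (1 : ℚ)))

/-- The transpose of a linear map between right modules. -/
abbrev leftDualMap {M M' : ModuleCat.{u} Rᵐᵒᵖ} (f : M ⟶ M') : leftDual R M' ⟶ leftDual R M :=
  ModuleCat.ofHom (RightHom.map R f.hom (AddMonoidHom.id _))

variable {R}

/-- A linear map along which all maps to character modules extend. -/
def PureMono {A B : ModuleCat.{u} R} (f : A ⟶ B) : Prop :=
  ∀ (M : ModuleCat.{u} Rᵐᵒᵖ) (g : A ⟶ leftDual R M), ∃ h : B ⟶ leftDual R M, f ≫ h = g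

/-- A map of abelian groups is injective if and only if characters extend along it, and by the
tensor-hom adjunction a character of `M ⊗_R A` is a map from `A` to `leftDual R M`. -/
lemma pureMono_iff_injective {A B : ModuleCat.{u} R} (f : A ⟶ B) :
    PureMono f ↔ ∀ M : ModuleCat.{u} Rᵐᵒᵖ,
      Function.Injective (balancedMap R (LinearMap.id : M →ₗ[Rᵐᵒᵖ] M) f.hom) := by
  refine forall_congr' fun M => ?_
  change _ ↔ Function.Injective (balancedMap R (LinearMap.id : M →ₗ[Rᵐᵒᵖ] M) f.hom).toAddMonoidHom
  rw [injective_iff_character]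
  constructor
  · intro h φ
    obtain ⟨g, hg⟩ := h (ModuleCat.ofHom (tensorCurry R φ))
    refine ⟨(tensorCurry R).symm g.hom, balanced_hom_ext R fun m n => ?_⟩
    exact congr($hg n m)
  · intro h g
    obtain ⟨ψ, hψ⟩ := h ((tensorCurry R).symm g.hom)
    refine ⟨ModuleCat.ofHom (tensorCurry R ψ), ?_⟩
    ext n
    refine RightHom.ext R fun m => ?_
    exact congr($hψ (btmul R m n))

lemma pureMono_iff_mono {A B : ModuleCat.{u} R} (f : A ⟶ B) :
    PureMono f ↔ ∀ M : ModuleCat.{u} Rᵐᵒᵖ, Mono (((tensorBifunctor R).obj M).map f) := by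
  rw [pureMono_iff_injective]
  refine forall_congr' fun M => ?_
  rw [ModuleCat.mono_iff_injective]
  rfl

/-- The embedding of a module into a product of character modules of `R`. -/
lemma exists_leftDual_apply_ne_zero {A : ModuleCat.{u} R} {a : A} (ha : a ≠ 0) :
    ∃ (M : ModuleCat.{u} Rᵐᵒᵖ) (g : A ⟶ leftDual R M), g a ≠ 0 := by
  obtain ⟨c, hc⟩ := CharacterModule.exists_character_apply_ne_zero_of_ne_zero ha
  let c' : A →+ AddCircle (1 : ℚ) := c
  -- The character `c'` becomes the linear map `a ↦ (r ↦ c' (r • a))`; its value at `r = 1` recovers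
  -- `c'`.
  refine ⟨ModuleCat.of Rᵐᵒᵖ R, ModuleCat.ofHom
    { toFun a := (c'.comp (AddMonoidHom.flip (AddMonoidHom.smul : R →+ A →+ A) a) :)
      map_add' x y := by
        ext r
        change c' (r • (x + y)) = c' (r • x) + c' (r • y)
        rw [smul_add, map_add]
      map_smul' s x := by
        ext r
        change c' (r • s • x) = c' ((r * s) • x)
        rw [mul_smul] }, fun h => hc ?_⟩
  have : c' ((1 : R) • a) = 0 := congr($h (1 : R))
  rwa [one_smul] at this

lemma PureMono.mono {A B : ModuleCat.{u} R} {f : A ⟶ B} (hf : PureMono f) : Mono f := by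
  rw [ModuleCat.mono_iff_injective]
  refine (injective_iff_map_eq_zero f.hom).2 fun a ha => ?_
  by_contra h
  obtain ⟨M, g, hg⟩ := exists_leftDual_apply_ne_zero h
  obtain ⟨k, rfl⟩ := hf M g
  refine hg ?_
  change k (f a) = 0
  have ha' : f a = 0 := ha
  rw [ha', map_zero]

/-- The functor `M ⊗_R -` is a left adjoint and preserves cokernels, so injectivity is the only
condition left. -/
lemma pureExact_iff (S : ShortComplex (ModuleCat.{u} R)) :
    pureExact R S ↔ S.ShortExact ∧ PureMono S.f := by
  constructor
  · exact fun h => ⟨h.1, (pureMono_iff_mono _).2 fun M => (h.2 M).mono_f⟩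
  · intro h
    refine ⟨h.1, fun M => ?_⟩
    have hM := (pureMono_iff_mono _).1 h.2 M
    have hS := h.1
    have : Epi S.g := hS.epi_g
    exact
      { exact := by
          refine ShortComplex.exact_of_g_is_cokernel _ ?_
          exact CokernelCofork.mapIsColimit _ hS.gIsCokernel ((tensorBifunctor R).obj M)
        mono_f := hM
        epi_g := inferInstanceAs (Epi (((tensorBifunctor R).obj M).map S.g)) }

lemma PureMono.extend {A B I : ModuleCat.{u} R} {f : A ⟶ B} (hf : PureMono f)
    (hI : pureInjective R I) (g : A ⟶ I) : ∃ h : B ⟶ I, f ≫ h = g := by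
  have := hf.mono
  exact hI (ShortComplex.mk f (cokernel.π f) (by simp)) ((pureExact_iff _).2
    ⟨{ exact := ShortComplex.exact_of_g_is_cokernel _ (cokernelIsCokernel f) }, hf⟩) g

lemma pureInjective_iff (I : ModuleCat.{u} R) : pureInjective R I ↔
    ∀ ⦃A B : ModuleCat.{u} R⦄ (f : A ⟶ B), PureMono f → ∀ g : A ⟶ I, ∃ h : B ⟶ I, f ≫ h = g :=
  ⟨fun hI _ _ _ hf g => hf.extend hI g, fun h S hS g => h S.f ((pureExact_iff S).1 hS).2 g⟩

lemma pureInjective_leftDual (M : ModuleCat.{u} Rᵐᵒᵖ) : pureInjective R (leftDual R M) :=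
  (pureInjective_iff _).2 fun _ _ _ hf g => hf M g

lemma pureMono_of_retraction {A B : ModuleCat.{u} R} {f : A ⟶ B} (r : B ⟶ A) (h : f ≫ r = 𝟙 A) :
    PureMono f := fun _ g => ⟨r ≫ g, by rw [← Category.assoc, h, Category.id_comp]⟩

lemma PureMono.comp {A B C : ModuleCat.{u} R} {f : A ⟶ B} {g : B ⟶ C} (hf : PureMono f)
    (hg : PureMono g) : PureMono (f ≫ g) := fun M k => by
  obtain ⟨h, rfl⟩ := hf M k
  obtain ⟨h', rfl⟩ := hg M h
  exact ⟨h', by simp⟩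

lemma PureMono.of_isIso {A B : ModuleCat.{u} R} (f : A ⟶ B) [IsIso f] : PureMono f :=
  pureMono_of_retraction (inv f) (by simp)

/-- A monomorphism with retractions on finite sets is pure. -/
lemma pureMono_of_locally_split {A B : ModuleCat.{u} R} (f : A ⟶ B)
    (h : ∀ s : Finset A, ∃ ρ : B ⟶ A, ∀ a ∈ s, ρ (f a) = a) : PureMono f := by
  classical
  rw [pureMono_iff_injective]
  intro M
  refine (injective_iff_map_eq_zero _).2 fun t ht => ?_
  -- A tensor involves finitely many elements of `A`, and a map that retracts `f` on these recovers
  -- the tensor from its image.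
  suffices H : ∃ s : Finset A, ∀ ρ : B ⟶ A, (∀ a ∈ s, ρ (f a) = a) →
      balancedMap R (LinearMap.id : M →ₗ[Rᵐᵒᵖ] M) ρ.hom (balancedMap R LinearMap.id f.hom t) = t by
    obtain ⟨s, hs⟩ := H
    obtain ⟨ρ, hρ⟩ := h s
    rw [← hs ρ hρ, ht, map_zero]
  clear ht
  obtain ⟨t, rfl⟩ := Submodule.Quotient.mk_surjective _ t
  induction t using TensorProduct.induction_on with
  | zero => exact ⟨∅, fun ρ _ => by simp⟩
  | tmul m a =>
    refine ⟨{a}, fun ρ hρ => ?_⟩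
    change balancedMap R _ _ (balancedMap R _ _ (btmul R m a)) = btmul R m a
    rw [balancedMap_btmul, balancedMap_btmul]
    exact congrArg (btmul R m) (hρ a (by simp))
  | add x y hx hy =>
    obtain ⟨s, hs⟩ := hx
    obtain ⟨s', hs'⟩ := hy
    refine ⟨s ∪ s', fun ρ hρ => ?_⟩
    rw [Submodule.Quotient.mk_add, map_add, map_add,
      hs ρ fun a ha => hρ a (Finset.mem_union_left _ ha),
      hs' ρ fun a ha => hρ a (Finset.mem_union_right _ ha)]

end Pure

end KFlatModel

end



noncomputable section

namespace KFlatModel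

/-! ### Finitely presented modules lift along pure exact complexes -/

section FinitePresentation

variable {R : Type u} [Ring R]

/-- Exactness of `M ⊗_R A ⟶ M ⊗_R B ⟶ M ⊗_R C` for all `M`, expressed by characters. -/
def PureExactAt {A B C : ModuleCat.{u} R} (f : A ⟶ B) (g : B ⟶ C) : Prop :=
  ∀ (M : ModuleCat.{u} Rᵐᵒᵖ) (φ : B ⟶ leftDual R M), f ≫ φ = 0 →
    ∃ ψ : C ⟶ leftDual R M, g ≫ ψ = φ

lemma pureExactAt_iff_exact {A B C : ModuleCat.{u} R} {f : A ⟶ B} {g : B ⟶ C} (h : f ≫ g = 0) :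
    PureExactAt f g ↔ ∀ M : ModuleCat.{u} Rᵐᵒᵖ,
      Function.Exact (balancedMap R (LinearMap.id : M →ₗ[Rᵐᵒᵖ] M) f.hom)
        (balancedMap R (LinearMap.id : M →ₗ[Rᵐᵒᵖ] M) g.hom) := by
  refine forall_congr' fun M => ?_
  have key := exact_iff_character
    (balancedMap R (LinearMap.id : M →ₗ[Rᵐᵒᵖ] M) f.hom).toAddMonoidHom
    (balancedMap R (LinearMap.id : M →ₗ[Rᵐᵒᵖ] M) g.hom).toAddMonoidHom (by
      have h' : ((balancedMap R (LinearMap.id : M →ₗ[Rᵐᵒᵖ] M) g.hom).toAddMonoidHom).comp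
          (balancedMap R (LinearMap.id : M →ₗ[Rᵐᵒᵖ] M) f.hom).toAddMonoidHom = 0 :=
        balanced_hom_ext R fun m n => by
          change btmul R m (g (f n)) = 0
          have : g (f n) = 0 := congr($h n)
          rw [this, btmul_zero]
      exact fun a => DFunLike.congr_fun h' a)
  refine Iff.trans ?_ key.symm
  constructor
  · intro H φ hφ
    obtain ⟨ψ, hψ⟩ := H (ModuleCat.ofHom (tensorCurry R φ)) (by
      ext n
      refine RightHom.ext R fun m => ?_
      exact congr($hφ (btmul R m n)))
    exact ⟨(tensorCurry R).symm ψ.hom, balanced_hom_ext R fun m n => congr($hψ n m)⟩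
  · intro H φ hφ
    obtain ⟨ψ, hψ⟩ := H ((tensorCurry R).symm φ.hom)
      (balanced_hom_ext R fun m n => congr($hφ n m))
    refine ⟨ModuleCat.ofHom (tensorCurry R ψ), ?_⟩
    ext n
    refine RightHom.ext R fun m => ?_
    exact congr($hψ (btmul R m n))

lemma PureExactAt.exact {A B C : ModuleCat.{u} R} {f : A ⟶ B} {g : B ⟶ C} (h : PureExactAt f g)
    (b : B) (hb : g b = 0) : ∃ a, f a = b := by
  by_contra hb'
  have : (Submodule.mkQ (LinearMap.range f.hom) b) ≠ 0 := fun h0 =>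
    hb' ((Submodule.Quotient.mk_eq_zero _).1 h0)
  obtain ⟨M, φ, hφ⟩ := exists_leftDual_apply_ne_zero
    (A := ModuleCat.of R (B ⧸ LinearMap.range f.hom)) this
  obtain ⟨ψ, hψ⟩ := h M (ModuleCat.ofHom (Submodule.mkQ (LinearMap.range f.hom)) ≫ φ) (by
    ext a
    change φ (Submodule.mkQ (LinearMap.range f.hom) (f a)) = 0
    have : Submodule.mkQ (LinearMap.range f.hom) (f a) = 0 :=
      (Submodule.Quotient.mk_eq_zero _).2 ⟨a, rfl⟩
    rw [this]
    exact map_zero φ.hom)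
  refine hφ ?_
  have := congr($hψ b)
  change ψ (g b) = _ at this
  rw [hb, map_zero] at this
  exact this.symm

lemma btmul_smul {M N : Type u} [AddCommGroup M] [Module Rᵐᵒᵖ M] [AddCommGroup N] [Module R N]
    (m : M) (r : R) (n : N) : btmul R m (r • n) = btmul R (MulOpposite.op r • m) n :=
  have h : btmul R (MulOpposite.op r • m) n = btmul R m (r • n) :=
    (Submodule.Quotient.eq _).2 (Submodule.subset_span ⟨m, r, n, rfl⟩)
  h.symm

/-- The right module presented by the columns of a matrix. -/
abbrev ColumnModule {m n : ℕ} (a : Fin n → Fin m → R) : Type u :=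
  (Fin n → R) ⧸ Submodule.span Rᵐᵒᵖ (Set.range fun j i => a i j)

section

variable {m n : ℕ} (a : Fin n → Fin m → R) {A : Type u} [AddCommGroup A] [Module R A]

/-- The additive map `y ↦ (∑ⱼ aᵢⱼ yⱼ)ᵢ`. -/
def matrixMap : (Fin m → A) →+ (Fin n → A) where
  toFun y i := ∑ j, a i j • y j
  map_zero' := by ext; simp
  map_add' x y := by ext; simp [Finset.sum_add_distrib]

/-- The class of the `i`-th basis vector. -/
def columnBasis (i : Fin n) : ColumnModule a :=
  Submodule.Quotient.mk (Pi.single i 1)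

lemma exists_eq_sum_columnBasis (t : BalancedTensor R (ColumnModule a) A) :
    ∃ x : Fin n → A, t = ∑ i, btmul R (columnBasis a i) (x i) := by
  obtain ⟨t, rfl⟩ := Submodule.Quotient.mk_surjective _ t
  induction t using TensorProduct.induction_on with
  | zero => exact ⟨0, by simp [btmul_zero]⟩
  | add x y hx hy =>
    obtain ⟨x', hx'⟩ := hx
    obtain ⟨y', hy'⟩ := hy
    refine ⟨x' + y', ?_⟩
    rw [Submodule.Quotient.mk_add, hx', hy', ← Finset.sum_add_distrib]
    refine Finset.sum_congr rfl fun i _ => ?_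
    simp [btmul, TensorProduct.tmul_add]
  | tmul v x =>
    obtain ⟨v, rfl⟩ := Submodule.Quotient.mk_surjective _ v
    refine ⟨fun i => v i • x, ?_⟩
    have h1 : ∀ i, btmul R (columnBasis a i) (v i • x) =
        btmul R (MulOpposite.op (v i) • columnBasis a i) x := fun i =>
      btmul_smul _ _ _
    have h2 : (Submodule.Quotient.mk v : ColumnModule a) =
        ∑ i, MulOpposite.op (v i) • columnBasis a i := by
      have : v = ∑ i, MulOpposite.op (v i) • (Pi.single i 1 : Fin n → R) := by
        ext k
        simp [Finset.sum_apply, Pi.single_apply]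
      conv_lhs => rw [this]
      exact map_sum (Submodule.mkQ _) _ _
    change btmul R (Submodule.Quotient.mk v : ColumnModule a) x = _
    simp_rw [h1]
    rw [h2]
    simp [btmul, TensorProduct.sum_tmul, map_sum]

/-- By right exactness, tensoring the column module with `A` gives the cokernel of `matrixMap a` on
`A`. Only the map to this cokernel `Q` is needed; it is the transpose of `Φ` under `tensorCurry`. -/
lemma exists_solution_of_sum_eq_zero (c : Fin n → A)
    (hc : ∑ i, btmul R (columnBasis a i) (c i) = 0) :
    ∃ y : Fin m → A, ∀ i, c i = ∑ j, a i j • y j := by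
  let Q := (Fin n → A) ⧸ (matrixMap a (A := A)).range
  let q : (Fin n → A) →+ Q := QuotientAddGroup.mk' _
  let ev (x : A) : (Fin n → R) →+ Q := q.comp
    { toFun v i := v i • x
      map_zero' := by ext; simp
      map_add' v w := by ext; simp [add_smul] }
  have hev (x : A) (v : Fin n → R)
      (hv : v ∈ Submodule.span Rᵐᵒᵖ (Set.range fun j i => a i j)) : ev x v = 0 := by
    induction hv using Submodule.span_induction generalizing x with
    | mem v hv =>
      obtain ⟨j, rfl⟩ := hv
      refine (QuotientAddGroup.eq_zero_iff _).2 ⟨Pi.single j x, ?_⟩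
      ext i
      simp [matrixMap, Pi.single_apply]
    | zero => exact map_zero _
    | add v w _ _ hv hw => rw [map_add, hv, hw, add_zero]
    | smul r v _ hv =>
      have : ev x (r • v) = ev (r.unop • x) v := by
        simp [ev, mul_smul]
      rw [this, hv]
  let L (x : A) : RightHom R (ColumnModule a) Q := QuotientAddGroup.lift
    (Submodule.span Rᵐᵒᵖ (Set.range fun j i => a i j)).toAddSubgroup (ev x) (hev x)
  let Φ : A →ₗ[R] RightHom R (ColumnModule a) Q :=
    { toFun := L
      map_add' x y := by
        refine RightHom.ext R fun v => ?_
        obtain ⟨v, rfl⟩ := Submodule.Quotient.mk_surjective _ v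
        change ev (x + y) v = ev x v + ev y v
        simp only [ev, AddMonoidHom.comp_apply, AddMonoidHom.coe_mk, ZeroHom.coe_mk, smul_add]
        exact map_add q _ _
      map_smul' r x := by
        refine RightHom.ext R fun v => ?_
        obtain ⟨v, rfl⟩ := Submodule.Quotient.mk_surjective _ v
        change ev (r • x) v = ev x (MulOpposite.op r • v)
        simp [ev, mul_smul] }
  have h := congrArg ((tensorCurry R).symm Φ) hc
  rw [map_sum, map_zero] at h
  have h' : q c = 0 := by
    rw [← h]
    have : c = ∑ i, fun k => (Pi.single i (1 : R) : Fin n → R) k • c i := by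
      ext k
      simp [Finset.sum_apply, Pi.single_apply, ite_smul]
    conv_lhs => rw [this]
    rw [map_sum]
    rfl
  obtain ⟨y, hy⟩ := (QuotientAddGroup.eq_zero_iff _).1 h'
  exact ⟨y, fun i => congr($hy.symm i)⟩

end

/-- Finitely presented modules lift along a complex that is exact after tensoring. -/
lemma exists_lift_of_pureExactAt {C₃ C₂ C₁ C₀ C' : ModuleCat.{u} R} {d₃ : C₃ ⟶ C₂} {d₂ : C₂ ⟶ C₁}
    {d₁ : C₁ ⟶ C₀} {d₀ : C₀ ⟶ C'} (w₃ : d₃ ≫ d₂ = 0) (w₂ : d₂ ≫ d₁ = 0)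
    (h₃ : PureExactAt d₃ d₂) (h₂ : PureExactAt d₂ d₁) (h₁ : PureExactAt d₁ d₀)
    (F : ModuleCat.{u} R) [Module.FinitePresentation R F] (f : F ⟶ C₀) (hf : f ≫ d₀ = 0) :
    ∃ g : F ⟶ C₁, g ≫ d₁ = f := by
  obtain ⟨m, K, e, hK⟩ := Module.FinitePresentation.exists_fin R F
  obtain ⟨n, a, ha⟩ := Submodule.fg_iff_exists_fin_generating_family.1 hK
  have hd₁ (x : C₂) : d₁ (d₂ x) = 0 := congr($w₂ x)
  have hd₂ (x : C₃) : d₂ (d₃ x) = 0 := congr($w₃ x)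
  let π : (Fin m → R) →ₗ[R] F := e.symm.toLinearMap ∘ₗ K.mkQ
  let x (j : Fin m) : C₀ := f (π (Pi.single j 1))
  have hπ (v : Fin m → R) : f (π v) = ∑ j, v j • x j := by
    have : v = ∑ j, v j • (Pi.single j (1 : R) : Fin m → R) := by
      ext k
      simp [Finset.sum_apply, Pi.single_apply]
    conv_lhs => rw [this]
    simp only [map_sum, map_smul]
    rfl
  have hax (i : Fin n) : ∑ j, a i j • x j = 0 := by
    rw [← hπ]
    have : π (a i) = 0 := by
      change e.symm (K.mkQ (a i)) = 0
      rw [Submodule.mkQ_apply, (Submodule.Quotient.mk_eq_zero K).2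
        (ha ▸ Submodule.subset_span ⟨i, rfl⟩), map_zero]
    rw [this]
    exact map_zero f.hom
  -- The generators of `F` are lifted arbitrarily to `y`; the `i`-th relation then fails by a
  -- boundary `d₂ (b i)`, and `y` has to be corrected by boundaries.
  choose y hy using fun j => h₁.exact (x j) (congr($hf (π (Pi.single j 1))))
  choose b hb using fun i => h₂.exact (∑ j, a i j • y j) (by
    rw [map_sum]; simp only [map_smul, hy, hax])
  -- With `e i` the basis classes of the column module, `∑ e i ⊗ d₂ (b i)` vanishes, because the
  -- columns of the relations are zero in `M`. Exactness of `M ⊗_R -` at `C₂` therefore provides `z`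
  -- with `∑ e i ⊗ (b i - d₃ (z i)) = 0`, that is, `b i - d₃ (z i) = ∑ a i j • v j` for some `v`.
  -- Since `d₂ d₃ = 0`, the elements `y j - d₂ (v j)` satisfy the relations.
  let M : ModuleCat.{u} Rᵐᵒᵖ := ModuleCat.of Rᵐᵒᵖ (ColumnModule a)
  obtain ⟨t, ht⟩ := ((pureExactAt_iff_exact w₃).1 h₃ M (∑ i, btmul R (columnBasis a i) (b i))).1 (by
    rw [map_sum]
    change ∑ i, btmul R (columnBasis a i) (d₂ (b i)) = 0
    simp_rw [hb]
    have key : ∀ v : Fin m → C₁, ∑ i, btmul R (columnBasis a i) (∑ j, a i j • v j) = 0 := by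
      intro v
      have h1 : ∀ i j, btmul R (columnBasis a i) (a i j • v j) =
          btmul R (MulOpposite.op (a i j) • columnBasis a i) (v j) := fun i j =>
        btmul_smul _ _ _
      have h2 : ∀ j, ∑ i, MulOpposite.op (a i j) • columnBasis a i = 0 := fun j => by
        have : (fun i => a i j) =
            ∑ i, MulOpposite.op (a i j) • (Pi.single i 1 : Fin n → R) := by
          ext k
          simp [Finset.sum_apply, Pi.single_apply]
        have h3 : (Submodule.Quotient.mk (fun i => a i j) : ColumnModule a) = 0 :=
          (Submodule.Quotient.mk_eq_zero _).2 (Submodule.subset_span ⟨j, rfl⟩)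
        rw [this] at h3
        rw [← h3]
        exact (map_sum (Submodule.mkQ _) _ _).symm
      have h4 : ∀ i, btmul R (columnBasis a i) (∑ j, a i j • v j) =
          ∑ j, btmul R (columnBasis a i) (a i j • v j) := fun i => by
        simp [btmul, TensorProduct.tmul_sum, map_sum]
      simp_rw [h4, h1]
      rw [Finset.sum_comm]
      refine Finset.sum_eq_zero fun j _ => ?_
      have h5 : ∑ i, btmul R (MulOpposite.op (a i j) • columnBasis a i) (v j) =
          btmul R (∑ i, MulOpposite.op (a i j) • columnBasis a i) (v j) := by
        simp [btmul, TensorProduct.sum_tmul, map_sum]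
      rw [h5, h2, zero_btmul]
    exact key y)
  obtain ⟨z, rfl⟩ := exists_eq_sum_columnBasis a t
  rw [map_sum] at ht
  obtain ⟨v, hv⟩ := exists_solution_of_sum_eq_zero a (fun i => b i - d₃ (z i)) (by
    have h1 : ∀ i, btmul R (columnBasis a i) (b i - d₃ (z i)) =
        btmul R (columnBasis a i) (b i) - btmul R (columnBasis a i) (d₃ (z i)) := fun i => by
      simp [btmul, TensorProduct.tmul_sub]
    simp_rw [h1]
    rw [Finset.sum_sub_distrib, ← ht, sub_eq_zero]
    rfl)
  let y' (j : Fin m) : C₁ := y j - d₂ (v j)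
  have hy' (i : Fin n) : ∑ j, a i j • y' j = 0 := by
    simp only [y', smul_sub, Finset.sum_sub_distrib, ← hb]
    rw [sub_eq_zero]
    have := congrArg d₂ (hv i)
    rw [map_sub, hd₂, sub_zero] at this
    rw [this, map_sum]
    simp only [map_smul]
  let g₀ : (Fin m → R) →ₗ[R] C₁ := Fintype.linearCombination R y'
  have hg₀ : K ≤ LinearMap.ker g₀ := by
    rw [← ha, Submodule.span_le]
    rintro _ ⟨i, rfl⟩
    exact hy' i
  refine ⟨ModuleCat.ofHom (K.liftQ g₀ hg₀ ∘ₗ e.toLinearMap), ?_⟩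
  ext w
  obtain ⟨w, rfl⟩ := e.symm.surjective w
  obtain ⟨w, rfl⟩ := Submodule.Quotient.mk_surjective _ w
  change d₁ (K.liftQ g₀ hg₀ (e (e.symm (Submodule.Quotient.mk w)))) = f (π w)
  rw [e.apply_symm_apply, hπ]
  change d₁ (∑ j, w j • y' j) = _
  rw [map_sum]
  refine Finset.sum_congr rfl fun j _ => ?_
  rw [map_smul, map_sub, hd₁, sub_zero, hy]

/-- The sequence is padded by a zero map on either side, which gives the five-term complex required
by `exists_lift_of_pureExactAt`. -/
lemma pureExact_pureExactAt {S : ShortComplex (ModuleCat.{u} R)} (hS : pureExact R S) :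
    PureExactAt S.f S.g ∧ PureExactAt (0 : S.X₁ ⟶ S.X₁) S.f ∧
      PureExactAt S.g (0 : S.X₃ ⟶ S.X₃) := by
  obtain ⟨h, hf⟩ := (pureExact_iff S).1 hS
  have := h.epi_g
  refine ⟨fun M φ hφ => ?_, fun M φ _ => hf M φ, fun M φ hφ => ⟨0, ?_⟩⟩
  · exact ⟨h.gIsCokernel.desc (CokernelCofork.ofπ φ hφ),
      h.gIsCokernel.fac _ WalkingParallelPair.one⟩
  · rw [comp_zero, ← cancel_epi S.g, hφ, comp_zero]

lemma pureExact.exists_lift {S : ShortComplex (ModuleCat.{u} R)} (hS : pureExact R S)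
    (F : ModuleCat.{u} R) [Module.FinitePresentation R F] (f : F ⟶ S.X₃) :
    ∃ g : F ⟶ S.X₂, g ≫ S.g = f := by
  obtain ⟨h1, h2, h3⟩ := pureExact_pureExactAt hS
  exact exists_lift_of_pureExactAt (by simp) S.zero h2 h1 h3 F f (by simp)

end FinitePresentation

end KFlatModel

end
-- Testing pure-injectivity on a set of pure monomorphisms.
noncomputable section
namespace KFlatModel

/-! ### Covers by finitely presented modules -/

section Cover

variable {R : Type u} [Ring R]

lemma exists_comp_eq_of_surjective {X B I : Type*} [AddCommGroup X] [Module R X] [AddCommGroup B]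
    [Module R B] [AddCommGroup I] [Module R I] (s : X →ₗ[R] B) (hs : Function.Surjective s)
    (t : X →ₗ[R] I) (h : ∀ x, s x = 0 → t x = 0) : ∃ t' : B →ₗ[R] I, t' ∘ₗ s = t := by
  refine ⟨(LinearMap.ker s).liftQ t (fun x hx => h x hx) ∘ₗ
    (s.quotKerEquivOfSurjective hs).symm.toLinearMap, ?_⟩
  ext x
  have : (s.quotKerEquivOfSurjective hs).symm (s x) = Submodule.Quotient.mk x :=
    (LinearEquiv.symm_apply_eq _).2 rfl
  simp only [LinearMap.comp_apply, LinearEquiv.coe_coe, this]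
  exact Submodule.liftQ_apply _ _ x

lemma exists_comp_eq_of_injective {A B X : Type*} [AddCommGroup X] [Module R X] [AddCommGroup B]
    [Module R B] [AddCommGroup A] [Module R A] (f : A →ₗ[R] B) (hf : Function.Injective f)
    (t : X →ₗ[R] B) (h : ∀ x, t x ∈ LinearMap.range f) : ∃ t' : X →ₗ[R] A, f ∘ₗ t' = t := by
  refine ⟨(LinearEquiv.ofInjective f hf).symm.toLinearMap ∘ₗ t.codRestrict _ h, ?_⟩
  ext x
  exact congrArg Subtype.val ((LinearEquiv.ofInjective f hf).apply_symm_apply ⟨t x, h x⟩)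

section DirectSum

variable {ι : Type u} (M : ι → Type u) [∀ i, AddCommGroup (M i)] [∀ i, Module R (M i)]

/-- The direct sum of a family of modules. -/
def DSum : Type u := Π₀ i, M i

instance : AddCommGroup (DSum M) := inferInstanceAs (AddCommGroup (Π₀ i, M i))

instance : Module R (DSum M) := inferInstanceAs (Module R (Π₀ i, M i))

variable {M}

open Classical in
variable (R) in
/-- The inclusion of a summand of a direct sum. -/
def DSum.incl (i : ι) : M i →ₗ[R] DSum M where
  toFun x := (DFinsupp.single i x : Π₀ i, M i)
  map_add' := DFinsupp.single_add i
  map_smul' := DFinsupp.single_smul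

variable (R) in
/-- The projection to a summand of a direct sum. -/
def DSum.proj (i : ι) : DSum M →ₗ[R] M i where
  toFun x := (show (Π₀ i, M i) from x) i
  map_add' x y := DFinsupp.add_apply x y i
  map_smul' r x := DFinsupp.smul_apply r x i

open Classical in
/-- The map from a direct sum that is given by maps from the summands. -/
def DSum.desc {B : Type u} [AddCommGroup B] [Module R B] (f : ∀ i, M i →ₗ[R] B) :
    DSum M →ₗ[R] B where
  toFun x := DFinsupp.lsum ℕ f (show (Π₀ i, M i) from x)
  map_add' x y := map_add (DFinsupp.lsum ℕ f) x y
  map_smul' r x := map_smul (DFinsupp.lsum ℕ f) r x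

@[simp] lemma DSum.desc_incl {B : Type u} [AddCommGroup B] [Module R B]
    (f : ∀ i, M i →ₗ[R] B) (i : ι) (x : M i) :
    DSum.desc f (DSum.incl R i x) = f i x := by
  classical
  exact DFinsupp.lsum_single (R := R) ℕ f i x

variable (R) in
lemma DSum.exists_finset (x : DSum M) : ∃ J : Finset ι, ∀ J', J ⊆ J' →
    ∑ j ∈ J', DSum.incl R j (DSum.proj R j x) = x := by
  classical
  let x' : Π₀ i, M i := x
  refine ⟨x'.support, fun J' hJ' => ?_⟩
  refine Eq.trans ?_ (DFinsupp.sum_single (f := x'))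
  refine (Finset.sum_subset hJ' fun i _ hi => ?_).symm
  exact (congrArg (fun y : M i => (DFinsupp.single i y : Π₀ i, M i))
    (DFinsupp.notMem_support_iff.1 hi)).trans (DFinsupp.single_zero _)

lemma DSum.hom_ext {B : Type u} [AddCommGroup B] [Module R B] {f g : DSum M →ₗ[R] B}
    (h : ∀ (i : ι) (x : M i), f (DSum.incl R i x) = g (DSum.incl R i x)) : f = g := by
  ext x
  obtain ⟨J, hJ⟩ := DSum.exists_finset R x
  rw [← hJ J subset_rfl, map_sum, map_sum]
  exact Finset.sum_congr rfl fun i _ => h i _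

end DirectSum

variable (R) in
/-- The finite presentations, up to isomorphism, of left modules. -/
def FpCode : Type u := Σ k : ℕ, {N : Submodule R (Fin k → R) // N.FG}

/-- The module with a given finite presentation. -/
def FpCode.Mod (c : FpCode R) : Type u := (Fin c.1 → R) ⧸ c.2.1

instance (c : FpCode R) : AddCommGroup c.Mod := inferInstanceAs (AddCommGroup ((Fin c.1 → R) ⧸ c.2.1))

instance (c : FpCode R) : Module R c.Mod := inferInstanceAs (Module R ((Fin c.1 → R) ⧸ c.2.1))

/-- The quotient map of a finite presentation. -/
def FpCode.quot (c : FpCode R) : (Fin c.1 → R) →ₗ[R] c.Mod := c.2.1.mkQ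

lemma FpCode.quot_surjective (c : FpCode R) : Function.Surjective c.quot :=
  Submodule.mkQ_surjective _

lemma FpCode.ker_quot (c : FpCode R) : LinearMap.ker c.quot = c.2.1 := Submodule.ker_mkQ _

instance FpCode.finitePresentation (c : FpCode R) : Module.FinitePresentation R c.Mod :=
  Module.finitePresentation_of_surjective c.quot c.quot_surjective
    (by rw [c.ker_quot]; exact c.2.2)

lemma FpCode.exists_equiv (F : Type u) [AddCommGroup F] [Module R F]
    [Module.FinitePresentation R F] : ∃ c : FpCode R, Nonempty (F ≃ₗ[R] c.Mod) := by
  obtain ⟨k, K, e, hK⟩ := Module.FinitePresentation.exists_fin R F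
  exact ⟨⟨k, K, hK⟩, ⟨e⟩⟩

variable (R) in
/-- The indexing set of the finitely presented modules over `N`. -/
abbrev FpIndex (N : Type u) [AddCommGroup N] [Module R N] : Type u := Σ c : FpCode R, c.Mod →ₗ[R] N

variable (R) in
/-- The direct sum of all finitely presented modules over `N`. -/
abbrev FpCover (N : Type u) [AddCommGroup N] [Module R N] : Type u :=
  DSum fun i : FpIndex R N => i.1.Mod

section

variable (N : Type u) [AddCommGroup N] [Module R N]

/-- The canonical map from the cover by finitely presented modules. -/
def fpCoverMap : FpCover R N →ₗ[R] N := DSum.desc fun i => i.2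

@[simp] lemma fpCoverMap_incl {N : Type u} [AddCommGroup N] [Module R N] (i : FpIndex R N)
    (x : i.1.Mod) : fpCoverMap N (DSum.incl R i x) = i.2 x := DSum.desc_incl _ _ _

lemma fpCoverMap_surjective : Function.Surjective (fpCoverMap (R := R) N) := fun n => by
  obtain ⟨c, ⟨e⟩⟩ := FpCode.exists_equiv (R := R) R
  exact ⟨DSum.incl R ⟨c, LinearMap.toSpanSingleton R N n ∘ₗ e.symm.toLinearMap⟩ (e 1),
    (fpCoverMap_incl _ _).trans (by simp)⟩

/-- The kernel of the cover by finitely presented modules. -/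
abbrev FpKernel : Submodule R (FpCover R N) := LinearMap.ker (fpCoverMap (R := R) N)

/-- Local retractions come from the abundance of summands. A finite set `s` in the kernel lies in a
finite partial sum `Q`, and the quotient of `Q` by the span `T` of `s` is finitely presented and
still maps to `N`, so up to isomorphism it is itself a summand of the cover. The projection to `Q`
minus its image in that summand has values in the kernel, and it fixes `s` because `s` vanishes in
`Q ⧸ T`. -/
lemma pureMono_fpKernel :
    PureMono (ModuleCat.ofHom (FpKernel (R := R) N).subtype) := by
  classical
  refine pureMono_of_locally_split _ fun s => ?_
  choose J₀ hJ₀ using fun x : FpCover R N => DSum.exists_finset R x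
  let J : Finset (FpIndex R N) := s.sup fun x => J₀ x.1
  let Q := ∀ j : J, j.1.1.Mod
  let res : FpCover R N →ₗ[R] Q := LinearMap.pi fun j => DSum.proj R j.1
  let inc : Q →ₗ[R] FpCover R N := ∑ j : J, DSum.incl R j.1 ∘ₗ LinearMap.proj j
  have hs (x) (hx : x ∈ s) : inc (res x.1) = x.1 := by
    have h0 : inc (res x.1) = ∑ j : J, DSum.incl R j.1 (DSum.proj R j.1 x.1) := by
      simp only [inc, LinearMap.sum_apply]
      rfl
    rw [h0, Finset.sum_coe_sort J fun j => DSum.incl R j (DSum.proj R j x.1)]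
    exact hJ₀ x.1 J (Finset.le_sup (f := fun x : FpKernel (R := R) N => J₀ x.1) hx)
  let T : Submodule R Q := Submodule.span R (s.image fun x => res x.1)
  have : Module.FinitePresentation R (Q ⧸ T) :=
    Module.finitePresentation_of_surjective T.mkQ (Submodule.mkQ_surjective _)
      (by rw [Submodule.ker_mkQ]; exact ⟨_, rfl⟩)
  obtain ⟨c, ⟨e⟩⟩ := FpCode.exists_equiv (R := R) (Q ⧸ T)
  let π : (Q ⧸ T) →ₗ[R] N := T.liftQ (fpCoverMap N ∘ₗ inc) (by
    refine Submodule.span_le.2 ?_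
    intro y hy
    obtain ⟨x, hx, rfl⟩ := Finset.mem_image.1 (Finset.mem_coe.1 hy)
    change fpCoverMap N (inc (res x.1)) = 0
    rw [hs x hx]
    exact x.2)
  let ρ : FpCover R N →ₗ[R] FpCover R N :=
    inc ∘ₗ res - DSum.incl R ⟨c, π ∘ₗ e.symm.toLinearMap⟩ ∘ₗ e.toLinearMap ∘ₗ T.mkQ ∘ₗ res
  have hρ (x) : ρ x ∈ FpKernel (R := R) N := by
    refine LinearMap.mem_ker.2 ((map_sub _ _ _).trans (sub_eq_zero.2 ?_))
    refine Eq.trans ?_ (fpCoverMap_incl ⟨c, π ∘ₗ e.symm.toLinearMap⟩ _).symm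
    change _ = π (e.symm (e (T.mkQ (res x))))
    rw [e.symm_apply_apply]
    rfl
  refine ⟨ModuleCat.ofHom (ρ.codRestrict _ hρ), fun x hx => Subtype.ext ?_⟩
  change inc (res x.1) - DSum.incl R ⟨c, π ∘ₗ e.symm.toLinearMap⟩ (e (T.mkQ (res x.1))) = x.1
  have : T.mkQ (res x.1) = 0 :=
    (Submodule.Quotient.mk_eq_zero _).2 (Submodule.subset_span
      (Finset.mem_coe.2 (Finset.mem_image_of_mem _ hx)))
  rw [hs x hx, this, map_zero, map_zero, sub_zero]

end

section

variable {A B C I : Type u} [AddCommGroup A] [Module R A] [AddCommGroup B] [Module R B]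
  [AddCommGroup C] [Module R C] [AddCommGroup I] [Module R I]

/-- All maps from finitely presented modules to the target of `g` lift. -/
def FpLifts (g : B →ₗ[R] C) : Prop :=
  ∀ (c : FpCode R) (f : c.Mod →ₗ[R] C), ∃ h : c.Mod →ₗ[R] B, g ∘ₗ h = f

lemma FpLifts.exists_fpCover_lift {g : B →ₗ[R] C} (hg : FpLifts g) :
    ∃ h : FpCover R C →ₗ[R] B, g ∘ₗ h = fpCoverMap C := by
  choose h hh using hg
  refine ⟨DSum.desc fun i => h i.1 i.2, DSum.hom_ext fun i x => ?_⟩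
  have := congr($(hh i.1 i.2) x)
  simpa using this

/-- Maps extend along the kernel of a map `g` that lifts finitely presented modules, if they do so
along the kernel of the canonical cover of the target. -/
lemma exists_extension_of_fpCover (f : A →ₗ[R] B) (g : B →ₗ[R] C) (hg : FpLifts g)
    (hf : Function.Injective f) (hfg : Function.Exact f g)
    (hI : ∀ u : FpKernel (R := R) C →ₗ[R] I,
      ∃ w : FpCover R C →ₗ[R] I, w ∘ₗ (FpKernel (R := R) C).subtype = u)
    (t : A →ₗ[R] I) : ∃ t' : B →ₗ[R] I, t' ∘ₗ f = t := by
  obtain ⟨h, hh⟩ := hg.exists_fpCover_lift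
  have hh' (x) : g (h x) = fpCoverMap C x := congr($hh x)
  obtain ⟨v, hv⟩ := exists_comp_eq_of_injective f hf (h ∘ₗ (FpKernel (R := R) C).subtype)
    fun x => (hfg _).1 ((hh' _).trans x.2)
  obtain ⟨w, hw⟩ := hI (t ∘ₗ v)
  -- `B` is the quotient of `A × FpCover R C` by the pairs `(-v p, p)` with `p` in the kernel of the
  -- cover. As `w p = t (v p)` for such `p`, the maps `t` and `w` glue to a map on `B`.
  obtain ⟨t', ht'⟩ := exists_comp_eq_of_surjective (f.coprod h) (fun b => by
    obtain ⟨p, hp⟩ := fpCoverMap_surjective (R := R) C (g b)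
    obtain ⟨a, ha⟩ := (hfg (b - h p)).1 (by rw [map_sub, hh', hp, sub_self])
    exact ⟨(a, p), by simp [ha]⟩) (t.coprod w) (by
      rintro ⟨a, p⟩ hap
      simp only [LinearMap.coprod_apply] at hap ⊢
      have hp : fpCoverMap C p = 0 := by
        rw [← hh', ← zero_add (g (h p)), ← hfg.apply_apply_eq_zero a, ← map_add, hap, map_zero,
          hfg.apply_apply_eq_zero a]
      have h1 : f (v ⟨p, hp⟩) = h p := congr($hv ⟨p, hp⟩)
      have h2 : w p = t (v ⟨p, hp⟩) := congr($hw ⟨p, hp⟩)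
      have h3 : a + v ⟨p, hp⟩ = 0 := hf (by rw [map_add, h1, hap, map_zero])
      rw [h2, ← map_add, h3, map_zero])
  refine ⟨t', ?_⟩
  ext a
  simpa using congr($ht' (a, 0))

/-- Kernels of maps that lift finitely presented modules are pure. -/
lemma pureMono_of_fpLifts (f : A →ₗ[R] B) (g : B →ₗ[R] C) (hg : FpLifts g)
    (hf : Function.Injective f) (hfg : Function.Exact f g) : PureMono (ModuleCat.ofHom f) := by
  intro M t
  obtain ⟨t', ht'⟩ := exists_extension_of_fpCover f g hg hf hfg (fun u => by
    obtain ⟨w, hw⟩ := pureMono_fpKernel C M (ModuleCat.ofHom u)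
    exact ⟨w.hom, congr(($hw).hom)⟩) t.hom
  exact ⟨ModuleCat.ofHom t', ModuleCat.hom_ext ht'⟩

end

end Cover

/-! ### Submodules closed under solving finite systems of linear equations -/

section SystemPure

variable {R : Type u} [Ring R] {B : Type u} [AddCommGroup B] [Module R B]

/-- Finite systems of linear equations with constants in `D` that are solvable in `B` are solvable
in `D`. -/
def SystemPure (D : Submodule R B) : Prop :=
  ∀ ⦃m n : ℕ⦄ (a : Fin n → Fin m → R) (x : Fin m → B), (∀ i, ∑ j, a i j • x j ∈ D) →
    ∃ y : Fin m → B, (∀ j, y j ∈ D) ∧ ∀ i, ∑ j, a i j • y j = ∑ j, a i j • x j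

/-- Transitivity of purity: a solution modulo `D` is lifted to `y₀`, and the defect is a system with
constants in `D` that has the solution `x - y₀` in `B`, hence a solution `z` in `D`; then `y₀ + z`
works. -/
lemma SystemPure.comap_mkQ {D : Submodule R B} (hD : SystemPure D) {N : Submodule R (B ⧸ D)}
    (hN : SystemPure N) : SystemPure (N.comap D.mkQ) := by
  intro m n a x hx
  obtain ⟨y, hy, hy'⟩ := hN a (fun j => D.mkQ (x j)) (fun i => by
    have := hx i
    simpa only [Submodule.mem_comap, map_sum, map_smul] using this)
  choose y₀ hy₀ using fun j => Submodule.mkQ_surjective D (y j)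
  obtain ⟨z, hz, hz'⟩ := hD a (fun j => x j - y₀ j) (fun i => by
    rw [← Submodule.ker_mkQ D, LinearMap.mem_ker, map_sum]
    simp only [map_smul, map_sub, hy₀, smul_sub, Finset.sum_sub_distrib]
    rw [hy' i, sub_self])
  refine ⟨fun j => y₀ j + z j, fun j => ?_, fun i => ?_⟩
  · have : D.mkQ (z j) = 0 := (Submodule.Quotient.mk_eq_zero _).2 (hz j)
    rw [Submodule.mem_comap, map_add, hy₀, this, add_zero]
    exact hy j
  · simp only [smul_add, Finset.sum_add_distrib, hz', smul_sub, Finset.sum_sub_distrib]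
    abel

/-- Arbitrary lifts `x` of the images of the generators satisfy the relations up to constants in
`D`. A solution `y` in `D` with the same constants turns `x - y` into an exact solution, and
subtracting `y` does not change the image under `g`. -/
lemma SystemPure.fpLifts {D : Submodule R B} (hD : SystemPure D) {C : Type u} [AddCommGroup C]
    [Module R C] (g : B →ₗ[R] C) (hg : Function.Surjective g) (hgD : LinearMap.ker g = D) :
    FpLifts g := by
  intro c f
  obtain ⟨n, a, ha⟩ := Submodule.fg_iff_exists_fin_generating_family.1 c.2.2
  choose x hx using fun j => hg (f (c.quot (Pi.single j 1)))
  have key (v : Fin c.1 → R) : f (c.quot v) = g (∑ j, v j • x j) := by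
    have : v = ∑ j, v j • (Pi.single j (1 : R) : Fin c.1 → R) := by
      ext k
      simp [Finset.sum_apply, Pi.single_apply]
    conv_lhs => rw [this]
    simp only [map_sum, map_smul, hx]
  obtain ⟨y, hy, hy'⟩ := hD a x (fun i => by
    have h0 : a i ∈ LinearMap.ker c.quot := by
      rw [c.ker_quot, ← ha]
      exact Submodule.subset_span ⟨i, rfl⟩
    rw [← hgD, LinearMap.mem_ker, ← key, LinearMap.mem_ker.1 h0, map_zero])
  obtain ⟨h, hh⟩ := exists_comp_eq_of_surjective c.quot c.quot_surjective
    (Fintype.linearCombination R fun j => x j - y j) (by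
      suffices LinearMap.ker c.quot ≤
        LinearMap.ker (Fintype.linearCombination R fun j => x j - y j) from fun v hv => this hv
      rw [c.ker_quot, ← ha, Submodule.span_le]
      rintro _ ⟨i, rfl⟩
      simp [Fintype.linearCombination_apply, smul_sub, hy' i])
  refine ⟨h, LinearMap.ext fun w => ?_⟩
  obtain ⟨v, rfl⟩ := c.quot_surjective w
  have h0 : g (∑ j, v j • y j) = 0 := by
    rw [← LinearMap.mem_ker, hgD]
    exact Submodule.sum_mem _ fun j _ => D.smul_mem _ (hy j)
  have h1 : h (c.quot v) = _ := congr($hh v)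
  rw [LinearMap.comp_apply, h1, key, Fintype.linearCombination_apply]
  simp only [smul_sub, Finset.sum_sub_distrib, map_sub, h0, sub_zero]

/-- The rows of the system present a finitely presented module, and a solution whose constants lie
in the range defines a map from it to the cokernel. A lift of this map to `B` is a solution `z` of
the homogeneous system that is congruent to `x`, so `x - z` lies in the range. -/
lemma systemPure_range_of_pureMono {A : Type u} [AddCommGroup A] [Module R A] {f : A →ₗ[R] B}
    (hf : PureMono (ModuleCat.ofHom f)) : SystemPure (LinearMap.range f) := by
  intro m n a x hx
  have := hf.mono
  have hS : pureExact R (ShortComplex.mk (ModuleCat.ofHom f)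
      (cokernel.π (ModuleCat.ofHom f)) (by simp)) := (pureExact_iff _).2
    ⟨{ exact := ShortComplex.exact_of_g_is_cokernel _ (cokernelIsCokernel _) }, hf⟩
  have hex := (ShortComplex.ShortExact.moduleCat_exact_iff_function_exact _).1 hS.1.exact
  let g : B →ₗ[R] (cokernel (ModuleCat.ofHom f) : ModuleCat.{u} R) := (cokernel.π (ModuleCat.ofHom f)).hom
  let c : FpCode R := ⟨m, Submodule.span R (Set.range a), Submodule.fg_span (Set.finite_range a)⟩
  have hc : LinearMap.ker c.quot = Submodule.span R (Set.range a) := c.ker_quot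
  obtain ⟨k, hk⟩ := exists_comp_eq_of_surjective c.quot c.quot_surjective
    (Fintype.linearCombination R fun j => g (x j)) (by
      suffices LinearMap.ker c.quot ≤
        LinearMap.ker (Fintype.linearCombination R fun j => g (x j)) from fun v hv => this hv
      rw [hc, Submodule.span_le]
      rintro _ ⟨i, rfl⟩
      obtain ⟨b, hb⟩ := hx i
      have : g (f b) = 0 := hex.apply_apply_eq_zero b
      rw [hb, map_sum] at this
      simpa [Fintype.linearCombination_apply] using this)
  have : Module.FinitePresentation R (ModuleCat.of R c.Mod) := FpCode.finitePresentation c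
  obtain ⟨h, hh⟩ := hS.exists_lift (ModuleCat.of R c.Mod) (ModuleCat.ofHom k)
  let h' : c.Mod →ₗ[R] B := h.hom
  let z (j : Fin m) : B := h' (c.quot (Pi.single j 1))
  have hz (j) : g (z j) = g (x j) := by
    have h1 : g (z j) = k (c.quot (Pi.single j 1)) := congr($hh (c.quot (Pi.single j 1)))
    have h2 : k (c.quot (Pi.single j 1)) = _ := congr($hk (Pi.single j 1))
    rw [h1, h2]
    simp
  have hz' (i) : ∑ j, a i j • z j = 0 := by
    have h1 : a i = ∑ j, a i j • (Pi.single j (1 : R) : Fin m → R) := by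
      ext k
      simp [Finset.sum_apply, Pi.single_apply]
    have h2 : c.quot (a i) = 0 := by
      rw [← LinearMap.mem_ker, hc]
      exact Submodule.subset_span ⟨i, rfl⟩
    have h3 : ∑ j, a i j • z j = h' (c.quot (a i)) := by
      conv_rhs => rw [h1]
      rw [map_sum c.quot, map_sum h']
      refine Finset.sum_congr rfl fun j _ => ?_
      rw [map_smul c.quot, map_smul h']
    rw [h3, h2, map_zero]
  refine ⟨fun j => x j - z j, fun j => ?_, fun i => ?_⟩
  · refine (hex (x j - z j)).1 ?_
    change g (x j - z j) = 0
    rw [map_sub, hz, sub_self]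
  · simp [smul_sub, Finset.sum_sub_distrib, hz']

variable (R) in
/-- The signature with the linear combinations and with a symbol for each unknown of a finite system
of linear equations. -/
def systemLanguage : FirstOrder.Language.{u, 0} where
  Functions n := (Σ m : ℕ, (Fin n → Fin m → R) × Fin m) ⊕ (Fin n → R)
  Relations _ := Empty

variable (R) in
/-- A bound for the size of small system-pure submodules. -/
def purityCardinal : Cardinal.{u} :=
  max Cardinal.aleph0 (1 + Cardinal.mk (Σ i, (systemLanguage R).Functions i))

lemma exists_small_systemPure (b : B) :
    ∃ S : Submodule R B, SystemPure S ∧ b ∈ S ∧ Cardinal.mk S ≤ purityCardinal R := by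
  classical
  let sol {m n : ℕ} (a : Fin n → Fin m → R) (v : Fin n → B) : Fin m → B :=
    if h : ∃ x : Fin m → B, ∀ i, ∑ j, a i j • x j = v i then h.choose else 0
  let _ : (systemLanguage R).Structure B :=
    { funMap := fun {n} f v => Sum.elim (fun s => sol s.2.1 v s.2.2) (fun r => ∑ i, r i • v i) f
      RelMap := fun r => r.elim }
  let T := FirstOrder.Language.Substructure.closure (systemLanguage R) {b}
  have hlin {n : ℕ} (r : Fin n → R) (v : Fin n → B) (hv : ∀ i, v i ∈ T) :
      ∑ i, r i • v i ∈ T := T.fun_mem (n := n) (Sum.inr r) v hv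
  have hsol {m n : ℕ} (a : Fin n → Fin m → R) (v : Fin n → B) (hv : ∀ i, v i ∈ T) (j) :
      sol a v j ∈ T := T.fun_mem (n := n) (Sum.inl ⟨m, a, j⟩) v hv
  let S : Submodule R B :=
    { carrier := T
      zero_mem' := by simpa using hlin (n := 0) 0 0 (fun i => i.elim0)
      add_mem' := fun {x y} hx hy => by
        have := hlin ![1, 1] ![x, y] (by
          intro i
          fin_cases i
          exacts [hx, hy])
        simpa using this
      smul_mem' := fun r x hx => by
        have := hlin ![r] ![x] (by
          intro i
          fin_cases i
          exact hx)
        simpa using this }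
  refine ⟨S, fun m n a x hx => ?_, FirstOrder.Language.Substructure.subset_closure rfl, ?_⟩
  · refine ⟨sol a fun i => ∑ j, a i j • x j, fun j => hsol a _ hx j, ?_⟩
    have h : ∃ y : Fin m → B, ∀ i, ∑ j, a i j • y j = ∑ j, a i j • x j := ⟨x, fun _ => rfl⟩
    simp only [sol, dif_pos h]
    exact h.choose_spec
  · have := FirstOrder.Language.Substructure.lift_card_closure_le (L := systemLanguage R) (s := {b})
    rw [Cardinal.lift_id, Cardinal.lift_id, Cardinal.lift_id, Cardinal.mk_singleton] at this
    exact this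

variable (R) in
/-- Representatives of the modules of size at most `purityCardinal R`. -/
abbrev SmallCode : Type u := Submodule R ((purityCardinal R).out →₀ R)

/-- The module represented by a code. -/
abbrev SmallCode.Mod (c : SmallCode R) : Type u := ((purityCardinal R).out →₀ R) ⧸ c

lemma SmallCode.exists_equiv (S : Type u) [AddCommGroup S] [Module R S]
    (h : Cardinal.mk S ≤ purityCardinal R) : ∃ c : SmallCode R, Nonempty (S ≃ₗ[R] c.Mod) := by
  have : Cardinal.mk S ≤ Cardinal.mk (purityCardinal R).out := by simpa using h
  obtain ⟨i⟩ := this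
  let p : ((purityCardinal R).out →₀ R) →ₗ[R] S :=
    Finsupp.linearCombination R (Function.invFun i)
  have hp : Function.Surjective p := fun s =>
    ⟨Finsupp.single (i s) 1, by simp [p, Function.leftInverse_invFun i.injective s]⟩
  exact ⟨LinearMap.ker p, ⟨(p.quotKerEquivOfSurjective hp).symm⟩⟩

variable {I : Type u} [AddCommGroup I] [Module R I]

variable (R I) in
/-- Maps extend along the kernels of the canonical covers of the small modules. -/
def ExtendsAlongSmall : Prop :=
  ∀ (c : SmallCode R) (u : FpKernel (R := R) c.Mod →ₗ[R] I),
    ∃ w : FpCover R c.Mod →ₗ[R] I, w ∘ₗ (FpKernel (R := R) c.Mod).subtype = u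

/-- Zorn's lemma for the partial maps that extend `g` and have a system-pure domain. If `b` is
outside a maximal domain, then its class lies in a small system-pure submodule `S` of the quotient.
The preimage `D'` of `S` is system-pure by transitivity, and `exists_extension_of_fpCover` extends
the map to `D'`, since the quotient of `D'` by the domain is isomorphic to `S`. -/
lemma ExtendsAlongSmall.exists_extension (hI : ExtendsAlongSmall R I) {D : Submodule R B}
    (hD : SystemPure D) (g : D →ₗ[R] I) : ∃ h : B →ₗ[R] I, h ∘ₗ D.subtype = g := by
  let P : Set (B →ₗ.[R] I) := {h | SystemPure h.domain ∧ ⟨D, g⟩ ≤ h}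
  obtain ⟨h, -, hmax⟩ := zorn_le_nonempty₀ P (fun c hc hchain y hy => by
    have hdir := hchain.directedOn
    have hne : c.Nonempty := ⟨y, hy⟩
    refine ⟨LinearPMap.sSup c hdir, ⟨fun m n a x hx => ?_, (hc hy).2.trans
      (LinearPMap.le_sSup hdir hy)⟩, fun z hz => LinearPMap.le_sSup hdir hz⟩
    choose k hk hk' using fun i => (LinearPMap.mem_domain_sSup_iff hne hdir).1 (hx i)
    -- A system has only finitely many constants, so they all lie in the domain of one member of the
    -- chain.
    obtain ⟨z, hz, hz'⟩ : ∃ z ∈ c, ∀ i, k i ≤ z := by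
      have : Nonempty c := ⟨⟨y, hy⟩⟩
      obtain ⟨z, hz⟩ := (directedOn_iff_directed.1 hdir).finite_le
        (fun i : Fin n => (⟨k i, hk i⟩ : c))
      exact ⟨z.1, z.2, hz⟩
    obtain ⟨v, hv, hv'⟩ := (hc hz).1 a x (fun i => (hz' i).1 (hk' i))
    exact ⟨v, fun j => (LinearPMap.le_sSup hdir hz).1 (hv j), hv'⟩) ⟨D, g⟩ ⟨hD, le_rfl⟩
  have hh : h ∈ P := hmax.prop
  have htop : h.domain = ⊤ := by
    by_contra hne
    obtain ⟨b, hb⟩ : ∃ b, b ∉ h.domain := by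
      by_contra! H
      exact hne (eq_top_iff.2 fun x _ => H x)
    obtain ⟨S, hS, hbS, hcard⟩ := exists_small_systemPure (R := R) (h.domain.mkQ b)
    obtain ⟨c, ⟨e⟩⟩ := SmallCode.exists_equiv S hcard
    let D' := S.comap h.domain.mkQ
    have hle : h.domain ≤ D' := fun x hx => by
      have : h.domain.mkQ x = 0 := (Submodule.Quotient.mk_eq_zero _).2 hx
      rw [Submodule.mem_comap, this]
      exact S.zero_mem
    let q : D' →ₗ[R] S := (h.domain.mkQ ∘ₗ D'.subtype).codRestrict S fun x => x.2
    have hq : Function.Surjective q := fun s => by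
      obtain ⟨x, hx⟩ := Submodule.mkQ_surjective _ s.1
      exact ⟨⟨x, by rw [Submodule.mem_comap, hx]; exact s.2⟩, Subtype.ext hx⟩
    have hq0 (x : D') : q x = 0 ↔ x.1 ∈ h.domain := by
      rw [← Submodule.Quotient.mk_eq_zero h.domain]
      exact Subtype.ext_iff
    let ι : h.domain →ₗ[R] D' := Submodule.inclusion hle
    have hpure : SystemPure (LinearMap.ker q) := fun m n a x hx => by
      obtain ⟨y, hy, hy'⟩ := hh.1 a (fun j => (x j).1) (fun i => by
        simpa using (hq0 _).1 (hx i))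
      refine ⟨fun j => ⟨y j, hle (hy j)⟩, fun j => (hq0 _).2 (hy j), fun i => Subtype.ext ?_⟩
      simpa using hy' i
    have hfp := hpure.fpLifts (e.toLinearMap ∘ₗ q) (e.surjective.comp hq) (by
      ext x; simp)
    obtain ⟨t, ht⟩ := exists_extension_of_fpCover ι _ hfp (Submodule.inclusion_injective hle)
      (fun x => by
        refine ⟨fun hx => ⟨⟨x.1, (hq0 x).1 (by simpa using hx)⟩, rfl⟩, ?_⟩
        rintro ⟨y, rfl⟩
        simpa using (hq0 _).2 y.2) (hI c) h.toFun
    have hle' : h ≤ ⟨D', t⟩ := ⟨hle, fun x y hxy => by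
      have h1 := congr($ht x)
      have h2 : ι x = y := Subtype.ext hxy
      rw [LinearMap.comp_apply, h2] at h1
      exact h1.symm⟩
    have := hmax.le_of_ge (y := ⟨D', t⟩) ⟨hh.1.comap_mkQ hS, hh.2.trans hle'⟩ hle'
    exact hb (this.1 hbS)
  refine ⟨h.toFun ∘ₗ (LinearMap.id.codRestrict h.domain fun x => htop ▸ Submodule.mem_top), ?_⟩
  ext x
  exact (hh.2.2 (x := x) rfl).symm

/-- A module is pure-injective if maps to it extend along a set of pure monomorphisms. -/
lemma pureInjective_of_extendsAlongSmall (I : ModuleCat.{u} R) (hI : ExtendsAlongSmall R I) :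
    pureInjective R I := by
  refine (pureInjective_iff I).2 fun A B f hf g => ?_
  have hinj : Function.Injective f.hom := (ModuleCat.mono_iff_injective f).1 hf.mono
  have hD : SystemPure (LinearMap.range f.hom) := systemPure_range_of_pureMono (f := f.hom) hf
  let e := LinearEquiv.ofInjective f.hom hinj
  obtain ⟨h, hh⟩ := hI.exists_extension hD (g.hom ∘ₗ e.symm.toLinearMap)
  refine ⟨ModuleCat.ofHom h, ModuleCat.hom_ext (LinearMap.ext fun x => ?_)⟩
  have := congr($hh (e x))
  refine this.trans ?_
  simp

end SystemPure

end KFlatModel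

end
noncomputable section
namespace KFlatModel

/-! ### Periodicity: pure acyclic complexes of pure-injective modules -/

section Periodicity

variable {R : Type u} [Ring R]

/-- Every map from `M` to `Z` lifts along `p`. -/
def HomLifts (M : Type u) [AddCommGroup M] [Module R M] {I Z : ModuleCat.{u} R} (p : I ⟶ Z) : Prop :=
  ∀ h : M →ₗ[R] Z, ∃ g : M →ₗ[R] I, p.hom ∘ₗ g = h

section

variable {I Z : ModuleCat.{u} R} {p : I ⟶ Z}

lemma HomLifts.of_equiv {M M' : Type u} [AddCommGroup M] [Module R M] [AddCommGroup M'] [Module R M']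
    (hM : HomLifts M p) (e : M ≃ₗ[R] M') : HomLifts M' p := fun h => by
  obtain ⟨g, hg⟩ := hM (h ∘ₗ e.toLinearMap)
  refine ⟨g ∘ₗ e.symm.toLinearMap, LinearMap.ext fun x => ?_⟩
  have := congr($hg (e.symm x))
  simpa using this

lemma HomLifts.dsum {ι : Type u} {M : ι → Type u} [∀ i, AddCommGroup (M i)] [∀ i, Module R (M i)]
    (hM : ∀ i, HomLifts (M i) p) : HomLifts (DSum M) p := fun h => by
  choose g hg using fun i => hM i (h ∘ₗ DSum.incl R i)
  refine ⟨DSum.desc g, DSum.hom_ext fun i x => ?_⟩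
  have := congr($(hg i) x)
  simpa using this

/-- A lift that is defined on a pure submodule extends if maps on the quotient lift. -/
lemma exists_lift_extension (hI : pureInjective R I) {B Q : Type u} [AddCommGroup B] [Module R B]
    [AddCommGroup Q] [Module R Q] {U V : Submodule R B} (hUV : U ≤ V)
    (hpure : PureMono (ModuleCat.ofHom (Submodule.inclusion hUV))) (τ : V →ₗ[R] Q)
    (hτ : Function.Surjective τ) (hτU : ∀ x : V, τ x = 0 ↔ x.1 ∈ U) (hQ : HomLifts Q p)
    (h : V →ₗ[R] Z) (g : U →ₗ[R] I) (hg : ∀ x : U, p (g x) = h ⟨x.1, hUV x.2⟩) :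
    ∃ g' : V →ₗ[R] I, (∀ x, p (g' x) = h x) ∧ ∀ x : U, g' ⟨x.1, hUV x.2⟩ = g x := by
  -- The map `g` extends to `V` by pure-injectivity of `I`. The error `h - p k` vanishes on `U`,
  -- descends to `Q` and is lifted there.
  obtain ⟨k, hk⟩ := hpure.extend hI (ModuleCat.ofHom g)
  let k' : V →ₗ[R] I := k.hom
  have hk' (x : U) : k' ⟨x.1, hUV x.2⟩ = g x := congr($hk x)
  obtain ⟨h', hh'⟩ := exists_comp_eq_of_surjective τ hτ (h - p.hom ∘ₗ k') (fun x hx => by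
    have h1 := hk' ⟨x.1, (hτU x).1 hx⟩
    have h2 := hg ⟨x.1, (hτU x).1 hx⟩
    change h x - p (k' x) = 0
    rw [sub_eq_zero, ← h2, ← h1])
  obtain ⟨l, hl⟩ := hQ h'
  refine ⟨k' + l ∘ₗ τ, fun x => ?_, fun x => ?_⟩
  · have h1 : p (l (τ x)) = h' (τ x) := congr($hl (τ x))
    have h2 : h' (τ x) = h x - p (k' x) := congr($hh' x)
    change p.hom (k' x + l (τ x)) = _
    rw [map_add]
    change p (k' x) + p (l (τ x)) = _
    rw [h1, h2]
    abel
  · have : τ ⟨x.1, hUV x.2⟩ = 0 := (hτU _).2 x.2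
    rw [LinearMap.add_apply, LinearMap.comp_apply, this, map_zero, add_zero, hk']

end

/-- Maps from the cokernel of a pure monomorphism lift if maps from the other terms lift, for two
consecutive differentials. -/
lemma HomLifts.of_pure {I' Z' I Z : ModuleCat.{u} R} {p' : I' ⟶ Z'} {i : Z' ⟶ I} {p : I ⟶ Z}
    (hi : Function.Injective i) (hip : Function.Exact i p) (hI' : pureInjective R I')
    {A B C : Type u} [AddCommGroup A] [Module R A] [AddCommGroup B] [Module R B] [AddCommGroup C]
    [Module R C] (f : A →ₗ[R] B) (q : B →ₗ[R] C) (hf : PureMono (ModuleCat.ofHom f))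
    (hq : Function.Surjective q) (hfq : Function.Exact f q) (hA : HomLifts A p')
    (hB : HomLifts B p) : HomLifts C p := fun h => by
  obtain ⟨b, hb⟩ := hB (h ∘ₗ q)
  have hb' (x) : p.hom (b x) = h (q x) := congr($hb x)
  -- On `A` the lift `b` has values in the kernel of `p`, which is `Z'`. The resulting map to `Z'`
  -- lifts to `I'` by the hypothesis on `A`, and the lift extends to `B` because `I'` is
  -- pure-injective. Subtracting the image of this extension in `I` makes `b` vanish on `A`, without
  -- changing its composite with `p`.
  obtain ⟨a, ha⟩ := exists_comp_eq_of_injective i.hom hi (b ∘ₗ f) (fun x => by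
    refine (hip _).1 ((hb' (f x)).trans ?_)
    rw [hfq.apply_apply_eq_zero, map_zero])
  obtain ⟨a', ha'⟩ := hA a
  obtain ⟨k, hk⟩ := hf.extend hI' (ModuleCat.ofHom a')
  let b' : B →ₗ[R] I' := k.hom
  have hk' (x) : b' (f x) = a' x := congr($hk x)
  obtain ⟨c, hc⟩ := exists_comp_eq_of_surjective q hq (b - i.hom ∘ₗ p'.hom ∘ₗ b') (fun x hx => by
    obtain ⟨y, rfl⟩ := (hfq x).1 hx
    have h1 : i.hom (a y) = b (f y) := congr($ha y)
    have h2 : p'.hom (a' y) = a y := congr($ha' y)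
    simp only [LinearMap.sub_apply, LinearMap.comp_apply, hk', h1, h2, sub_self])
  refine ⟨c, LinearMap.ext fun x => ?_⟩
  obtain ⟨x, rfl⟩ := hq x
  have h1 : c (q x) = b x - i.hom (p'.hom (b' x)) := congr($hc x)
  have h2 : p.hom (i.hom (p'.hom (b' x))) = 0 := hip.apply_apply_eq_zero _
  rw [LinearMap.comp_apply, h1, map_sub, h2, sub_zero, hb']

/-- Maps from a quotient of a free module by a finitely generated submodule lift along pure
epimorphisms. -/
lemma homLifts_of_finite {Z' I Z : ModuleCat.{u} R} {i : Z' ⟶ I} {p : I ⟶ Z}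
    (hi : PureMono i) (hip : Function.Exact i p) (hp : Function.Surjective p)
    {X L : Type u} [Finite L] (y : L → (X →₀ R)) :
    HomLifts ((X →₀ R) ⧸ Submodule.span R (Set.range y)) p := fun h => by
  classical
  cases nonempty_fintype L
  choose x hx using fun e : X => hp (h (Submodule.Quotient.mk (Finsupp.single e 1)))
  let φ : (X →₀ R) →ₗ[R] I := Finsupp.linearCombination R x
  have hφ (v) : p.hom (φ v) = h (Submodule.Quotient.mk v) := by
    have : p.hom ∘ₗ φ = h ∘ₗ Submodule.mkQ _ := by
      ext e
      simpa [φ] using hx e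
    exact congr($this v)
  -- Only the finitely many basis vectors in the supports of the relations matter. The values of `φ`
  -- on the relations lie in the range of `i`, which is system-pure, so there are corrections `z` in
  -- this range that have the same values on the relations.
  let T : Finset X := Finset.univ.biUnion fun l => (y l).support
  obtain ⟨z, hz, hz'⟩ := systemPure_range_of_pureMono (f := i.hom) hi
    (fun (l : Fin (Fintype.card L)) (t : Fin T.card) =>
      y ((Fintype.equivFin L).symm l) (T.equivFin.symm t).1)
    (fun t => x (T.equivFin.symm t).1) (fun l => by
      set l' := (Fintype.equivFin L).symm l
      have h1 : ∑ t : Fin T.card, y l' (T.equivFin.symm t).1 • x (T.equivFin.symm t).1 = φ (y l') := by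
        rw [Equiv.sum_comp T.equivFin.symm (fun t : T => y l' t.1 • x t.1),
          Finset.sum_coe_sort T (fun t => y l' t • x t)]
        refine (Finset.sum_subset (Finset.subset_biUnion_of_mem (fun l => (y l).support)
          (Finset.mem_univ l')) fun t _ ht => ?_).symm
        simp [Finsupp.notMem_support_iff.1 ht]
      rw [h1]
      refine (hip _).1 ((hφ _).trans ?_)
      have h2 : y l' ∈ Submodule.span R (Set.range y) := Submodule.subset_span ⟨l', rfl⟩
      rw [(Submodule.Quotient.mk_eq_zero _).2 h2, map_zero])
  let x' (e : X) : I := if he : e ∈ T then x e - z (T.equivFin ⟨e, he⟩) else x e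
  have hx' (e) : p.hom (x' e) = p.hom (x e) := by
    by_cases he : e ∈ T
    · obtain ⟨a, ha⟩ := hz (T.equivFin ⟨e, he⟩)
      have : p.hom (z (T.equivFin ⟨e, he⟩)) = 0 := by
        rw [← ha]
        exact hip.apply_apply_eq_zero a
      simp [x', he, this]
    · simp [x', he]
  let φ' : (X →₀ R) →ₗ[R] I := Finsupp.linearCombination R x'
  have hφ' : p.hom ∘ₗ φ' = p.hom ∘ₗ φ := by
    ext e
    simpa [φ, φ'] using hx' e
  have hker : Submodule.span R (Set.range y) ≤ LinearMap.ker φ' := by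
    rw [Submodule.span_le]
    rintro _ ⟨l, rfl⟩
    have h2 (f : X → I) : Finsupp.linearCombination R f (y l) =
        ∑ t : Fin T.card, y l (T.equivFin.symm t).1 • f (T.equivFin.symm t).1 := by
      rw [Equiv.sum_comp T.equivFin.symm (fun t : T => y l t.1 • f t.1),
        Finset.sum_coe_sort T (fun t => y l t • f t)]
      refine Finset.sum_subset (Finset.subset_biUnion_of_mem (fun l => (y l).support)
        (Finset.mem_univ l)) fun t _ ht => ?_
      simp [Finsupp.notMem_support_iff.1 ht]
    have h3 (t : Fin T.card) : x' (T.equivFin.symm t).1 = x (T.equivFin.symm t).1 - z t := by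
      simp [x']
    have h4 := hz' (Fintype.equivFin L l)
    simp only [Equiv.symm_apply_apply] at h4
    refine LinearMap.mem_ker.2 ((h2 x').trans ?_)
    simp only [h3, smul_sub, Finset.sum_sub_distrib]
    rw [sub_eq_zero, h4]
  refine ⟨(Submodule.span R (Set.range y)).liftQ φ' hker, Submodule.linearMap_qext _ ?_⟩
  ext1 e
  ext1
  have h5 := congr($hφ' (Finsupp.single e 1))
  have h6 := hφ (Finsupp.single e 1)
  exact h5.trans h6

/-! ### Telescopes of well-ordered chains of quotients. -/

section Chain

variable {L : Type u} [LinearOrder L] {F : Type u} [AddCommGroup F] [Module R F]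
  (N : L → Submodule R F)

/-- The transition maps of the quotients by an increasing family of submodules. -/
def quotMap {N N' : Submodule R F} (h : N ≤ N') : (F ⧸ N) →ₗ[R] (F ⧸ N') := Submodule.factor h

@[simp] lemma quotMap_mk {N N' : Submodule R F} (h : N ≤ N') (x : F) :
    quotMap h (Submodule.Quotient.mk x) = Submodule.Quotient.mk x := rfl

variable {N}

open Classical in
/-- The map on `⨁ F / N_b` that sends `x` in `F / N_b`, for `b ≤ a`, to the difference of `x` and
its image in `F / N_a`, and the summands with `b > a` to zero. -/
def chainProj (hN : Monotone N) (a : L) :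
    DSum (fun b => F ⧸ N b) →ₗ[R] DSum (fun b => F ⧸ N b) :=
  DSum.desc fun b => if h : b ≤ a then DSum.incl (M := fun b => F ⧸ N b) R b -
    DSum.incl (M := fun b => F ⧸ N b) R a ∘ₗ quotMap (hN h) else 0

lemma chainProj_incl_of_le (hN : Monotone N) {a b : L} (h : b ≤ a) (x : F ⧸ N b) :
    chainProj hN a (DSum.incl (M := fun b => F ⧸ N b) R b x) =
      DSum.incl (M := fun b => F ⧸ N b) R b x -
        DSum.incl (M := fun b => F ⧸ N b) R a (quotMap (hN h) x) := by
  simp [chainProj, h]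

lemma chainProj_incl_of_lt (hN : Monotone N) {a b : L} (h : a < b) (x : F ⧸ N b) :
    chainProj hN a (DSum.incl (M := fun b => F ⧸ N b) R b x) = 0 := by
  simp [chainProj, not_le.2 h]

/-- For `a = c` this is idempotency. So `chainProj hN a` is a projection onto `chainKer hN a`, and
these submodules increase with `a`. -/
lemma chainProj_chainProj (hN : Monotone N) {a c : L} (h : a ≤ c) (x : DSum (fun b => F ⧸ N b)) :
    chainProj hN c (chainProj hN a x) = chainProj hN a x := by
  suffices chainProj hN c ∘ₗ chainProj hN a = chainProj hN a from congr($this x)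
  refine DSum.hom_ext fun b x => ?_
  rw [LinearMap.comp_apply]
  rcases le_or_gt b a with hb | hb
  · obtain ⟨x, rfl⟩ := Submodule.Quotient.mk_surjective _ x
    rw [chainProj_incl_of_le hN hb, map_sub, chainProj_incl_of_le hN (hb.trans h),
      chainProj_incl_of_le hN h, quotMap_mk, quotMap_mk, quotMap_mk]
    abel
  · rw [chainProj_incl_of_lt hN hb, map_zero]

/-- The fixed points of `chainProj hN a`. -/
def chainKer (hN : Monotone N) (a : L) : Submodule R (DSum (fun b => F ⧸ N b)) :=
  LinearMap.eqLocus (chainProj hN a) LinearMap.id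

lemma mem_chainKer {hN : Monotone N} {a : L} {x} : x ∈ chainKer hN a ↔ chainProj hN a x = x :=
  Iff.rfl

lemma chainProj_mem (hN : Monotone N) (a : L) (x : DSum (fun b => F ⧸ N b)) :
    chainProj hN a x ∈ chainKer hN a := chainProj_chainProj hN le_rfl x

lemma chainKer_mono (hN : Monotone N) : Monotone (chainKer hN) := fun a c h x hx => by
  rw [mem_chainKer] at hx ⊢
  rw [← hx, chainProj_chainProj hN h]

open Classical in
/-- The sum of the components with index in a lower set, as an element of `F / N'`. -/
def chainSum (s : Set L) {N' : Submodule R F} (hN' : ∀ b ∈ s, N b ≤ N') :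
    DSum (fun b => F ⧸ N b) →ₗ[R] F ⧸ N' :=
  DSum.desc fun b => if h : b ∈ s then quotMap (hN' b h) else 0

lemma chainSum_incl_of_mem {s : Set L} {N' : Submodule R F} (hN' : ∀ b ∈ s, N b ≤ N') {b : L}
    (hb : b ∈ s) (x : F) : chainSum s hN' (DSum.incl R b (Submodule.Quotient.mk x)) =
      Submodule.Quotient.mk x := by
  simp [chainSum, hb]

lemma chainSum_incl_of_notMem {s : Set L} {N' : Submodule R F} (hN' : ∀ b ∈ s, N b ≤ N') {b : L}
    (hb : b ∉ s) (x : F ⧸ N b) : chainSum s hN' (DSum.incl R b x) = 0 := by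
  simp [chainSum, hb]

lemma chainSum_chainProj (hN : Monotone N) {s : Set L} {N' : Submodule R F}
    (hN' : ∀ b ∈ s, N b ≤ N') (hs : IsLowerSet s) {a : L} (ha : a ∈ s) (x) :
    chainSum s hN' (chainProj hN a x) = 0 := by
  suffices chainSum s hN' ∘ₗ chainProj hN a = 0 from congr($this x)
  refine DSum.hom_ext fun b x => ?_
  rw [LinearMap.comp_apply]
  rcases le_or_gt b a with hb | hb
  · obtain ⟨x, rfl⟩ := Submodule.Quotient.mk_surjective _ x
    rw [chainProj_incl_of_le hN hb, quotMap_mk, map_sub, chainSum_incl_of_mem hN' (hs hb ha),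
      chainSum_incl_of_mem hN' ha, sub_self]
    rfl
  · rw [chainProj_incl_of_lt hN hb, map_zero]
    rfl

/-- Elements supported in `s` whose sum vanishes are fixed by some `chainProj`. -/
lemma exists_mem_chainKer (hN : Monotone N) {s : Set L} (hs : s.Nonempty)
    (J : Finset L) (hJ : ∀ b ∈ J, b ∈ s) (x : L → F)
    (hx : ∑ b ∈ J, x b ∈ ⨆ b ∈ s, N b) :
    ∃ a ∈ s, ∑ b ∈ J, DSum.incl (M := fun b => F ⧸ N b) R b (Submodule.Quotient.mk (x b)) ∈
      chainKer hN a := by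
  classical
  have : Nonempty s := hs.to_subtype
  have hdir : Directed (· ≤ ·) fun b : s => N b.1 := (hN.comp (Subtype.mono_coe (· ∈ s))).directed_le
  rw [iSup_subtype', Submodule.mem_iSup_of_directed _ hdir] at hx
  obtain ⟨c, hc⟩ := hx
  -- By directedness the sum already lies in a single `N c`. An index above `c` and all of `J` is
  -- one for which both parts of `chainProj` are visible: every component is kept and the total
  -- vanishes in `F ⧸ N a`.
  obtain ⟨a, ha, hca, haJ⟩ : ∃ a ∈ s, c.1 ≤ a ∧ ∀ b ∈ J, b ≤ a := by
    clear hc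
    induction J using Finset.induction_on with
    | empty => exact ⟨c.1, c.2, le_rfl, by simp⟩
    | insert b J hb ih =>
      obtain ⟨a, ha, hca, haJ⟩ := ih (fun b hb => hJ b (Finset.mem_insert_of_mem hb))
      rcases le_total a b with h | h
      · exact ⟨b, hJ b (Finset.mem_insert_self _ _), hca.trans h, by
          intro b' hb'
          rcases Finset.mem_insert.1 hb' with rfl | hb'
          exacts [le_rfl, (haJ b' hb').trans h]⟩
      · exact ⟨a, ha, hca, by
          intro b' hb'
          rcases Finset.mem_insert.1 hb' with rfl | hb'
          exacts [h, haJ b' hb']⟩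
  refine ⟨a, ha, ?_⟩
  rw [mem_chainKer, map_sum]
  have h1 : ∑ b ∈ J, chainProj hN a (DSum.incl R b (Submodule.Quotient.mk (x b))) =
      ∑ b ∈ J, (DSum.incl (M := fun b => F ⧸ N b) R b (Submodule.Quotient.mk (x b)) -
        DSum.incl (M := fun b => F ⧸ N b) R a (Submodule.Quotient.mk (x b))) :=
    Finset.sum_congr rfl fun b hb => by rw [chainProj_incl_of_le hN (haJ b hb), quotMap_mk]
  rw [h1, Finset.sum_sub_distrib, ← map_sum, sub_eq_self]
  have h2 : ∑ b ∈ J, (Submodule.Quotient.mk (x b) : F ⧸ N a) = 0 := by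
    have : (Submodule.Quotient.mk (∑ b ∈ J, x b) : F ⧸ N a) = 0 :=
      (Submodule.Quotient.mk_eq_zero _).2 (hN hca hc)
    rw [← this]
    exact (map_sum (Submodule.mkQ (N a)) _ _).symm
  rw [h2, map_zero]

lemma exists_eq_sum_incl (x : DSum (fun b => F ⧸ N b)) : ∃ (J : Finset L) (y : L → F),
    x = ∑ b ∈ J, DSum.incl (M := fun b => F ⧸ N b) R b (Submodule.Quotient.mk (y b)) := by
  obtain ⟨J, hJ⟩ := DSum.exists_finset R x
  choose y hy using fun b => Submodule.Quotient.mk_surjective (N b) (DSum.proj (M := fun b => F ⧸ N b) R b x)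
  exact ⟨J, y, by simp only [hy, hJ J subset_rfl]⟩

lemma chainSum_sum {s : Set L} {N' : Submodule R F} (hN' : ∀ b ∈ s, N b ≤ N') (J : Finset L)
    (hJ : ∀ b ∈ J, b ∈ s) (y : L → F) :
    chainSum s hN' (∑ b ∈ J, DSum.incl (M := fun b => F ⧸ N b) R b (Submodule.Quotient.mk (y b))) =
      Submodule.Quotient.mk (∑ b ∈ J, y b) := by
  rw [map_sum, Finset.sum_congr rfl fun b hb => chainSum_incl_of_mem hN' (hJ b hb) (y b)]
  exact (map_sum (Submodule.mkQ N') _ _).symm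

lemma mem_iSup_chainKer_iff (hN : Monotone N) {s : Set L} (hs : s.Nonempty) (x) :
    x ∈ ⨆ b ∈ s, chainKer hN b ↔ ∃ b ∈ s, x ∈ chainKer hN b := by
  have : Nonempty s := hs.to_subtype
  have hdir : Directed (· ≤ ·) fun b : s => chainKer hN b.1 :=
    ((chainKer_mono hN).comp (Subtype.mono_coe (· ∈ s))).directed_le
  rw [iSup_subtype', Submodule.mem_iSup_of_directed _ hdir]
  simp

/-- The kernel of the map from the direct sum of a chain of quotients to its colimit is the union
of the submodules `chainKer`. -/
lemma ker_chainSum_univ [Nonempty L] (hN : Monotone N) :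
    LinearMap.ker (chainSum (N := N) Set.univ (N' := ⨆ b ∈ Set.univ, N b)
      fun b hb => le_biSup N hb) = ⨆ b ∈ Set.univ, chainKer hN b := by
  ext x
  rw [mem_iSup_chainKer_iff hN Set.univ_nonempty]
  refine ⟨fun hx => ?_, ?_⟩
  · obtain ⟨J, y, rfl⟩ := exists_eq_sum_incl x
    rw [LinearMap.mem_ker, chainSum_sum _ J (by simp), Submodule.Quotient.mk_eq_zero] at hx
    exact exists_mem_chainKer hN Set.univ_nonempty J (by simp) y hx
  · rintro ⟨b, hb, hx⟩
    rw [LinearMap.mem_ker, ← mem_chainKer.1 hx, chainSum_chainProj hN _ isLowerSet_univ hb]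

/-- Finitely many elements of the union lie in one `chainKer hN a`, and `chainProj hN a` is a
retraction that fixes them. -/
lemma pureMono_inclusion_iSup_chainKer (hN : Monotone N) {s : Set L} (hs : s.Nonempty)
    {V : Submodule R (DSum (fun b => F ⧸ N b))} (h : ⨆ b ∈ s, chainKer hN b ≤ V) :
    PureMono (ModuleCat.ofHom (Submodule.inclusion h)) := by
  classical
  refine pureMono_of_locally_split _ fun t => ?_
  obtain ⟨a, ha, hta⟩ : ∃ a ∈ s, ∀ x ∈ t, x.1 ∈ chainKer hN a := by
    induction t using Finset.induction_on with
    | empty => exact ⟨hs.some, hs.some_mem, by simp⟩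
    | insert x t _ ih =>
      obtain ⟨a, ha, hat⟩ := ih
      obtain ⟨b, hb, hbx⟩ := (mem_iSup_chainKer_iff hN hs _).1 x.2
      refine ⟨max a b, by rcases max_choice a b with h | h <;> rwa [h], fun y hy => ?_⟩
      rcases Finset.mem_insert.1 hy with rfl | hy
      · exact chainKer_mono hN (le_max_right a b) hbx
      · exact chainKer_mono hN (le_max_left a b) (hat y hy)
  refine ⟨ModuleCat.ofHom ((chainProj hN a ∘ₗ V.subtype).codRestrict _ fun x =>
    (mem_iSup_chainKer_iff hN hs _).2 ⟨a, ha, chainProj_mem hN a _⟩), fun x hx => Subtype.ext ?_⟩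
  exact mem_chainKer.1 (hta x hx)

variable {I Z : ModuleCat.{u} R} {p : I ⟶ Z}

lemma iSup_Iio_chainKer_le (hN : Monotone N) (c : L) :
    ⨆ b ∈ Set.Iio c, chainKer hN b ≤ chainKer hN c :=
  iSup₂_le fun _ hb => chainKer_mono hN (le_of_lt hb)

/-- An element of `chainKer hN c` is determined by its components of index below `c`, because the
component at `c` is minus the image of their sum. Adding these components maps `chainKer hN c` onto
the quotient of `F` by the union of the earlier submodules, and the kernel is the union of the
earlier `chainKer hN b`. So the new layer of the filtration is again a quotient of `F`, to which the
lifting hypothesis applies. -/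
lemma chainKer_extension (hI : pureInjective R I) (hN : Monotone N) (c : L)
    (hQ : HomLifts (F ⧸ ⨆ b ∈ Set.Iio c, N b) p) (h : chainKer hN c →ₗ[R] Z)
    (g : ↥(⨆ b ∈ Set.Iio c, chainKer hN b) →ₗ[R] I)
    (hg : ∀ x, p (g x) = h ⟨x.1, iSup_Iio_chainKer_le hN c x.2⟩) :
    ∃ g' : chainKer hN c →ₗ[R] I, (∀ x, p (g' x) = h x) ∧
      ∀ (x : ↥(⨆ b ∈ Set.Iio c, chainKer hN b)) (hx : x.1 ∈ chainKer hN c), g' ⟨x.1, hx⟩ = g x := by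
  classical
  have hle := iSup_Iio_chainKer_le hN c
  have hform (x) (hx : x ∈ chainKer hN c) : ∃ (J : Finset L) (_ : ∀ b ∈ J, b ∈ Set.Iio c) (y : L → F),
      x = ∑ b ∈ J, DSum.incl (M := fun b => F ⧸ N b) R b (Submodule.Quotient.mk (y b)) -
        DSum.incl (M := fun b => F ⧸ N b) R c (Submodule.Quotient.mk (∑ b ∈ J, y b)) := by
    obtain ⟨J, y, hJ⟩ := exists_eq_sum_incl x
    refine ⟨J.filter (· < c), fun b hb => (Finset.mem_filter.1 hb).2, y, ?_⟩
    have h0 : (Submodule.Quotient.mk (∑ b ∈ J.filter (· < c), y b) : F ⧸ N c) =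
      ∑ b ∈ J.filter (· < c), Submodule.Quotient.mk (y b) := map_sum (Submodule.mkQ (N c)) _ _
    rw [h0, map_sum, ← Finset.sum_sub_distrib, Finset.sum_filter, ← mem_chainKer.1 hx, hJ, map_sum]
    refine Finset.sum_congr rfl fun b _ => ?_
    rcases lt_trichotomy b c with hb | rfl | hb
    · rw [if_pos hb, chainProj_incl_of_le hN hb.le, quotMap_mk]
    · rw [if_neg (lt_irrefl _), chainProj_incl_of_le hN le_rfl, quotMap_mk, sub_self]
    · rw [if_neg hb.not_gt, chainProj_incl_of_lt hN hb]
  -- For the least index `chainKer hN c` is zero, while the quotient of `F` by the empty union is a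
  -- copy of `F`, so the sum map need not be surjective and the case is separate.
  rcases (Set.Iio c).eq_empty_or_nonempty with he | hne
  · have hz (x : chainKer hN c) : x = 0 := by
      obtain ⟨J, hJ, y, hx⟩ := hform x.1 x.2
      have : J = ∅ := Finset.eq_empty_of_forall_notMem fun b hb => by
        have := hJ b hb
        rw [he] at this
        exact this
      subst this
      refine Subtype.ext (hx.trans ?_)
      simp
    refine ⟨0, fun x => ?_, fun x hx => ?_⟩
    · rw [hz x]
      exact (map_zero p.hom).trans (map_zero h).symm
    · have : x = 0 := Subtype.ext (Subtype.ext_iff.1 (hz ⟨x.1, hx⟩) :)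
      exact (map_zero g).symm.trans (congrArg g this.symm)
  · let τ : chainKer hN c →ₗ[R] F ⧸ ⨆ b ∈ Set.Iio c, N b :=
      chainSum (N := N) (Set.Iio c) (fun b hb => le_biSup N hb) ∘ₗ (chainKer hN c).subtype
    have hnot : c ∉ Set.Iio c := lt_irrefl c
    obtain ⟨g', hg', hg''⟩ := exists_lift_extension hI hle
      (pureMono_inclusion_iSup_chainKer hN hne hle) τ (fun q => by
        obtain ⟨f, rfl⟩ := Submodule.Quotient.mk_surjective _ q
        refine ⟨⟨_, chainProj_mem hN c (DSum.incl R hne.some (Submodule.Quotient.mk f))⟩, ?_⟩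
        change chainSum _ _ (chainProj hN c _) = _
        rw [chainProj_incl_of_le hN (le_of_lt hne.some_mem), map_sub,
          chainSum_incl_of_mem _ hne.some_mem, chainSum_incl_of_notMem _ hnot, sub_zero])
      (fun x => by
        rw [mem_iSup_chainKer_iff hN hne]
        constructor
        · intro hx
          obtain ⟨J, hJ, y, hxJ⟩ := hform x.1 x.2
          change chainSum _ _ x.1 = 0 at hx
          rw [hxJ, map_sub, chainSum_incl_of_notMem _ hnot, sub_zero, chainSum_sum _ J hJ,
            Submodule.Quotient.mk_eq_zero] at hx
          have hc : (Submodule.Quotient.mk (∑ b ∈ J, y b) : F ⧸ N c) = 0 :=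
            (Submodule.Quotient.mk_eq_zero _).2
              ((iSup₂_le fun b hb => hN (le_of_lt hb) : ⨆ b ∈ Set.Iio c, N b ≤ N c) hx)
          rw [hxJ, hc, map_zero, sub_zero]
          exact exists_mem_chainKer hN hne J hJ y hx
        · rintro ⟨b, hb, hx⟩
          change chainSum _ _ x.1 = 0
          rw [← mem_chainKer.1 hx]
          exact chainSum_chainProj hN _ (isLowerSet_Iio c) hb _)
      hQ h g hg
    exact ⟨g', hg', fun x hx => hg'' x⟩

/-- Transfinite extension of lifts along the filtration, organised by Zorn's lemma. The domains are
required to be unions of members of the filtration: if a maximal domain contains all `chainKer hN b`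
with `b < c` and is not already indexed past `c`, then it equals their union, and
`chainKer_extension` applies to it. -/
lemma homLifts_iSup_chainKer [WellFoundedLT L] (hI : pureInjective R I) (hN : Monotone N)
    (hQ : ∀ c, HomLifts (F ⧸ ⨆ b ∈ Set.Iio c, N b) p) :
    HomLifts ↥(⨆ b ∈ Set.univ, chainKer hN b) p := fun h => by
  have hle (b : L) : chainKer hN b ≤ ⨆ b ∈ Set.univ, chainKer hN b :=
    le_biSup (chainKer hN) (Set.mem_univ b)
  let P : Set (DSum (fun b => F ⧸ N b) →ₗ.[R] I) :=
    {g | (∃ J : Set L, g.domain = ⨆ b ∈ J, chainKer hN b) ∧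
      ∀ (x : g.domain) (hx : x.1 ∈ ⨆ b ∈ Set.univ, chainKer hN b), p (g.toFun x) = h ⟨x.1, hx⟩}
  have hbot : ⊥ ∈ P := by
    refine ⟨⟨∅, ?_⟩, fun x hx => ?_⟩
    · simp
      rfl
    · have h0 : x = 0 := Subsingleton.elim (α := (⊥ : Submodule R (DSum fun b => F ⧸ N b))) _ _
      subst h0
      refine ((congrArg p (map_zero _)).trans (map_zero p.hom)).trans (map_zero h).symm
  obtain ⟨g, -, hmax⟩ := zorn_le_nonempty₀ P (fun c hc hchain y hy => by
    have hdir := hchain.directedOn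
    have hne : c.Nonempty := ⟨y, hy⟩
    refine ⟨LinearPMap.sSup c hdir, ⟨?_, fun x hx => ?_⟩, fun z hz => LinearPMap.le_sSup hdir hz⟩
    · refine ⟨{b | ∃ f ∈ c, chainKer hN b ≤ f.domain}, le_antisymm (fun x hx => ?_)
        (iSup₂_le ?_)⟩
      · obtain ⟨f, hf, hx⟩ := (LinearPMap.mem_domain_sSup_iff hne hdir).1 hx
        obtain ⟨J, hJ⟩ := (hc hf).1
        rw [hJ] at hx
        refine (biSup_mono (f := chainKer hN) fun b hb => ⟨f, hf, ?_⟩ : _ ≤ _) hx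
        rw [hJ]
        exact le_biSup (chainKer hN) hb
      · rintro b ⟨f, hf, hb⟩
        exact hb.trans (LinearPMap.le_sSup hdir hf).1
    · obtain ⟨f, hf, hx'⟩ := (LinearPMap.mem_domain_sSup_iff hne hdir).1 x.2
      rw [← (hc hf).2 ⟨x.1, hx'⟩ hx]
      exact congrArg p ((LinearPMap.le_sSup hdir hf).2 (x := ⟨x.1, hx'⟩) rfl).symm) ⊥ hbot
  have hg : g ∈ P := hmax.prop
  have key (c : L) : chainKer hN c ≤ g.domain := by
    induction c using WellFoundedLT.induction with
    | ind c ih =>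
      obtain ⟨J, hJ⟩ := hg.1
      by_cases hcJ : ∃ j ∈ J, c ≤ j
      · obtain ⟨j, hj, hcj⟩ := hcJ
        rw [hJ]
        exact (chainKer_mono hN hcj).trans (le_biSup (chainKer hN) hj)
      push Not at hcJ
      have hdom : g.domain = ⨆ b ∈ Set.Iio c, chainKer hN b :=
        le_antisymm (hJ.le.trans (biSup_mono fun b hb => hcJ b hb)) (iSup₂_le ih)
      obtain ⟨g', hg', hg''⟩ := chainKer_extension hI hN c (hQ c)
        (h ∘ₗ Submodule.inclusion (hle c))
        (g.toFun ∘ₗ Submodule.inclusion hdom.ge) (fun x => hg.2 ⟨x.1, hdom.ge x.2⟩ _)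
      have hle' : g ≤ ⟨chainKer hN c, g'⟩ := by
        refine ⟨hdom.le.trans (iSup_Iio_chainKer_le hN c), fun x y hxy => ?_⟩
        have h1 := hg'' ⟨x.1, hdom.le x.2⟩ (hxy ▸ y.2)
        have h2 : y = ⟨x.1, hxy ▸ y.2⟩ := Subtype.ext hxy.symm
        rw [h2]
        exact h1.symm
      have hmem : (⟨chainKer hN c, g'⟩ : DSum (fun b => F ⧸ N b) →ₗ.[R] I) ∈ P := by
        refine ⟨⟨{c}, by simp⟩, fun x hx => hg' x⟩
      exact (hmax.le_of_ge hmem hle').1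
  have htop : ⨆ b ∈ Set.univ, chainKer hN b ≤ g.domain := iSup₂_le fun b _ => key b
  refine ⟨g.toFun ∘ₗ Submodule.inclusion htop, LinearMap.ext fun x => ?_⟩
  exact hg.2 ⟨x.1, htop x.2⟩ x.2

end Chain

/-- Maps from the quotient by the union of a chain of submodules lift. -/
lemma homLifts_quotient_iSup {L : Type u} [LinearOrder L] [WellFoundedLT L] [Nonempty L]
    {F : Type u} [AddCommGroup F] [Module R F] {N : L → Submodule R F} (hN : Monotone N)
    {I' Z' I Z : ModuleCat.{u} R} {p' : I' ⟶ Z'} {i : Z' ⟶ I} {p : I ⟶ Z}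
    (hi : Function.Injective i) (hip : Function.Exact i p) (hI' : pureInjective R I')
    (hQ : ∀ c, HomLifts (F ⧸ ⨆ b ∈ Set.Iio c, N b) p') (hB : ∀ c, HomLifts (F ⧸ N c) p) :
    HomLifts (F ⧸ ⨆ b ∈ Set.univ, N b) p := by
  let σ : DSum (fun b => F ⧸ N b) →ₗ[R] F ⧸ ⨆ b ∈ Set.univ, N b :=
    chainSum (N := N) Set.univ fun b hb => le_biSup N hb
  have hσ := ker_chainSum_univ hN
  have hle : ⨆ b ∈ Set.univ, chainKer hN b ≤ ⊤ := le_top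
  have hpure := pureMono_inclusion_iSup_chainKer hN Set.univ_nonempty hle
  have hpure' : PureMono (ModuleCat.ofHom
      (⨆ b ∈ Set.univ, chainKer hN b : Submodule R (DSum fun b => F ⧸ N b)).subtype) :=
    PureMono.comp hpure (PureMono.of_isIso (Submodule.topEquiv (R := R)
      (M := DSum fun b => F ⧸ N b)).toModuleIso.hom)
  refine HomLifts.of_pure hi hip hI' (Submodule.subtype _) σ hpure' (fun x => ?_) (fun x => ?_)
    (homLifts_iSup_chainKer hI' hN hQ) (HomLifts.dsum hB)
  · obtain ⟨x, rfl⟩ := Submodule.Quotient.mk_surjective _ x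
    exact ⟨DSum.incl R (Classical.arbitrary L) (Submodule.Quotient.mk x),
      chainSum_incl_of_mem _ (Set.mem_univ _) x⟩
  · rw [← LinearMap.mem_ker, hσ]
    simp

/-- All maps to the cycles of a pure acyclic complex of pure-injective modules lift. -/
lemma homLifts_of_periodic {I Z : ℤ → ModuleCat.{u} R} (i : ∀ n, Z n ⟶ I n)
    (p : ∀ n m, I n ⟶ Z m) (hi : ∀ n, PureMono (i n))
    (hip : ∀ n, Function.Exact (i n) (p n (n + 1))) (hp : ∀ n, Function.Surjective (p n (n + 1)))
    (hI : ∀ n, pureInjective R (I n)) (M : Type u) [AddCommGroup M] [Module R M] (n m : ℤ)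
    (hnm : n + 1 = m) : HomLifts M (p n m) := by
  have hinj (n) : Function.Injective (i n) := (ModuleCat.mono_iff_injective _).1 (hi n).mono
  -- Induction on the number of relations, for all degrees at once, since lifting along one
  -- differential uses liftings along the preceding one for the kernel of the telescope.
  have key (κ : Cardinal.{u}) : ∀ (L : Type u) (_ : Cardinal.mk L = κ) (y : L → (M →₀ R)) (n m : ℤ)
      (_ : n + 1 = m), HomLifts ((M →₀ R) ⧸ Submodule.span R (Set.range y)) (p n m) := by
    induction κ using WellFoundedLT.induction with
    | ind κ ih =>
      rintro L hL y n m rfl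
      by_cases hfin : Finite L
      · exact homLifts_of_finite (hi n) (hip n) (hp n) y
      have hinf : Cardinal.aleph0 ≤ κ := by
        rw [← hL, Cardinal.aleph0_le_mk_iff]
        exact not_finite_iff_infinite.1 hfin
      -- The relations are well-ordered by the initial ordinal of `κ`, so every proper initial
      -- segment has fewer than `κ` elements. With `N c` spanned by the relations of index at most
      -- `c`, the union over `Set.Iio c` is spanned by those of index below `c`, and the induction
      -- hypothesis covers both kinds of quotients.
      let L' := κ.ord.ToType
      have hL' : Cardinal.mk L' = κ := Cardinal.mk_ord_toType κ
      obtain ⟨e⟩ := Cardinal.eq.1 (hL'.trans hL.symm)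
      let N (c : L') : Submodule R (M →₀ R) := Submodule.span R (y ∘ e '' Set.Iic c)
      have hN : Monotone N := fun a b h => Submodule.span_mono (Set.image_mono (Set.Iic_subset_Iic.2 h))
      have hrange (s : Set L') (hs : Cardinal.mk s < κ) (n m : ℤ) (hnm : n + 1 = m) :
          HomLifts ((M →₀ R) ⧸ Submodule.span R (y ∘ e '' s)) (p n m) := by
        have := ih _ hs s rfl (fun x => y (e x.1)) n m hnm
        have h2 : Set.range (fun x : s => y (e x.1)) = y ∘ e '' s := by
          ext; simp
        rwa [h2] at this
      have hIio (c : L') : Cardinal.mk (Set.Iio c) < κ := by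
        have := Cardinal.mk_Iio_lt c (by rw [hL', Ordinal.type_toType])
        rwa [hL'] at this
      have hIic (c : L') : Cardinal.mk (Set.Iic c) < κ := by
        rw [← Set.Iio_insert]
        exact Cardinal.mk_insert_le.trans_lt
          (Cardinal.add_lt_of_lt hinf (hIio c) (Cardinal.one_lt_aleph0.trans_le hinf))
      have hne : Nonempty L' := by
        rw [← Cardinal.mk_ne_zero_iff, hL']
        exact (Cardinal.aleph0_pos.trans_le hinf).ne'
      have hsup (s : Set L') : ⨆ b ∈ s, N b = Submodule.span R (y ∘ e '' {x | ∃ b ∈ s, x ≤ b}) := by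
        simp only [N]
        rw [← Submodule.span_iUnion₂]
        congr 1
        ext x
        simp only [Set.mem_iUnion, Set.mem_image, Set.mem_Iic, Set.mem_ofPred_eq]
        constructor
        · rintro ⟨b, hb, a, hab, rfl⟩
          exact ⟨a, ⟨b, hb, hab⟩, rfl⟩
        · rintro ⟨a, ⟨b, hb, hab⟩, rfl⟩
          exact ⟨b, hb, a, hab, rfl⟩
      obtain ⟨n', hn'⟩ : ∃ n', n' + 1 = n := ⟨n - 1, by omega⟩
      have := homLifts_quotient_iSup hN (p' := p n' n) (hinj n) (hip n) (hI n') (fun c => by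
        rw [hsup]
        have : {x | ∃ b ∈ Set.Iio c, x ≤ b} = Set.Iio c := by
          ext x
          exact ⟨fun ⟨b, hb, hx⟩ => lt_of_le_of_lt hx hb, fun hx => ⟨x, hx, le_rfl⟩⟩
        rw [this]
        exact hrange _ (hIio c) _ _ hn') (fun c => hrange _ (hIic c) _ _ rfl)
      rw [hsup] at this
      have huniv : y ∘ e '' {x | ∃ b ∈ Set.univ, x ≤ b} = Set.range y := by
        have : {x : L' | ∃ b ∈ Set.univ, x ≤ b} = Set.univ := by
          ext x
          simpa using ⟨x, le_rfl⟩
        rw [this, Set.image_univ, EquivLike.range_comp]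
      rwa [huniv] at this
  let q : (M →₀ R) →ₗ[R] M := Finsupp.linearCombination R id
  have hq : Function.Surjective q := fun x => ⟨Finsupp.single x 1, by simp [q]⟩
  have h1 := key _ (LinearMap.ker q) rfl (fun x => x.1) n m hnm
  have h2 : Set.range (fun x : LinearMap.ker q => x.1) = LinearMap.ker q := Subtype.range_coe
  rw [h2, Submodule.span_eq] at h1
  exact h1.of_equiv (q.quotKerEquivOfSurjective hq)

end Periodicity

end KFlatModel

end
-- Orthogonality of complexes, lifting properties and contractibility.
noncomputable section
namespace KFlatModel

open CochainComplex.HomComplex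

/-! ### Orthogonality of complexes -/

section Orthogonal

/-- The complex of homomorphisms from `X` to `Y` is acyclic. -/
def Orth {C : Type u} [Category.{v} C] [Preadditive C] (X Y : CochainComplex C ℤ) : Prop :=
  ∀ (m n : ℤ) (_ : m + 1 = n) (z : Cochain X Y n), (∀ k, δ n k z = 0) →
    ∃ w : Cochain X Y m, δ m n w = z

section

variable {C : Type u} [Category.{v} C] [Preadditive C] {X Y Z : CochainComplex C ℤ}

lemma Orth.of_homotopy_left (h : Homotopy (𝟙 X) 0) (Y : CochainComplex C ℤ) : Orth X Y := by
  rintro m n hmn z hz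
  have h1 : δ (-1) 0 (Cochain.ofHomotopy h) = Cochain.ofHom (𝟙 X) := by
    rw [δ_ofHomotopy, Cochain.ofHom_zero, sub_zero]
  refine ⟨n.negOnePow • (Cochain.ofHomotopy h).comp z (by omega), ?_⟩
  rw [δ_units_smul, δ_comp _ _ (by omega : -1 + n = m) 0 (n + 1) n hmn (by omega) rfl, hz,
    Cochain.comp_zero, zero_add, h1, Cochain.id_comp, smul_smul, ← Int.negOnePow_add,
    Int.negOnePow_even _ ⟨n, rfl⟩, one_smul]

lemma Orth.homotopy (h : Orth X Y) (f g : X ⟶ Y) : Nonempty (Homotopy f g) := by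
  obtain ⟨w, hw⟩ := h (-1) 0 (by omega) (Cochain.ofHom f - Cochain.ofHom g) (by simp)
  exact ⟨(Cochain.equivHomotopy f g).symm ⟨w, by rw [hw]; abel⟩⟩

lemma Orth.of_retract {X' : CochainComplex C ℤ} (r : Retract X' X) (h : Orth X Y) : Orth X' Y := by
  intro m n hmn z hz
  obtain ⟨w, hw⟩ := h m n hmn ((Cochain.ofHom r.r).comp z (zero_add n))
    (fun k => by rw [δ_ofHom_comp, hz, Cochain.comp_zero])
  refine ⟨(Cochain.ofHom r.i).comp w (zero_add m), ?_⟩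
  rw [δ_ofHom_comp, hw, ← Cochain.comp_assoc_of_first_is_zero_cochain, ← Cochain.ofHom_comp,
    r.retract, Cochain.id_comp]

lemma Orth.of_retract_right {Y' : CochainComplex C ℤ} (r : Retract Y' Y) (h : Orth X Y) :
    Orth X Y' := by
  intro m n hmn z hz
  obtain ⟨w, hw⟩ := h m n hmn (z.comp (Cochain.ofHom r.i) (add_zero n))
    (fun k => by rw [δ_comp_ofHom, hz, Cochain.zero_comp])
  refine ⟨w.comp (Cochain.ofHom r.r) (add_zero m), ?_⟩
  rw [δ_comp_ofHom, hw, Cochain.comp_assoc_of_third_is_zero_cochain, ← Cochain.ofHom_comp,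
    r.retract, Cochain.comp_id]

end

variable {R : Type u} [Ring R]

lemma dwPureExact.shortExact {S : ShortComplex (Ch R)} (hS : dwPureExact R S) : S.ShortExact :=
  HomologicalComplex.shortExact_of_degreewise_shortExact S fun n => (hS n).1

lemma dwPureExact.pureMono {S : ShortComplex (Ch R)} (hS : dwPureExact R S) (n : ℤ) :
    PureMono (S.f.f n) := ((pureExact_iff _).1 (hS n)).2

lemma dwPureExact_iff {S : ShortComplex (Ch R)} :
    dwPureExact R S ↔ S.ShortExact ∧ ∀ n, PureMono (S.f.f n) := by
  refine ⟨fun hS => ⟨hS.shortExact, hS.pureMono⟩, fun h n => (pureExact_iff _).2 ⟨?_, h.2 n⟩⟩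
  exact h.1.map_of_exact (HomologicalComplex.eval _ _ n)

variable {S : ShortComplex (Ch R)} {Y : Ch R}

lemma exists_cochain_extension {A B : Ch R} {f : A ⟶ B} (hf : ∀ n, PureMono (f.f n))
    (hY : dwPureInjective R Y) {n : ℤ} (z : Cochain A Y n) :
    ∃ z' : Cochain B Y n, (Cochain.ofHom f).comp z' (zero_add n) = z := by
  choose g hg using fun (p q : ℤ) (h : p + n = q) => (hf p).extend (hY q) (z.v p q h)
  refine ⟨Cochain.mk g, ?_⟩
  ext p q h : 1
  rw [Cochain.zero_cochain_comp_v, Cochain.ofHom_v, Cochain.mk_v, hg]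

lemma exists_cochain_desc (hS : S.ShortExact) {n : ℤ} (z : Cochain S.X₂ Y n)
    (hz : (Cochain.ofHom S.f).comp z (zero_add n) = 0) :
    ∃ z' : Cochain S.X₃ Y n, (Cochain.ofHom S.g).comp z' (zero_add n) = z := by
  have hS' (p : ℤ) := (hS.map_of_exact (HomologicalComplex.eval _ _ p)).gIsCokernel
  have key (p q : ℤ) (h : p + n = q) : ∃ g, S.g.f p ≫ g = z.v p q h := by
    have h0 : S.f.f p ≫ z.v p q h = 0 := by
      have := Cochain.congr_v hz p q h
      rwa [Cochain.zero_cochain_comp_v, Cochain.ofHom_v, Cochain.zero_v] at this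
    exact ⟨(hS' p).desc (CokernelCofork.ofπ _ h0), (hS' p).fac _ WalkingParallelPair.one⟩
  choose g hg using key
  refine ⟨Cochain.mk g, ?_⟩
  ext p q h : 1
  rw [Cochain.zero_cochain_comp_v, Cochain.ofHom_v, Cochain.mk_v, hg]

lemma cochain_eq_of_epi {A B : Ch R} {g : A ⟶ B} [Epi g] {n : ℤ} {z z' : Cochain B Y n}
    (h : (Cochain.ofHom g).comp z (zero_add n) = (Cochain.ofHom g).comp z' (zero_add n)) :
    z = z' := by
  ext p q hpq : 1
  have := Cochain.congr_v h p q hpq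
  rw [Cochain.zero_cochain_comp_v, Cochain.zero_cochain_comp_v, Cochain.ofHom_v] at this
  rwa [cancel_epi] at this

lemma ofHom_comp_ofHom_comp {A B C Y : Ch R} {f : A ⟶ B} {g : B ⟶ C} (h : f ≫ g = 0) {n : ℤ}
    (z : Cochain C Y n) :
    (Cochain.ofHom f).comp ((Cochain.ofHom g).comp z (zero_add n)) (zero_add n) = 0 := by
  rw [← Cochain.comp_assoc_of_first_is_zero_cochain, ← Cochain.ofHom_comp, h, Cochain.ofHom_zero,
    Cochain.zero_comp]

/-- Since `Y` is degreewise pure-injective, `Hom(-, Y)` turns `S` into a short exact sequence of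
complexes. This lemma and the two that follow are the two-out-of-three property for acyclicity of
its terms, carried out with cochains. -/
lemma Orth.middle (hS : dwPureExact R S) (hY : dwPureInjective R Y) (h₁ : Orth S.X₁ Y)
    (h₃ : Orth S.X₃ Y) : Orth S.X₂ Y := by
  intro m n hmn z hz
  have := hS.shortExact.epi_g
  obtain ⟨w, hw⟩ := h₁ m n hmn ((Cochain.ofHom S.f).comp z (zero_add n))
    (fun k => by rw [δ_ofHom_comp, hz, Cochain.comp_zero])
  obtain ⟨w', rfl⟩ := exists_cochain_extension hS.pureMono hY w
  rw [δ_ofHom_comp] at hw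
  obtain ⟨z', hz'⟩ := exists_cochain_desc hS.shortExact (z - δ m n w') (by
    rw [Cochain.comp_sub, hw, sub_self])
  obtain ⟨v, hv⟩ := h₃ m n hmn z' (fun k => cochain_eq_of_epi (g := S.g) (by
    rw [← δ_ofHom_comp, hz', δ_sub, hz, δ_δ, Cochain.comp_zero, sub_zero]))
  refine ⟨w' + (Cochain.ofHom S.g).comp v (zero_add m), ?_⟩
  rw [δ_add, δ_ofHom_comp, hv, hz']
  abel

lemma Orth.last (hS : dwPureExact R S) (hY : dwPureInjective R Y) (h₁ : Orth S.X₁ Y)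
    (h₂ : Orth S.X₂ Y) : Orth S.X₃ Y := by
  intro m n hmn z hz
  have := hS.shortExact.epi_g
  obtain ⟨w, hw⟩ := h₂ m n hmn ((Cochain.ofHom S.g).comp z (zero_add n))
    (fun k => by rw [δ_ofHom_comp, hz, Cochain.comp_zero])
  obtain ⟨v, hv⟩ := h₁ (m - 1) m (by omega) ((Cochain.ofHom S.f).comp w (zero_add m)) (fun k => by
    by_cases hk : m + 1 = k
    · obtain rfl : k = n := by omega
      rw [δ_ofHom_comp, hw, ofHom_comp_ofHom_comp S.zero]
    · exact δ_shape _ _ hk _)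
  obtain ⟨v', rfl⟩ := exists_cochain_extension hS.pureMono hY v
  rw [δ_ofHom_comp] at hv
  obtain ⟨w', hw'⟩ := exists_cochain_desc hS.shortExact (w - δ (m - 1) m v') (by
    rw [Cochain.comp_sub, hv, sub_self])
  refine ⟨w', cochain_eq_of_epi (g := S.g) ?_⟩
  rw [← δ_ofHom_comp, hw', δ_sub, δ_δ, hw, sub_zero]

lemma Orth.first (hS : dwPureExact R S) (hY : dwPureInjective R Y) (h₂ : Orth S.X₂ Y)
    (h₃ : Orth S.X₃ Y) : Orth S.X₁ Y := by
  intro m n hmn z hz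
  have := hS.shortExact.epi_g
  obtain ⟨z', rfl⟩ := exists_cochain_extension hS.pureMono hY z
  obtain ⟨t, ht⟩ := exists_cochain_desc hS.shortExact (δ n (n + 1) z') (by
    rw [← δ_ofHom_comp, hz])
  obtain ⟨v, hv⟩ := h₃ n (n + 1) rfl t (fun k => cochain_eq_of_epi (g := S.g) (by
    rw [← δ_ofHom_comp, ht, δ_δ, Cochain.comp_zero]))
  obtain ⟨w, hw⟩ := h₂ m n hmn (z' - (Cochain.ofHom S.g).comp v (zero_add n)) (fun k => by
    by_cases hk : n + 1 = k
    · subst hk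
      rw [δ_sub, δ_ofHom_comp, hv, ht, sub_self]
    · exact δ_shape _ _ hk _)
  refine ⟨(Cochain.ofHom S.f).comp w (zero_add m), ?_⟩
  rw [δ_ofHom_comp, hw, Cochain.comp_sub, ofHom_comp_ofHom_comp S.zero, sub_zero]

/-- Sections of admissible epimorphisms with pure-injective kernel. -/
lemma exists_retraction_of_pureInjective {A B : ModuleCat.{u} R} {f : A ⟶ B} (hf : PureMono f)
    (hA : pureInjective R A) : ∃ r : B ⟶ A, f ≫ r = 𝟙 A := hf.extend hA (𝟙 A)

/-- The sequence with kernel `K` splits in each degree and maps to the components of `K` extend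
along `i`, so lifts exist degreewise. The obstruction to a lift that commutes with the differentials
is a cocycle of degree one from `Q` to `K`, which is a boundary by orthogonality. -/
lemma hasLift_of_orth {A B X Y Q K : Ch R} {i : A ⟶ B} {π : B ⟶ Q} {wi : i ≫ π = 0}
    (hi : dwPureExact R (ShortComplex.mk i π wi)) {k : K ⟶ X} {p : X ⟶ Y} {wp : k ≫ p = 0}
    (hp : dwPureExact R (ShortComplex.mk k p wp)) (hK : dwPureInjective R K) (hQK : Orth Q K) :
    HasLiftingProperty i p where
  sq_hasLift {t b} sq := by
    have hS (n : ℤ) : Nonempty (sq.map (HomologicalComplex.eval _ _ n)).LiftStruct := by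
      obtain ⟨r, hr⟩ := exists_retraction_of_pureInjective (hp.pureMono n) (hK n)
      have hex := (hp n).1
      have : Mono (k.f n) := hex.mono_f
      have : Epi (p.f n) := hex.epi_g
      have hkp : k.f n ≫ p.f n = 0 := by rw [← HomologicalComplex.comp_f, wp]; rfl
      obtain ⟨s, hid, hs⟩ : ∃ s : Y.X n ⟶ X.X n,
          r ≫ k.f n + p.f n ≫ s = 𝟙 (X.X n) ∧ s ≫ p.f n = 𝟙 (Y.X n) := by
        let σ : (ShortComplex.mk (k.f n) (p.f n) hkp).Splitting :=
          ShortComplex.Splitting.ofExactOfRetraction _ hex.exact r hr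
            (inferInstanceAs (Epi (p.f n)))
        exact ⟨σ.s, σ.id, σ.s_g⟩
      obtain ⟨e, he⟩ := (hi.pureMono n).extend (hK n) (t.f n ≫ r)
      have hw : t.f n ≫ p.f n = i.f n ≫ b.f n := by
        rw [← HomologicalComplex.comp_f, sq.w, HomologicalComplex.comp_f]
      refine ⟨⟨e ≫ k.f n + b.f n ≫ s, ?_, ?_⟩⟩
      · change i.f n ≫ (e ≫ k.f n + b.f n ≫ s) = t.f n
        have he' : i.f n ≫ e = t.f n ≫ r := he
        rw [Preadditive.comp_add, ← Category.assoc, ← Category.assoc, he', ← hw, Category.assoc,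
          Category.assoc, ← Preadditive.comp_add, hid, Category.comp_id]
      · change (e ≫ k.f n + b.f n ≫ s) ≫ p.f n = b.f n
        rw [Preadditive.add_comp, Category.assoc, Category.assoc, hkp, hs, comp_zero, zero_add,
          Category.comp_id]
    obtain ⟨α, hα⟩ := hQK 0 1 (by omega)
      (CochainComplex.Lifting.cocycle₁ sq (fun n => (hS n).some) hi.shortExact.gIsCokernel
        hp.shortExact.fIsKernel).1
      (fun k => Cocycle.δ_eq_zero _ k)
    exact CochainComplex.Lifting.hasLift sq _ _ _ α hα

lemma isZero_eval {Z : Ch R} (hZ : IsZero Z) (n : ℤ) : IsZero (Z.X n) :=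
  (HomologicalComplex.eval (ModuleCat.{u} R) (ComplexShape.up ℤ) n).map_isZero hZ

lemma pureMono_of_isZero {A B : ModuleCat.{u} R} (hA : IsZero A) (f : A ⟶ B) : PureMono f :=
  fun _ _ => ⟨0, hA.eq_of_src _ _⟩

lemma dwPureExact_of_isZero_left {Z X : Ch R} (hZ : IsZero Z) (f : Z ⟶ X) :
    dwPureExact R (ShortComplex.mk f (𝟙 X) (hZ.eq_of_src _ _)) := by
  refine dwPureExact_iff.2 ⟨?_, fun n => pureMono_of_isZero (isZero_eval hZ n) _⟩
  have : Mono f := hZ.mono _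
  exact { exact := (ShortComplex.exact_iff_mono _ (hZ.eq_of_src _ _)).2 inferInstance }

lemma dwPureExact_of_isZero_right {Z X : Ch R} (hZ : IsZero Z) (g : X ⟶ Z) :
    dwPureExact R (ShortComplex.mk (𝟙 X) g (hZ.eq_of_tgt _ _)) := by
  refine dwPureExact_iff.2 ⟨?_, fun n => PureMono.of_isIso _⟩
  have : Epi g := hZ.epi _
  exact { exact := (ShortComplex.exact_iff_epi _ (hZ.eq_of_tgt _ _)).2 inferInstance }

lemma extVanishes_of_orth {X Y : Ch R} (hY : dwPureInjective R Y) (h : Orth X Y) :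
    ExtVanishes (dwPureExact R) X Y := by
  intro Z f g w hS
  have := hasLift_of_orth (dwPureExact_of_isZero_left initialIsInitial.isZero (initial.to X)) hS hY h
  have sq : CommSq (initial.to Z) (initial.to X) g (𝟙 X) := ⟨by simp⟩
  have := hS.shortExact.mono_f
  exact ⟨ShortComplex.Splitting.ofExactOfSection _ hS.shortExact.exact sq.lift sq.fac_right
    (inferInstanceAs (Mono f))⟩

/-! ### Pure acyclic complexes -/

/-- The complexes that remain acyclic under `M ⊗_R -`, for all right modules `M`. -/
def PureAcyclic (X : Ch R) : Prop :=
  ∀ (i j k : ℤ), i + 1 = j → j + 1 = k → PureExactAt (X.d i j) (X.d j k)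

lemma isZero_pureInjective {A : ModuleCat.{u} R} (hA : IsZero A) : pureInjective R A :=
  fun _ _ _ => ⟨0, hA.eq_of_tgt _ _⟩

lemma dwPureInjective_single {A : ModuleCat.{u} R} (hA : pureInjective R A) (j : ℤ) :
    dwPureInjective R ((HomologicalComplex.single _ _ j).obj A) := fun n => by
  by_cases h : n = j
  · subst h
    refine (pureInjective_iff _).2 fun B C f hf g => ?_
    let e := HomologicalComplex.singleObjXSelf (ComplexShape.up ℤ) n A
    obtain ⟨h, hh⟩ := hf.extend hA (g ≫ e.hom)
    exact ⟨h ≫ e.inv, by rw [← Category.assoc, hh]; simp⟩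
  · exact isZero_pureInjective (HomologicalComplex.isZero_single_obj_X _ _ _ _ h)

/-- For a target concentrated in one degree, the complex of homomorphisms is, up to signs and
reindexing, the complex of maps from the components of `X` to `leftDual R M`. -/
lemma pureAcyclic_iff_orth (X : Ch R) : PureAcyclic X ↔ ∀ (M : ModuleCat.{u} Rᵐᵒᵖ) (j : ℤ),
    Orth X ((HomologicalComplex.single _ _ j).obj (leftDual R M)) := by
  constructor
  · intro hX M j m n hmn z hz
    let e := HomologicalComplex.singleObjXSelf (ComplexShape.up ℤ) j (leftDual R M)
    have hzero (p : ℤ) (hp : p ≠ j) :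
        IsZero (((HomologicalComplex.single _ (ComplexShape.up ℤ) j).obj (leftDual R M)).X p) :=
      HomologicalComplex.isZero_single_obj_X _ _ _ _ hp
    have hd (p q : ℤ) :
        ((HomologicalComplex.single _ (ComplexShape.up ℤ) j).obj (leftDual R M)).d p q = 0 := by
      simp
    obtain ⟨ψ, hψ⟩ := hX (j - n - 1) (j - n) (j - m) (by omega) (by omega) M
      (z.v (j - n) j (by omega) ≫ e.hom) (by
        have := Cochain.congr_v (hz (n + 1)) (j - n - 1) j (by omega)
        rw [δ_v n (n + 1) rfl _ _ _ _ (j - 1) (j - n) (by omega) (by omega), hd, comp_zero, zero_add,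
          Cochain.zero_v] at this
        have h2 : X.d (j - n - 1) (j - n) ≫ z.v (j - n) j (by omega) = 0 := by
          rw [← smul_left_cancel_iff (n + 1).negOnePow, this, smul_zero]
        rw [← Category.assoc, h2, zero_comp])
    refine ⟨n.negOnePow • Cochain.single (ψ ≫ e.inv) m, ?_⟩
    ext p q hpq : 1
    by_cases hq : q = j
    · subst hq
      obtain rfl : p = q - n := by omega
      rw [δ_v m n hmn _ _ _ _ (q - 1) (q - m) (by omega) (by omega), hd, comp_zero, zero_add,
        Cochain.units_smul_v, Cochain.single_v, Linear.comp_units_smul, smul_smul,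
        ← Int.negOnePow_add, Int.negOnePow_even _ ⟨n, rfl⟩, one_smul, ← Category.assoc, hψ]
      simp
    · exact (hzero q hq).eq_of_tgt _ _
  · rintro h i j k rfl rfl M φ hφ
    let Y := (HomologicalComplex.single (ModuleCat.{u} R) (ComplexShape.up ℤ) (i + 1)).obj (leftDual R M)
    let e := HomologicalComplex.singleObjXSelf (ComplexShape.up ℤ) (i + 1) (leftDual R M)
    let f : X ⟶ Y := HomologicalComplex.mkHomToSingle φ (fun p hp => by
      obtain rfl : p = i := by simpa using hp
      exact hφ)
    obtain ⟨ho⟩ := (h M (i + 1)).homotopy f 0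
    have h1 := ho.comm (i + 1)
    rw [dNext_eq ho.hom (show (ComplexShape.up ℤ).Rel (i + 1) (i + 1 + 1) by simp),
      prevD_eq ho.hom (show (ComplexShape.up ℤ).Rel i (i + 1) by simp)] at h1
    have h2 : f.f (i + 1) = φ ≫ e.inv := HomologicalComplex.mkHomToSingle_f _ _
    refine ⟨ho.hom (i + 1 + 1) (i + 1) ≫ e.hom, ?_⟩
    rw [h2] at h1
    have h3 : φ = (φ ≫ e.inv) ≫ e.hom := by simp
    rw [h3, h1]
    simp

lemma PureAcyclic.first (hS : dwPureExact R S) (h₂ : PureAcyclic S.X₂) (h₃ : PureAcyclic S.X₃) :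
    PureAcyclic S.X₁ := by
  rw [pureAcyclic_iff_orth] at *
  exact fun M j => Orth.first hS (dwPureInjective_single (pureInjective_leftDual M) j)
    (h₂ M j) (h₃ M j)

lemma PureAcyclic.of_orth {X : Ch R} (h : ∀ Y, dwPureInjective R Y → Orth X Y) : PureAcyclic X :=
  (pureAcyclic_iff_orth X).2 fun M j => h _ (dwPureInjective_single (pureInjective_leftDual M) j)

lemma PureAcyclic.exact {X : Ch R} (hX : PureAcyclic X) {i j k : ℤ} (hij : i + 1 = j)
    (hjk : j + 1 = k) : Function.Exact (X.d i j) (X.d j k) := fun x =>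
  ⟨(hX i j k hij hjk).exact x, by
    rintro ⟨y, rfl⟩
    exact congr($(X.d_comp_d i j k) y)⟩

lemma PureAcyclic.acyclic {X : Ch R} (hX : PureAcyclic X) : acyclic R X := fun j => by
  rw [HomologicalComplex.exactAt_iff' X (j - 1) j (j + 1) (by simp) (by simp),
    ShortComplex.moduleCat_exact_iff]
  exact fun x hx => (hX.exact (by omega) rfl x).1 hx

/-- A pure acyclic complex of pure-injective modules is contractible. -/
lemma PureAcyclic.contractible {X : Ch R} (hX : PureAcyclic X) (hX' : dwPureInjective R X) :
    Nonempty (Homotopy (𝟙 X) 0) := by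
  let Z (n : ℤ) : ModuleCat.{u} R := ModuleCat.of R (LinearMap.ker (X.d n (n + 1)).hom)
  let i (n : ℤ) : Z n ⟶ X.X n := ModuleCat.ofHom (Submodule.subtype _)
  have hdd (n m k : ℤ) (x : X.X n) : X.d m k (X.d n m x) = 0 := congr($(X.d_comp_d n m k) x)
  let p (n m : ℤ) : X.X n ⟶ Z m :=
    ModuleCat.ofHom ((X.d n m).hom.codRestrict _ fun x => hdd n m (m + 1) x)
  have hp (n : ℤ) : Function.Surjective (p n (n + 1)) := fun x => by
    obtain ⟨y, hy⟩ := (hX.exact rfl rfl x.1).1 x.2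
    exact ⟨y, Subtype.ext hy⟩
  have hip (n : ℤ) : Function.Exact (i n) (p n (n + 1)) := fun x => by
    refine ⟨fun hx => ⟨⟨x, congrArg Subtype.val hx⟩, rfl⟩, ?_⟩
    rintro ⟨y, rfl⟩
    exact Subtype.ext y.2
  -- The composite of `φ` with the surjection onto the cycles kills boundaries, so by pure
  -- acyclicity it factors through the differential, and the factor extends `φ`.
  have hi (n : ℤ) : PureMono (i n) := fun M φ => by
    obtain ⟨ψ, hψ⟩ := hX (n - 2) (n - 1) n (by omega) (by omega) M (p (n - 1) n ≫ φ) (by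
      have : X.d (n - 2) (n - 1) ≫ p (n - 1) n = 0 := by
        refine ModuleCat.hom_ext (LinearMap.ext fun x => Subtype.ext ?_)
        exact hdd (n - 2) (n - 1) n x
      rw [← Category.assoc, this, zero_comp])
    refine ⟨ψ, ?_⟩
    ext x
    obtain ⟨y, hy⟩ := (hX.exact (i := n - 1) (by omega) rfl x.1).1 x.2
    have h1 : ψ (X.d (n - 1) n y) = φ (p (n - 1) n y) := congr($hψ y)
    have h2 : p (n - 1) n y = x := Subtype.ext hy
    have h3 : i n x = X.d (n - 1) n y := hy.symm
    change ψ (i n x) = φ x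
    rw [h3, h1, h2]
  -- Periodicity is applied to the identity maps of the modules of cycles, which gives sections `s`
  -- of the surjections `p`.
  choose s hs using fun n m (h : n + 1 = m) =>
    homLifts_of_periodic i p hi hip hp hX' (Z m) n m h LinearMap.id
  have hs' (n m) (h : n + 1 = m) (x : Z m) : X.d n m (s n m h x) = x.1 :=
    congrArg Subtype.val congr($(hs n m h) x)
  -- The contraction sends `x` to `s (x - s (d x))`. Then `d t` is `1 - s p` and `t d` is `s p`.
  let t (m n : ℤ) (h : n + 1 = m) : X.X m →ₗ[R] X.X n :=
    s n m h ∘ₗ (LinearMap.id - s m (m + 1) rfl ∘ₗ (p m (m + 1)).hom).codRestrict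
      (LinearMap.ker (X.d m (m + 1)).hom) (fun x => by
        refine LinearMap.mem_ker.2 ((map_sub _ _ _).trans (sub_eq_zero.2 ?_))
        exact (hs' m (m + 1) rfl (p m (m + 1) x)).symm)
  have ht (m n : ℤ) (h : n + 1 = m) (x : X.X m) :
      X.d n m (t m n h x) = x - s m (m + 1) rfl (p m (m + 1) x) := hs' n m h _
  have ht' (m : ℤ) (x : X.X m) :
      t (m + 1) m rfl (X.d m (m + 1) x) = s m (m + 1) rfl (p m (m + 1) x) := by
    refine congrArg (s m (m + 1) rfl) (Subtype.ext ?_)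
    have : p (m + 1) (m + 1 + 1) (X.d m (m + 1) x) = 0 := Subtype.ext (hdd _ _ _ x)
    change X.d m (m + 1) x - s _ _ rfl (p (m + 1) (m + 1 + 1) (X.d m (m + 1) x)) = X.d m (m + 1) x
    rw [this, map_zero, sub_zero]
  refine ⟨{ hom := fun m n => if h : n + 1 = m then ModuleCat.ofHom (t m n h) else 0
            zero := fun m n hmn => dif_neg hmn
            comm := fun m => ?_ }⟩
  rw [dNext_eq _ (show (ComplexShape.up ℤ).Rel m (m + 1) by simp),
    prevD_eq _ (show (ComplexShape.up ℤ).Rel (m - 1) m by simp), dif_pos rfl,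
    dif_pos (show m - 1 + 1 = m by omega)]
  ext x
  have h1 := ht m (m - 1) (by omega) x
  have h2 := ht' m x
  change x = t (m + 1) m rfl (X.d m (m + 1) x) + X.d (m - 1) m (t m (m - 1) _ x) + 0
  rw [h1, h2]
  abel

end Orthogonal

end KFlatModel

end
-- Character duality for complexes, and acyclic K-flat complexes.
noncomputable section
namespace KFlatModel

open CochainComplex.HomComplex Opposite

/-! ### Duality between tensor products and homomorphisms of complexes -/

section Duality

section Characters

variable {S : Type w} [Ring S]

/-- Natural isomorphisms between maps to `T` and characters. -/
structure CharacterObject (T : ModuleCat.{u} S) where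
  /-- Maps to `T` are the same as characters. -/
  equiv (N : ModuleCat.{u} S) : (N ⟶ T) ≃+ (N →+ AddCircle (1 : ℚ))
  equiv_comp {N N' : ModuleCat.{u} S} (f : N ⟶ N') (φ : N' ⟶ T) :
    equiv N (f ≫ φ) = (equiv N' φ).comp f.hom.toAddMonoidHom

/-- The group of characters `ℚ / ℤ`. -/
def intCharacterObject :
    CharacterObject (ModuleCat.of ℤ (ULift.{u} (AddCircle (1 : ℚ)))) where
  equiv N :=
    { toFun φ := AddEquiv.ulift.toAddMonoidHom.comp φ.hom.toAddMonoidHom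
      invFun c := ModuleCat.ofHom
        { toFun n := ULift.up (c n)
          map_add' x y := congrArg ULift.up (map_add c x y)
          map_smul' k x := congrArg ULift.up ((congrArg c (int_smul_eq_zsmul _ k x)).trans
            (map_zsmul c k x)) }
      left_inv φ := rfl
      right_inv c := rfl
      map_add' _ _ := rfl }
  equiv_comp _ _ := rfl

/-- The character module of a ring. -/
def ringCharacterObject (S : Type u) [Ring S] :
    CharacterObject (leftDual S (ModuleCat.of Sᵐᵒᵖ S)) where
  equiv N :=
    { toFun φ :=
        { toFun n := φ.hom n (1 : S)
          map_zero' := congr($(map_zero φ.hom) (1 : S))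
          map_add' x y := congr($(map_add φ.hom x y) (1 : S)) }
      invFun c := ModuleCat.ofHom
        { toFun n := (c.comp (AddMonoidHom.flip (AddMonoidHom.smul : S →+ N →+ N) n) :)
          map_add' x y := by
            refine RightHom.ext S fun (r : S) => ?_
            change c (r • (x + y)) = c (r • x) + c (r • y)
            rw [smul_add, map_add]
          map_smul' s x := by
            refine RightHom.ext S fun (r : S) => ?_
            change c (r • s • x) = c ((r * s) • x)
            rw [mul_smul] }
      left_inv φ := by
        refine ModuleCat.hom_ext (LinearMap.ext fun n => RightHom.ext S fun (r : S) => ?_)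
        change φ.hom (r • n) (1 : S) = φ.hom n r
        rw [map_smul φ.hom]
        change φ.hom n ((1 : S) * r) = _
        rw [one_mul]
      right_inv c := by
        ext n
        change c ((1 : S) • n) = c n
        rw [one_smul]
      map_add' _ _ := rfl }
  equiv_comp _ _ := rfl

variable {T : ModuleCat.{u} S} (c : CharacterObject T)

include c

lemma CharacterObject.exact_iff (K : ShortComplex (ModuleCat.{u} S)) :
    K.Exact ↔ ∀ φ : K.X₂ ⟶ T, K.f ≫ φ = 0 → ∃ ψ : K.X₃ ⟶ T, K.g ≫ ψ = φ := by
  rw [ShortComplex.ShortExact.moduleCat_exact_iff_function_exact]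
  refine (exact_iff_character K.f.hom.toAddMonoidHom K.g.hom.toAddMonoidHom
    (fun a => congr($K.zero a))).trans ⟨fun h φ hφ => ?_, fun h φ hφ => ?_⟩
  · obtain ⟨ψ, hψ⟩ := h (c.equiv _ φ) (by rw [← c.equiv_comp, hφ, map_zero])
    refine ⟨(c.equiv _).symm ψ, (c.equiv _).injective ?_⟩
    rw [c.equiv_comp, AddEquiv.apply_symm_apply, hψ]
  · obtain ⟨ψ, hψ⟩ := h ((c.equiv _).symm φ) ((c.equiv _).injective (by
      rw [c.equiv_comp, AddEquiv.apply_symm_apply, hφ, map_zero]))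
    refine ⟨c.equiv _ ψ, ?_⟩
    rw [← c.equiv_comp, hψ, AddEquiv.apply_symm_apply]

lemma CharacterObject.acyclic_iff (K : CochainComplex (ModuleCat.{u} S) ℤ) :
    K.Acyclic ↔ ∀ (i j k : ℤ) (_ : i + 1 = j) (_ : j + 1 = k) (φ : K.X j ⟶ T),
      K.d i j ≫ φ = 0 → ∃ ψ : K.X k ⟶ T, K.d j k ≫ ψ = φ := by
  refine ⟨?_, fun h j => ?_⟩
  · rintro h i j k rfl rfl
    have := h (i + 1)
    rw [HomologicalComplex.exactAt_iff' K i (i + 1) (i + 1 + 1) (by simp) (by simp),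
      c.exact_iff] at this
    exact this
  · rw [HomologicalComplex.exactAt_iff' K (j - 1) j (j + 1) (by simp) (by simp), c.exact_iff]
    exact h (j - 1) j (j + 1) (by omega) rfl

end Characters

variable {C B D : Type*} [Category* C] [Preadditive C] [Category* B] [Preadditive B]
  [Category* D] [Preadditive D]

/-- A functor `dual` with natural isomorphisms `Hom(F(M, N), T) ≅ Hom(N, dual M)`. -/
structure BifunctorDuality (F : C ⥤ B ⥤ D) (T : D) (dual : Cᵒᵖ ⥤ B) where
  /-- The isomorphism `Hom(F(M, N), T) ≅ Hom(N, dual M)`. -/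
  equiv (M : C) (N : B) : ((F.obj M).obj N ⟶ T) ≃+ (N ⟶ dual.obj (op M))
  nat_right {M : C} {N N' : B} (f : N ⟶ N') (φ : (F.obj M).obj N' ⟶ T) :
    equiv M N ((F.obj M).map f ≫ φ) = f ≫ equiv M N' φ
  nat_left {M M' : C} {N : B} (g : M ⟶ M') (φ : (F.obj M').obj N ⟶ T) :
    equiv M N ((F.map g).app N ≫ φ) = equiv M' N φ ≫ dual.map g.op

/-- The dual of a complex. -/
def dualComplex (dual : Cᵒᵖ ⥤ B) [dual.PreservesZeroMorphisms]
    (E : CochainComplex C ℤ) : CochainComplex B ℤ where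
  X n := dual.obj (op (E.X (-n)))
  d i j := dual.map (E.d (-j) (-i)).op
  shape i j h := by
    rw [E.shape _ _ (fun h' => h (by simp at h' ⊢; omega)), op_zero, dual.map_zero]
  d_comp_d' i j k _ _ := by
    rw [← dual.map_comp, ← op_comp, E.d_comp_d, op_zero, dual.map_zero]

/-- The sign `(-1)^{j (j - 1) / 2}`. -/
def twistSign (j : ℤ) : ℤˣ := (j * (j - 1) / 2).negOnePow

lemma twistSign_succ (j : ℤ) : twistSign (j + 1) = j.negOnePow * twistSign j := by
  rw [twistSign, twistSign, ← Int.negOnePow_add]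
  congr 1
  have : (j + 1) * (j + 1 - 1) = j * (j - 1) + j * 2 := by ring
  rw [this, Int.add_mul_ediv_right _ _ (by norm_num), add_comm]

lemma twistSign_mul_self (j : ℤ) : twistSign j * twistSign j = 1 := Int.units_mul_self _

lemma ι_mapBifunctor_d {C₁ C₂ D : Type*} [Category* C₁] [Category* C₂] [Category* D]
    [HasZeroMorphisms C₁] [HasZeroMorphisms C₂] [Preadditive D]
    (F : C₁ ⥤ C₂ ⥤ D) [F.PreservesZeroMorphisms] [∀ M, (F.obj M).PreservesZeroMorphisms]
    (E : CochainComplex C₁ ℤ) (W : CochainComplex C₂ ℤ)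
    [HomologicalComplex.HasMapBifunctor E W F (ComplexShape.up ℤ)] (i i' j j' n n' : ℤ)
    (hi : i + 1 = i') (hj : j + 1 = j') (h : i + j = n) (h' : n + 1 = n') :
    HomologicalComplex.ιMapBifunctor E W F (ComplexShape.up ℤ) i j n h ≫
      (HomologicalComplex.mapBifunctor E W F (ComplexShape.up ℤ)).d n n' =
    (F.map (E.d i i')).app (W.X j) ≫
        HomologicalComplex.ιMapBifunctor E W F (ComplexShape.up ℤ) i' j n'
          (show i' + j = n' by omega) +
      i.negOnePow • ((F.obj (E.X i)).map (W.d j j') ≫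
        HomologicalComplex.ιMapBifunctor E W F (ComplexShape.up ℤ) i j' n'
          (show i + j' = n' by omega)) := by
  have hi' : (ComplexShape.up ℤ).Rel i i' := hi
  have hj' : (ComplexShape.up ℤ).Rel j j' := hj
  rw [HomologicalComplex.mapBifunctor.d_eq, Preadditive.comp_add,
    HomologicalComplex.mapBifunctor.ι_D₁, HomologicalComplex.mapBifunctor.ι_D₂,
    HomologicalComplex.mapBifunctor.d₁_eq _ _ _ _ hi' _ _ (show i' + j = n' by omega),
    HomologicalComplex.mapBifunctor.d₂_eq _ _ _ _ _ hj' _ (show i + j' = n' by omega)]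
  congr 1
  exact one_smul _ _

variable {F : C ⥤ B ⥤ D} {T : D} {dual : Cᵒᵖ ⥤ B} [dual.PreservesZeroMorphisms]
  (Δ : BifunctorDuality F T dual) (E : CochainComplex C ℤ)

namespace BifunctorDuality

/-- The isomorphisms of a duality, for the components of a complex. -/
def equivX (q : ℤ) (N : B) : ((F.obj (E.X (-q))).obj N ⟶ T) ≃+ (N ⟶ (dualComplex dual E).X q) :=
  Δ.equiv (E.X (-q)) N

lemma equivX_units_smul (q : ℤ) {N : B} (e : ℤˣ) (φ : (F.obj (E.X (-q))).obj N ⟶ T) :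
    Δ.equivX E q N (e • φ) = e • Δ.equivX E q N φ := by
  rcases Int.units_eq_one_or e with rfl | rfl <;> simp [Units.neg_smul]

lemma equivX_right (q : ℤ) {N N' : B} (f : N ⟶ N') (φ : (F.obj (E.X (-q))).obj N' ⟶ T) :
    Δ.equivX E q N ((F.obj (E.X (-q))).map f ≫ φ) = f ≫ Δ.equivX E q N' φ :=
  Δ.nat_right f φ

lemma equivX_left (q q' : ℤ) {N : B} (φ : (F.obj (E.X (-q'))).obj N ⟶ T) :
    Δ.equivX E q N ((F.map (E.d (-q) (-q'))).app N ≫ φ) =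
      Δ.equivX E q' N φ ≫ (dualComplex dual E).d q' q :=
  Δ.nat_left (E.d (-q) (-q')) φ

end BifunctorDuality

variable [F.PreservesZeroMorphisms] [∀ M, (F.obj M).PreservesZeroMorphisms]
  (W : CochainComplex B ℤ) [HomologicalComplex.HasMapBifunctor E W F (ComplexShape.up ℤ)]

/-- The cochain that corresponds to a character of the tensor product of complexes. -/
def charCochain (n : ℤ)
    (φ : (HomologicalComplex.mapBifunctor E W F (ComplexShape.up ℤ)).X n ⟶ T) (m : ℤ)
    (hm : n + m = 0) : Cochain W (dualComplex dual E) m :=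
  Cochain.mk fun p q _ => twistSign p • Δ.equivX E q (W.X p)
    (HomologicalComplex.ιMapBifunctor E W F (ComplexShape.up ℤ) (-q) p n
      (show -q + p = n by omega) ≫ φ)

lemma charCochain_v (n : ℤ)
    (φ : (HomologicalComplex.mapBifunctor E W F (ComplexShape.up ℤ)).X n ⟶ T) (m : ℤ)
    (hm : n + m = 0) (p q : ℤ) (hpq : p + m = q) :
    (charCochain Δ E W n φ m hm).v p q hpq = twistSign p • Δ.equivX E q (W.X p)
      (HomologicalComplex.ιMapBifunctor E W F (ComplexShape.up ℤ) (-q) p n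
        (show -q + p = n by omega) ≫ φ) := rfl

lemma charCochain_zero (n m : ℤ) (hm : n + m = 0) : charCochain Δ E W n 0 m hm = 0 := by
  ext p q hpq : 1
  rw [charCochain_v, comp_zero, map_zero, smul_zero, Cochain.zero_v]

lemma charCochain_injective (n m : ℤ) (hm : n + m = 0) :
    Function.Injective fun φ => charCochain Δ E W n φ m hm := by
  intro φ φ' h
  refine HomologicalComplex.mapBifunctor.hom_ext fun i j hij => ?_
  change i + j = n at hij
  obtain ⟨q, rfl⟩ : ∃ q, i = -q := ⟨-i, by simp⟩
  have h1 := Cochain.congr_v h j q (by omega)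
  rw [charCochain_v, charCochain_v] at h1
  exact (Δ.equivX E q _).injective ((smul_left_cancel_iff _).1 h1)

lemma charCochain_surjective (n m : ℤ) (hm : n + m = 0) :
    Function.Surjective fun φ => charCochain Δ E W n φ m hm := by
  intro z
  let ψ (q j : ℤ) (h : -q + j = n) : (F.obj (E.X (-q))).obj (W.X j) ⟶ T :=
    (Δ.equivX E q _).symm (twistSign j • z.v j q (by omega))
  have hψ (q q' j : ℤ) (hq : q = q') (h : -q + j = n) (h' : -q' + j = n) :
      (F.map (E.XIsoOfEq (show -q = -q' by omega)).hom).app (W.X j) ≫ ψ q' j h' = ψ q j h := by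
    subst hq
    simp
  -- The duality is formulated in the degrees `-q` of `E`, so the summand of index `i` is
  -- transported to index `-(-i)`, which equals `i` only propositionally.
  refine ⟨HomologicalComplex.mapBifunctorDesc fun i j hij =>
    (F.map (E.XIsoOfEq (show i = -(-i) by omega)).hom).app (W.X j) ≫
      ψ (-i) j (by change i + j = n at hij; omega), ?_⟩
  ext p q hpq : 1
  beta_reduce
  rw [charCochain_v, HomologicalComplex.ι_mapBifunctorDesc,
    hψ q (- -q) p (by omega) (by omega) (by omega), AddEquiv.apply_symm_apply, smul_smul,
    twistSign_mul_self, one_smul]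

/-- The correspondence is compatible with differentials on the nose, which is the purpose of
`twistSign`: the factor `(-1)^p` in `twistSign (p + 1)` converts the sign `(-1)^m'` of `δ` into
`(-1)^q`, the sign in the differential of the tensor product. -/
lemma δ_charCochain (n n' m m' : ℤ) (hm : n + m = 0) (hm' : n' + m' = 0) (hn : n' + 1 = n)
    (φ : (HomologicalComplex.mapBifunctor E W F (ComplexShape.up ℤ)).X n ⟶ T) :
    δ m m' (charCochain Δ E W n φ m hm) =
      charCochain Δ E W n'
        ((HomologicalComplex.mapBifunctor E W F (ComplexShape.up ℤ)).d n' n ≫ φ) m' hm' := by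
  ext p q hpq : 1
  rw [δ_v m m' (by omega) _ p q hpq (q - 1) (p + 1) (by omega) rfl, charCochain_v, charCochain_v,
    charCochain_v, ← Category.assoc,
    ι_mapBifunctor_d F E W (-q) (-(q - 1)) p (p + 1) n' n (by omega) rfl (by omega) hn,
    Preadditive.add_comp, map_add, Category.assoc, Δ.equivX_left, smul_add,
    Linear.units_smul_comp, Linear.units_smul_comp, Category.assoc, Δ.equivX_units_smul,
    Δ.equivX_right, Linear.comp_units_smul, smul_smul, smul_smul, twistSign_succ,
    ← mul_assoc, ← Int.negOnePow_add, mul_comm (twistSign p)]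
  congr 3
  rw [Int.negOnePow_eq_iff]
  exact ⟨q, by omega⟩

/-- The tensor product with `E` is acyclic if and only if the complex of homomorphisms to the dual
of `E` is. -/
lemma mapBifunctor_acyclic_iff_orth {S : Type w} [Ring S] {F : C ⥤ B ⥤ ModuleCat.{u} S}
    {T : ModuleCat.{u} S} (c : CharacterObject T) (Δ : BifunctorDuality F T dual)
    [F.PreservesZeroMorphisms] [∀ M, (F.obj M).PreservesZeroMorphisms]
    [HomologicalComplex.HasMapBifunctor E W F (ComplexShape.up ℤ)] :
    (HomologicalComplex.mapBifunctor E W F (ComplexShape.up ℤ)).Acyclic ↔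
      Orth W (dualComplex dual E) := by
  rw [c.acyclic_iff]
  constructor
  · intro h m n hmn z hz
    obtain ⟨φ, rfl⟩ := charCochain_surjective Δ E W (-n) n (by omega) z
    obtain ⟨ψ, hψ⟩ := h (-n - 1) (-n) (-m) (by omega) (by omega) φ
      (charCochain_injective Δ E W _ (n + 1) (by omega) (by
        have h1 := hz (n + 1)
        beta_reduce at h1 ⊢
        rw [δ_charCochain Δ E W (-n) (-n - 1) n (n + 1) (by omega) (by omega) (by omega)] at h1
        rw [h1, charCochain_zero]))
    refine ⟨charCochain Δ E W (-m) ψ m (by omega), ?_⟩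
    rw [δ_charCochain Δ E W (-m) (-n) m n (by omega) (by omega) (by omega), hψ]
  · rintro h i j k rfl rfl φ hφ
    obtain ⟨w, hw⟩ := h (-(i + 1) - 1) (-(i + 1)) (by omega)
      (charCochain Δ E W (i + 1) φ (-(i + 1)) (by omega)) (fun l => by
        by_cases hl : -(i + 1) + 1 = l
        · rw [δ_charCochain Δ E W (i + 1) i _ l (by omega) (by omega) rfl, hφ, charCochain_zero]
        · exact δ_shape _ _ hl _)
    obtain ⟨ψ, rfl⟩ := charCochain_surjective Δ E W (i + 1 + 1) _ (by omega) w
    refine ⟨ψ, charCochain_injective Δ E W _ (-(i + 1)) (by omega) ?_⟩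
    beta_reduce at hw ⊢
    rw [← hw, δ_charCochain Δ E W (i + 1 + 1) (i + 1) _ _ (by omega) (by omega) rfl]

end Duality

/-! ### K-flat complexes -/

section KFlat

variable {R : Type u} [Ring R]

variable (R) in
/-- The character modules of right modules, as a functor. -/
@[simps]
def leftDualFunctor : (ModuleCat.{u} Rᵐᵒᵖ)ᵒᵖ ⥤ ModuleCat.{u} R where
  obj M := leftDual R M.unop
  map f := leftDualMap R f.unop

instance : (leftDualFunctor R).PreservesZeroMorphisms where
  map_zero M M' := by
    refine ModuleCat.hom_ext (LinearMap.ext fun φ => RightHom.ext R fun m => ?_)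
    exact AddMonoidHom.map_zero (φ : M.unop →+ AddCircle (1 : ℚ))

variable (R) in
/-- The tensor product of right and left modules is dual to the character modules. -/
def tensorDuality : BifunctorDuality (tensorBifunctor R)
    (ModuleCat.of ℤ (ULift.{u} (AddCircle (1 : ℚ)))) (leftDualFunctor R) where
  equiv M N := (intCharacterObject.equiv _).trans
    { toFun φ := ModuleCat.ofHom (tensorCurry R φ)
      invFun g := (tensorCurry R).symm g.hom
      left_inv φ := (tensorCurry R).symm_apply_apply φ
      right_inv g := ModuleCat.hom_ext ((tensorCurry R).apply_symm_apply g.hom)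
      map_add' _ _ := rfl }
  nat_right f φ := rfl
  nat_left g φ := ModuleCat.hom_ext (LinearMap.ext fun n => RightHom.ext R fun m => rfl)

/-- The complex of character modules of a complex of right modules. -/
abbrev leftDualComplex (E : CochainComplex (ModuleCat.{u} Rᵐᵒᵖ) ℤ) : Ch R :=
  dualComplex (leftDualFunctor R) E

lemma dwPureInjective_leftDualComplex (E : CochainComplex (ModuleCat.{u} Rᵐᵒᵖ) ℤ) :
    dwPureInjective R (leftDualComplex E) := fun _ => pureInjective_leftDual _

lemma kFlat_iff_orth (W : Ch R) :
    kFlat R W ↔ ∀ E : CochainComplex (ModuleCat.{u} Rᵐᵒᵖ) ℤ, E.Acyclic →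
      Orth W (leftDualComplex E) :=
  forall₂_congr fun E _ => mapBifunctor_acyclic_iff_orth E W intCharacterObject (tensorDuality R)

lemma kFlat.of_retract {W W' : Ch R} (r : Retract W' W) (h : kFlat R W) : kFlat R W' := by
  rw [kFlat_iff_orth] at *
  exact fun E hE => (h E hE).of_retract r

lemma kFlat_of_homotopy {W : Ch R} (h : Homotopy (𝟙 W) 0) : kFlat R W :=
  (kFlat_iff_orth W).2 fun _ _ => Orth.of_homotopy_left h _

variable {S : ShortComplex (Ch R)}

lemma kFlat.first (hS : dwPureExact R S) (h₂ : kFlat R S.X₂) (h₃ : kFlat R S.X₃) :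
    kFlat R S.X₁ := by
  rw [kFlat_iff_orth] at *
  exact fun E hE => Orth.first hS (dwPureInjective_leftDualComplex E) (h₂ E hE) (h₃ E hE)

lemma kFlat.middle (hS : dwPureExact R S) (h₁ : kFlat R S.X₁) (h₃ : kFlat R S.X₃) :
    kFlat R S.X₂ := by
  rw [kFlat_iff_orth] at *
  exact fun E hE => Orth.middle hS (dwPureInjective_leftDualComplex E) (h₁ E hE) (h₃ E hE)

end KFlat

end KFlatModel

end
noncomputable section
namespace KFlatModel

open CochainComplex.HomComplex Opposite

/-! ### Acyclic K-flat complexes -/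

section Bidual

variable {R : Type u} [Ring R]

variable (R) in
/-- The group of homomorphisms from a left module to a group. -/
def LeftHom (N : Type u) [AddCommGroup N] (A : Type*) [AddCommGroup A] := N →+ A

namespace LeftHom

variable {N N' : Type u} [AddCommGroup N] [Module R N] [AddCommGroup N'] [Module R N']
  {A : Type*} [AddCommGroup A]

instance : AddCommGroup (LeftHom N A) := inferInstanceAs (AddCommGroup (N →+ A))

instance : FunLike (LeftHom N A) N A := inferInstanceAs (FunLike (N →+ A) N A)

instance : AddMonoidHomClass (LeftHom N A) N A := inferInstanceAs (AddMonoidHomClass (N →+ A) N A)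

omit [Module R N] in
lemma ext {φ ψ : LeftHom N A} (h : ∀ n, φ n = ψ n) : φ = ψ := DFunLike.ext _ _ h

instance : Module Rᵐᵒᵖ (LeftHom N A) where
  smul r φ := (AddMonoidHom.comp φ (DistribSMul.toAddMonoidHom N r.unop) : N →+ A)
  one_smul φ := ext fun n => congrArg φ (one_smul R n)
  mul_smul r s φ := ext fun n => congrArg φ (mul_smul s.unop r.unop n)
  smul_zero _ := rfl
  smul_add _ _ _ := rfl
  add_smul r s φ := ext fun n =>
    (congrArg φ (add_smul r.unop s.unop n)).trans (map_add φ _ _)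
  zero_smul φ := ext fun n => (congrArg φ (zero_smul R n)).trans (map_zero φ)

/-- Precomposition with a linear map. -/
def map (f : N →ₗ[R] N') : LeftHom N' A →ₗ[Rᵐᵒᵖ] LeftHom N A where
  toFun φ := (AddMonoidHom.comp φ f.toAddMonoidHom : N →+ A)
  map_add' _ _ := rfl
  map_smul' r φ := ext fun n => congrArg φ (map_smul f r.unop n).symm

end LeftHom

variable (R) in
/-- The character modules of left modules, as a functor. -/
def rightDualFunctor : (ModuleCat.{u} R)ᵒᵖ ⥤ ModuleCat.{u} Rᵐᵒᵖ where
  obj N := ModuleCat.of Rᵐᵒᵖ (LeftHom N.unop (AddCircle (1 : ℚ)))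
  map f := ModuleCat.ofHom (LeftHom.map f.unop.hom)

instance : (rightDualFunctor R).PreservesZeroMorphisms where
  map_zero N N' := by
    refine ModuleCat.hom_ext (LinearMap.ext fun φ => LeftHom.ext fun n => ?_)
    exact AddMonoidHom.map_zero (φ : N.unop →+ AddCircle (1 : ℚ))

lemma acyclic_dualComplex_rightDualFunctor {W : Ch R} (hW : acyclic R W) :
    (dualComplex (rightDualFunctor R) W).Acyclic := by
  intro j
  rw [HomologicalComplex.exactAt_iff' _ (j - 1) j (j + 1) (by simp) (by simp),
    ShortComplex.moduleCat_exact_iff]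
  intro (φ : W.X (-j) →+ AddCircle (1 : ℚ)) hφ
  have h1 := hW (-j)
  rw [HomologicalComplex.exactAt_iff' W (-(j + 1)) (-j) (-(j - 1)) (by simp; omega) (by simp; omega),
    ShortComplex.ShortExact.moduleCat_exact_iff_function_exact] at h1
  obtain ⟨ψ, hψ⟩ := (exact_iff_character (W.d (-(j + 1)) (-j)).hom.toAddMonoidHom
    (W.d (-j) (-(j - 1))).hom.toAddMonoidHom (fun a => congr($(W.d_comp_d _ _ _) a))).1 h1 φ hφ
  exact ⟨ψ, hψ⟩

/-- The complex of double duals. -/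
abbrev bidual (W : Ch R) : Ch R := leftDualComplex (dualComplex (rightDualFunctor R) W)

/-- The evaluation map to the complex of double duals. -/
def toBidual (W : Ch R) : W ⟶ bidual W where
  f n := ModuleCat.ofHom
    { toFun x := ({ toFun := fun φ : W.X (- -n) →+ AddCircle (1 : ℚ) =>
                      φ ((W.XIsoOfEq (show n = - -n by omega)).hom x)
                    map_zero' := rfl
                    map_add' := fun _ _ => rfl } :
                LeftHom (W.X (- -n)) (AddCircle (1 : ℚ)) →+ AddCircle (1 : ℚ))
      map_add' x y := RightHom.ext R fun (φ : W.X (- -n) →+ AddCircle (1 : ℚ)) =>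
        (congrArg φ (map_add (W.XIsoOfEq (show n = - -n by omega)).hom.hom x y)).trans
          (map_add φ _ _)
      map_smul' r x := RightHom.ext R fun (φ : W.X (- -n) →+ AddCircle (1 : ℚ)) =>
        congrArg φ (map_smul (W.XIsoOfEq (show n = - -n by omega)).hom.hom r x) }
  comm' i j _ := ModuleCat.hom_ext (LinearMap.ext fun x => RightHom.ext R
    fun (φ : W.X (- -j) →+ AddCircle (1 : ℚ)) => by
      have := (W.XIsoOfEq_hom_comp_d (show i = - -i by omega) (- -j)).trans
        (W.d_comp_XIsoOfEq_hom (show j = - -j by omega) i).symm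
      exact congrArg φ congr($this x))

/-- The extension of a map to a character module over the double dual. -/
def bidualExtend {N : ModuleCat.{u} R} {M : ModuleCat.{u} Rᵐᵒᵖ} (f : N ⟶ leftDual R M) :
    M ⟶ (rightDualFunctor R).obj (op N) := ModuleCat.ofHom
  { toFun m := ({ toFun := fun n => f n m
                  map_zero' := congr($(map_zero f.hom) m)
                  map_add' := fun x y => congr($(map_add f.hom x y) m) } :
                N →+ AddCircle (1 : ℚ))
    map_add' m m' := LeftHom.ext fun n => map_add (f.hom n) m m'
    map_smul' r m := LeftHom.ext fun n => congr($(map_smul f.hom r.unop n) m).symm }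

/-- An acyclic K-flat complex is pure acyclic. -/
lemma kFlat.pureAcyclic {W : Ch R} (hW : kFlat R W) (hW' : acyclic R W) : PureAcyclic W := by
  -- The dual of `W` is an acyclic complex of right modules, so K-flatness makes the evaluation map
  -- to the double dual null-homotopic.
  obtain ⟨h⟩ := ((kFlat_iff_orth W).1 hW _
    (acyclic_dualComplex_rightDualFunctor hW')).homotopy (toBidual W) 0
  rintro i j k rfl rfl M f hf
  let f' : W.X (- -(i + 1)) ⟶ leftDual R M :=
    (W.XIsoOfEq (show - -(i + 1) = i + 1 by omega)).hom ≫ f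
  have hf' : W.d (- -i) (- -(i + 1)) ≫ f' = 0 := by
    have : W.d (- -i) (- -(i + 1)) ≫ f' =
        (W.XIsoOfEq (show - -i = i by omega)).hom ≫ W.d i (i + 1) ≫ f := by simp [f']
    rw [this, hf, comp_zero]
  -- The map `g` extends `f` along the evaluation map, and it kills the boundaries of the double
  -- dual because `f` kills those of `W`.
  let g : (bidual W).X (i + 1) ⟶ leftDual R M := leftDualMap R (bidualExtend f')
  have hg : (bidual W).d i (i + 1) ≫ g = 0 := by
    refine ModuleCat.hom_ext (LinearMap.ext fun Φ => RightHom.ext R fun m => ?_)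
    have : ((dualComplex (rightDualFunctor R) W).d (-(i + 1)) (-i)) (bidualExtend f' m) = 0 :=
      LeftHom.ext fun n => congr($hf' n m)
    have h0 (Ψ : LeftHom (W.X (- -i)) (AddCircle (1 : ℚ)) →+ AddCircle (1 : ℚ)) :=
      (congrArg Ψ this).trans (map_zero Ψ)
    exact h0 Φ
  have hfg : (toBidual W).f (i + 1) ≫ g = f := by
    refine ModuleCat.hom_ext (LinearMap.ext fun x => RightHom.ext R fun m => ?_)
    have : (W.XIsoOfEq (show i + 1 = - -(i + 1) by omega)).hom ≫ f' = f := by simp [f']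
    exact congr($this x m)
  -- After composition with `g`, only the term of the homotopy formula that starts with the
  -- differential of `W` survives, so `f` factors through this differential.
  refine ⟨h.hom (i + 1 + 1) (i + 1) ≫ g, ?_⟩
  have hc := h.comm (i + 1)
  rw [dNext_eq h.hom (show (ComplexShape.up ℤ).Rel (i + 1) (i + 1 + 1) from rfl),
    prevD_eq h.hom (show (ComplexShape.up ℤ).Rel i (i + 1) from rfl), HomologicalComplex.zero_f,
    add_zero] at hc
  rw [← hfg, hc, Preadditive.add_comp, Category.assoc, Category.assoc, hg, comp_zero, add_zero]

end Bidual

end KFlatModel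

end
-- Generating sets and the lifting properties they detect.
noncomputable section
namespace KFlatModel

open CochainComplex.HomComplex Opposite

/-! ### Small sets of monomorphisms in Grothendieck categories -/

/-- In a Grothendieck abelian category an object is small relative to monomorphisms, once the
regular cardinal exceeds the number of its subobjects. Coproducts and pushouts of monomorphisms are
monomorphisms, so relative cell complexes are transfinite compositions of these. -/
lemma hasSmallObjectArgument_of_le_monomorphisms {C : Type u} [Category.{v} C] [Abelian C]
    [IsGrothendieckAbelian.{w} C] (I : MorphismProperty C) [MorphismProperty.IsSmall.{w} I]
    (hI : I ≤ MorphismProperty.monomorphisms C) : MorphismProperty.HasSmallObjectArgument.{w} I := by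
  obtain ⟨κ, hκ', hκ⟩ := HasCardinalLT.exists_regular_cardinal_forall.{w}
    (fun i : I.toSet => Subobject i.1.left)
  have : Fact κ.IsRegular := ⟨hκ'⟩
  have : Nonempty κ.ord.ToType := by simpa using hκ'.ne_zero
  have := WellFoundedLT.toOrderBot κ.ord.ToType
  exact ⟨κ, inferInstance, inferInstance,
    { preservesColimit {A B X Y} i hi f hf := by
        let hf' : (MorphismProperty.monomorphisms C).TransfiniteCompositionOfShape
            κ.ord.ToType f :=
          { toTransfiniteCompositionOfShape := hf.toTransfiniteCompositionOfShape
            map_mem j hj := by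
              have := (hf.attachCells j hj).pushouts_coproducts
              simp only [MorphismProperty.ofHoms_homFamily] at this
              refine (?_ : _ ≤ MorphismProperty.monomorphisms C) _ this
              simp only [MorphismProperty.pushouts_le_iff, MorphismProperty.coproducts_le_iff]
              exact hI }
        have (j j' : κ.ord.ToType) (φ : j ⟶ j') : Mono (hf'.F.map φ) := hf'.mem_map φ
        apply IsGrothendieckAbelian.preservesColimit_coyoneda_obj_of_mono (Y := hf'.F) (κ := κ)
        exact hκ ⟨Arrow.mk i, hi⟩ }⟩

/-! ### Free complexes and spheres -/

section Free

variable {C : Type u} [Category.{v} C] [Preadditive C] [HasBinaryBiproducts C]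

/-- The contractible complex with `A ⊞ A` in each degree and `d (x, y) = (0, x)`. -/
abbrev freeC (A : C) : CochainComplex C ℤ where
  X _ := A ⊞ A
  d i j := if i + 1 = j then biprod.fst ≫ biprod.inr else 0
  shape i j h := if_neg h
  d_comp_d' i j k h h' := by
    rw [if_pos (show i + 1 = j from h), if_pos (show j + 1 = k from h')]
    simp

/-- The complex with `A` in each degree and zero differential. -/
abbrev sphereC (A : C) : CochainComplex C ℤ where
  X _ := A
  d _ _ := 0

lemma freeC_d (A : C) {i j : ℤ} (h : i + 1 = j) : (freeC A).d i j = biprod.fst ≫ biprod.inr :=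
  if_pos h

/-- The map between free complexes induced by a morphism. -/
@[simps]
def freeMap {A B : C} (i : A ⟶ B) : freeC A ⟶ freeC B where
  f _ := biprod.map i i
  comm' j k h := by rw [freeC_d A h, freeC_d B h]; simp

lemma freeMap_comp {A B D : C} (i : A ⟶ B) (j : B ⟶ D) :
    freeMap i ≫ freeMap j = freeMap (i ≫ j) := by
  ext n : 1
  simp only [HomologicalComplex.comp_f, freeMap_f]
  ext <;> simp

lemma freeMap_zero (A B : C) : freeMap (0 : A ⟶ B) = 0 := by
  ext n : 1
  simp only [freeMap_f, HomologicalComplex.zero_f]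
  ext <;> simp

/-- The map from a free complex given by arbitrary morphisms. -/
@[simps]
def freeDesc {A : C} {X : CochainComplex C ℤ} (f : ∀ n, A ⟶ X.X n) : freeC A ⟶ X where
  f n := biprod.desc (f n) (f (n - 1) ≫ X.d (n - 1) n)
  comm' i j h := by
    obtain rfl : i = j - 1 := by change i + 1 = j at h; omega
    rw [freeC_d A (by omega)]
    refine biprod.hom_ext' _ _ ?_ ?_ <;> simp

/-- The map to a free complex given by arbitrary morphisms. -/
@[simps]
def freeLift {A : C} {X : CochainComplex C ℤ} (f : ∀ n, X.X n ⟶ A) : X ⟶ freeC A where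
  f n := biprod.lift (X.d n (n + 1) ≫ f (n + 1)) (f n)
  comm' i j h := by
    obtain rfl : i + 1 = j := h
    rw [freeC_d A rfl]
    refine biprod.hom_ext _ _ ?_ ?_ <;> simp

/-- With `freeDesc` this says that maps from `freeC A` are arbitrary families of maps `A ⟶ X.X n`.
Dually, `freeLift` builds maps to `freeC A` from families `X.X n ⟶ A`. -/
lemma free_hom_ext {A : C} {X : CochainComplex C ℤ} {φ ψ : freeC A ⟶ X}
    (h : ∀ n, (biprod.inl : A ⟶ A ⊞ A) ≫ φ.f n = biprod.inl ≫ ψ.f n) : φ = ψ := by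
  ext n : 1
  refine biprod.hom_ext' _ _ (h n) ?_
  have h1 : (biprod.inr : A ⟶ A ⊞ A) = biprod.inl ≫ (freeC A).d (n - 1) n := by
    rw [freeC_d A (by omega)]
    simp
  rw [h1]
  have h2 := congr($(h (n - 1)) ≫ X.d (n - 1) n)
  rw [Category.assoc, Category.assoc, φ.comm, ψ.comm] at h2
  rw [Category.assoc, Category.assoc]
  exact h2

/-- Free complexes are contractible. -/
def freeHomotopy (A : C) : Homotopy (𝟙 (freeC A)) 0 where
  hom i j := if j + 1 = i then biprod.snd ≫ biprod.inl else 0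
  zero i j h := if_neg h
  comm n := by
    rw [dNext_eq _ (show (ComplexShape.up ℤ).Rel n (n + 1) from rfl),
      prevD_eq _ (show (ComplexShape.up ℤ).Rel (n - 1) n from by simp), freeC_d A rfl,
      freeC_d A (by omega), if_pos rfl, if_pos (by omega)]
    simp only [HomologicalComplex.id_f, HomologicalComplex.zero_f]
    ext <;> simp

/-- The inclusion of the boundaries in a free complex. -/
@[simps]
def sphereIncl (A : C) : sphereC A ⟶ freeC A where
  f _ := biprod.inr
  comm' i j h := by rw [freeC_d A h]; simp

/-- The projection from a free complex to its quotient by the boundaries. -/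
@[simps]
def sphereProj (A : C) : freeC A ⟶ sphereC A where
  f _ := biprod.fst
  comm' i j h := by rw [freeC_d A h]; simp

lemma sphereIncl_proj (A : C) : sphereIncl A ≫ sphereProj A = 0 := by ext; simp

/-- The map from a sphere given by cycles. -/
@[simps]
def sphereDesc {A : C} {X : CochainComplex C ℤ} (f : ∀ n, A ⟶ X.X n)
    (hf : ∀ n, f n ≫ X.d n (n + 1) = 0) : sphereC A ⟶ X where
  f := f
  comm' i j h := by
    obtain rfl : i + 1 = j := h
    simp [hf]

end Free

/-! ### Generating cofibrations -/

section Generators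

variable (R : Type u) [Ring R]

/-- Generators of the trivial cofibrations. -/
def genTrivCof : MorphismProperty (Ch R) :=
  MorphismProperty.ofHoms (fun c : SmallCode R =>
      freeMap (ModuleCat.ofHom (FpKernel (R := R) c.Mod).subtype)) ⊔
    MorphismProperty.ofHoms (fun c : FpCode R =>
      freeMap (0 : ModuleCat.of R PUnit.{u + 1} ⟶ ModuleCat.of R c.Mod))

/-- Generators of the cofibrations. -/
def genCof : MorphismProperty (Ch R) :=
  genTrivCof R ⊔ MorphismProperty.ofHoms (fun _ : PUnit.{u + 1} => sphereIncl (ModuleCat.of R R))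

lemma isSmall_sup {C : Type u} [Category.{v} C] (I J : MorphismProperty C)
    [MorphismProperty.IsSmall.{w} I] [MorphismProperty.IsSmall.{w} J] :
    MorphismProperty.IsSmall.{w} (I ⊔ J) := by
  rw [sup_eq_iSup]
  have (b : Bool) : MorphismProperty.IsSmall.{w} (cond b I J) := by cases b <;> assumption
  infer_instance

instance : MorphismProperty.IsSmall.{u} (genTrivCof R) := isSmall_sup _ _

instance : MorphismProperty.IsSmall.{u} (genCof R) := isSmall_sup _ _

variable {R}

lemma isZero_punit : IsZero (ModuleCat.of R PUnit.{u + 1}) := ModuleCat.isZero_of_subsingleton _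

lemma pureMono_biprod_map {A B : ModuleCat.{u} R} {i : A ⟶ B} (hi : PureMono i) :
    PureMono (biprod.map i i) := by
  intro M g
  obtain ⟨h₁, hh₁⟩ := hi M (biprod.inl ≫ g)
  obtain ⟨h₂, hh₂⟩ := hi M (biprod.inr ≫ g)
  exact ⟨biprod.desc h₁ h₂, by refine biprod.hom_ext' _ _ ?_ ?_ <;> simp [hh₁, hh₂]⟩

lemma exists_dwPureExact_freeMap {A B : ModuleCat.{u} R} {i : A ⟶ B} (hi : PureMono i) :
    ∃ (Q : ModuleCat.{u} R) (π : B ⟶ Q) (w : freeMap i ≫ freeMap π = 0),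
      dwPureExact R (ShortComplex.mk (freeMap i) (freeMap π) w) := by
  have := hi.mono
  have w : i ≫ cokernel.π i = 0 := cokernel.condition i
  refine ⟨_, cokernel.π i, by rw [freeMap_comp, w, freeMap_zero],
    dwPureExact_iff.2 ⟨?_, fun n => pureMono_biprod_map hi⟩⟩
  rw [HomologicalComplex.shortExact_iff_degreewise_shortExact]
  intro n
  have hm : Mono (biprod.map i i) := (pureMono_biprod_map hi).mono
  have hw : biprod.map i i ≫ biprod.map (cokernel.π i) (cokernel.π i) = 0 := by
    refine biprod.hom_ext' _ _ ?_ ?_ <;> simp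
  have hc : IsColimit (CokernelCofork.ofπ _ hw) := by
    refine CokernelCofork.IsColimit.ofπ' _ hw fun {T} k hk => ⟨biprod.desc
      (cokernel.desc i (biprod.inl ≫ k) ?_) (cokernel.desc i (biprod.inr ≫ k) ?_), ?_⟩
    · simpa using congr(biprod.inl ≫ $hk)
    · simpa using congr(biprod.inr ≫ $hk)
    · refine biprod.hom_ext' _ _ ?_ ?_ <;> simp
  exact
    { exact := ShortComplex.exact_of_g_is_cokernel (ShortComplex.mk _ _ hw) hc
      mono_f := hm
      epi_g := inferInstanceAs (Epi (biprod.map (cokernel.π i) (cokernel.π i))) }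

lemma dwPureExact_sphere (A : ModuleCat.{u} R) :
    dwPureExact R (ShortComplex.mk (sphereIncl A) (sphereProj A) (sphereIncl_proj A)) := by
  refine dwPureExact_iff.2 ⟨?_, fun n => pureMono_of_retraction (r := biprod.snd) (by simp)⟩
  rw [HomologicalComplex.shortExact_iff_degreewise_shortExact]
  intro n
  have σ : (ShortComplex.mk (biprod.inr : A ⟶ A ⊞ A) biprod.fst (by simp)).Splitting :=
    { r := biprod.snd
      s := biprod.inl
      id := (add_comm _ _).trans biprod.total }
  exact σ.shortExact

/-- The source is free in each degree and has zero differential, so a cocycle is a family of cycles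
of `K`, each of which is a boundary. -/
lemma orth_sphere {K : Ch R} (hK : acyclic R K) : Orth (sphereC (ModuleCat.of R R)) K := by
  intro m n hmn z hz
  have hex (q r : ℤ) (hqr : q + 1 = r) (x : K.X r) (hx : K.d r (r + 1) x = 0) :
      ∃ y, K.d q r y = x := by
    have := hK r
    rw [HomologicalComplex.exactAt_iff' K q r (r + 1) (by simp; omega) (by simp),
      ShortComplex.moduleCat_exact_iff] at this
    exact this x hx
  have key (p q : ℤ) (h : p + m = q) : ∃ g : ModuleCat.of R R ⟶ K.X q,
      g ≫ K.d q (q + 1) = z.v p (q + 1) (by omega) := by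
    have h1 : z.v p (q + 1) (by omega) ≫ K.d (q + 1) (q + 1 + 1) = 0 := by
      have := Cochain.congr_v (hz (n + 1)) p (q + 1 + 1) (by omega)
      rw [δ_v n (n + 1) rfl z p (q + 1 + 1) (by omega) (q + 1) (p + 1) (by omega) rfl] at this
      simpa using this
    obtain ⟨y, hy⟩ := hex q (q + 1) rfl (z.v p (q + 1) (by omega) (1 : R)) congr($h1 (1 : R))
    refine ⟨ModuleCat.ofHom (LinearMap.toSpanSingleton R _ y), ModuleCat.hom_ext ?_⟩
    refine LinearMap.ext_ring ?_
    refine Eq.trans ?_ hy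
    exact congrArg (K.d q (q + 1)) (one_smul R y)
  choose g hg using key
  refine ⟨Cochain.mk g, ?_⟩
  ext p q h : 1
  obtain rfl : q = p + m + 1 := by omega
  rw [δ_v m n hmn _ p _ h (p + m) (p + 1) (by omega) rfl, Cochain.mk_v, hg]
  simp

/-- A lifting problem in the single degree `n` is extended by zero to all degrees; this is why
generators that involve all degrees at once suffice. -/
lemma exists_lift_of_freeMap {X Y : Ch R} {p : X ⟶ Y} {A B : ModuleCat.{u} R} {i : A ⟶ B}
    [HasLiftingProperty (freeMap i) p] {n : ℤ} (f : A ⟶ X.X n) (g : B ⟶ Y.X n)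
    (h : f ≫ p.f n = i ≫ g) : ∃ l : B ⟶ X.X n, i ≫ l = f ∧ l ≫ p.f n = g := by
  have sq : CommSq (freeDesc (Pi.single n f)) (freeMap i) p (freeDesc (Pi.single n g)) := by
    refine ⟨free_hom_ext fun m => ?_⟩
    by_cases hm : m = n
    · subst hm
      simpa using h
    · simp [hm]
  obtain ⟨⟨L, h₁, h₂⟩⟩ := (HasLiftingProperty.sq_hasLift sq).exists_lift
  refine ⟨biprod.inl ≫ L.f n, ?_, ?_⟩
  · simpa using congr((biprod.inl : A ⟶ A ⊞ A) ≫ ($h₁).f n)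
  · simpa using congr((biprod.inl : B ⟶ B ⊞ B) ≫ ($h₂).f n)

lemma fpLifts_of_rlp {X Y : Ch R} {p : X ⟶ Y} (hp : (genTrivCof R).rlp p) (n : ℤ) :
    FpLifts (p.f n).hom := by
  intro c f
  have := hp _ (Or.inr ⟨c⟩)
  obtain ⟨l, -, hl⟩ := exists_lift_of_freeMap (p := p)
    (i := (0 : ModuleCat.of R PUnit.{u + 1} ⟶ ModuleCat.of R c.Mod)) (n := n)
    0 (ModuleCat.ofHom f) (by simp)
  exact ⟨l.hom, congr(($hl).hom)⟩

lemma FpLifts.surjective {A B : Type u} [AddCommGroup A] [Module R A] [AddCommGroup B] [Module R B]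
    {g : A →ₗ[R] B} (hg : FpLifts g) : Function.Surjective g := fun b => by
  obtain ⟨h, hh⟩ := hg.exists_fpCover_lift
  obtain ⟨x, rfl⟩ := fpCoverMap_surjective (R := R) B b
  exact ⟨h x, congr($hh x)⟩

/-- Maps with the right lifting property with respect to the generators have a pure-injective
kernel. -/
lemma exists_kernel_of_rlp {X Y : Ch R} {p : X ⟶ Y} (hp : (genTrivCof R).rlp p) :
    dwPureExact R (ShortComplex.mk (kernel.ι p) p (kernel.condition p)) ∧
      dwPureInjective R (kernel p) := by
  have hepi : Epi p := by
    have (n : ℤ) : Epi (p.f n) := (ModuleCat.epi_iff_surjective _).2 (fpLifts_of_rlp hp n).surjective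
    exact HomologicalComplex.epi_of_epi_f _ inferInstance
  have hS : (ShortComplex.mk (kernel.ι p) p (kernel.condition p)).ShortExact :=
    { exact := ShortComplex.exact_of_f_is_kernel _ (kernelIsKernel p) }
  have hinj (n : ℤ) : Function.Injective ((kernel.ι p).f n).hom :=
    (ModuleCat.mono_iff_injective _).1 (hS.map_of_exact (HomologicalComplex.eval _ _ n)).mono_f
  have hex (n : ℤ) : Function.Exact ((kernel.ι p).f n).hom (p.f n).hom :=
    (ShortComplex.ShortExact.moduleCat_exact_iff_function_exact _).1
      (hS.map_of_exact (HomologicalComplex.eval _ _ n)).exact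
  -- The generators with zero source lift finitely presented modules, which makes the kernel pure.
  -- The kernels of the covers of small modules test that it is pure-injective.
  refine ⟨dwPureExact_iff.2 ⟨hS, fun n => ?_⟩, fun n => ?_⟩
  · exact pureMono_of_fpLifts _ _ (fpLifts_of_rlp hp n) (hinj n) (hex n)
  · refine pureInjective_of_extendsAlongSmall _ fun c t => ?_
    have := hp _ (Or.inl ⟨c⟩)
    obtain ⟨l, hl, hl'⟩ := exists_lift_of_freeMap (p := p)
      (i := ModuleCat.ofHom (FpKernel (R := R) c.Mod).subtype) (n := n)
      (ModuleCat.ofHom t ≫ (kernel.ι p).f n) 0 (by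
        rw [comp_zero, Category.assoc, ← HomologicalComplex.comp_f, kernel.condition,
          HomologicalComplex.zero_f, comp_zero])
    obtain ⟨s, hs⟩ := exists_comp_eq_of_injective _ (hinj n) l.hom fun x =>
      (hex n _).1 congr($hl' x)
    refine ⟨s, LinearMap.ext fun x => hinj n ?_⟩
    exact (congr($hs (x : FpCover R c.Mod))).trans congr($hl x)

lemma rlp_genTrivCof_iff {X Y : Ch R} (p : X ⟶ Y) :
    (genTrivCof R).rlp p ↔ AdmissibleEpi (dwPureExact R) (dwPureInjective R) p := by
  refine ⟨fun hp => ⟨_, _, _, exists_kernel_of_rlp hp⟩, ?_⟩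
  rintro ⟨K, k, w, hS, hK⟩ A B i hi
  have key {A B : ModuleCat.{u} R} {i : A ⟶ B} (hi : PureMono i) :
      HasLiftingProperty (freeMap i) p := by
    obtain ⟨Q, π, w, hπ⟩ := exists_dwPureExact_freeMap hi
    exact hasLift_of_orth hπ hS hK (Orth.of_homotopy_left (freeHomotopy Q) _)
  obtain (⟨⟨c⟩⟩ | ⟨⟨c⟩⟩) := hi
  · exact key (pureMono_fpKernel _)
  · exact key (pureMono_of_isZero isZero_punit _)

lemma genTrivCof_le_genCof : genTrivCof R ≤ genCof R := le_sup_left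

/-- A cycle of the kernel is a map from the sphere to `X` in the single degree `n` that is killed by
`p`. A lift against the zero map from the free complex is an element of degree `n - 1` with the
cycle as boundary, and it lies in the kernel as well. -/
lemma acyclic_kernel_of_rlp {X Y : Ch R} {p : X ⟶ Y} (hp : (genCof R).rlp p) :
    acyclic R (kernel p) := by
  have hinj (n : ℤ) : Function.Injective ((kernel.ι p).f n).hom :=
    (ModuleCat.mono_iff_injective _).1 inferInstance
  have hS := (exists_kernel_of_rlp (p := p)
    (MorphismProperty.antitone_rlp genTrivCof_le_genCof _ hp)).1.shortExact
  have hex (n : ℤ) : Function.Exact ((kernel.ι p).f n).hom (p.f n).hom :=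
    (ShortComplex.ShortExact.moduleCat_exact_iff_function_exact _).1
      (hS.map_of_exact (HomologicalComplex.eval _ _ n)).exact
  intro n
  rw [HomologicalComplex.exactAt_iff' _ (n - 1) n (n + 1) (by simp) (by simp),
    ShortComplex.moduleCat_exact_iff]
  intro (x : (kernel p).X n) (hx : (kernel p).d n (n + 1) x = 0)
  let a : ModuleCat.of R R ⟶ X.X n :=
    ModuleCat.ofHom (LinearMap.toSpanSingleton R _ ((kernel.ι p).f n x))
  have ha : a ≫ X.d n (n + 1) = 0 := by
    refine ModuleCat.hom_ext (LinearMap.ext_ring ?_)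
    have h1 : X.d n (n + 1) ((kernel.ι p).f n x) = 0 := by
      refine (congr($((kernel.ι p).comm n (n + 1)) x)).trans ?_
      exact (congrArg ((kernel.ι p).f (n + 1)) hx).trans (map_zero _)
    refine Eq.trans ?_ h1
    exact congrArg (X.d n (n + 1)) (one_smul R _)
  have hap : a ≫ p.f n = 0 := by
    refine ModuleCat.hom_ext (LinearMap.ext_ring ?_)
    refine Eq.trans ?_ ((hex n _).2 ⟨x, rfl⟩)
    exact congrArg (p.f n) (one_smul R _)
  have := hp _ (Or.inr ⟨PUnit.unit⟩)
  have sq : CommSq (sphereDesc (X := X) (Pi.single n a) (fun m => by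
      by_cases hm : m = n
      · subst hm
        simpa using ha
      · simp [hm])) (sphereIncl (ModuleCat.of R R)) p 0 := by
    refine ⟨?_⟩
    ext m : 1
    by_cases hm : m = n
    · subst hm
      simpa using hap
    · simp [hm]
  obtain ⟨⟨L, h₁, h₂⟩⟩ := (HasLiftingProperty.sq_hasLift sq).exists_lift
  let l : ModuleCat.of R R ⟶ X.X (n - 1) := biprod.inl ≫ L.f (n - 1)
  have hl : l ≫ X.d (n - 1) n = a := by
    have h3 := L.comm (n - 1) n
    rw [freeC_d _ (by omega)] at h3
    have h4 : biprod.inr ≫ L.f n = a := by simpa using congr(($h₁).f n)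
    rw [Category.assoc, h3]
    simpa using h4
  have hlp : l ≫ p.f (n - 1) = 0 := by
    have h3 : L.f (n - 1) ≫ p.f (n - 1) = 0 := congr(($h₂).f (n - 1))
    rw [Category.assoc, h3, comp_zero]
  obtain ⟨y, hy⟩ := (hex (n - 1) (l (1 : R))).1 congr($hlp (1 : R))
  refine ⟨y, hinj n ?_⟩
  refine (congr($((kernel.ι p).comm (n - 1) n) y)).symm.trans ?_
  refine (congrArg (X.d (n - 1) n) hy).trans ?_
  exact (congr($hl (1 : R))).trans (one_smul R _)

lemma rlp_genCof_iff {X Y : Ch R} (p : X ⟶ Y) :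
    (genCof R).rlp p ↔ AdmissibleEpi (dwPureExact R) (acyclic R ⊓ dwPureInjective R) p := by
  constructor
  · intro hp
    have h := exists_kernel_of_rlp (p := p)
      (MorphismProperty.antitone_rlp genTrivCof_le_genCof _ hp)
    exact ⟨_, _, _, h.1, acyclic_kernel_of_rlp hp, h.2⟩
  · rintro ⟨K, k, w, hS, hK, hK'⟩ A B i hi
    obtain (hi | ⟨⟨c⟩⟩) := hi
    · exact (rlp_genTrivCof_iff p).2 ⟨K, k, w, hS, hK'⟩ i hi
    · exact hasLift_of_orth (dwPureExact_sphere _) hS hK' (orth_sphere hK)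

lemma genCof_le_monomorphisms : genCof R ≤ MorphismProperty.monomorphisms (Ch R) := by
  rintro A B i ((⟨⟨c⟩⟩ | ⟨⟨c⟩⟩) | ⟨⟨c⟩⟩)
  · obtain ⟨_, _, _, h⟩ := exists_dwPureExact_freeMap (pureMono_fpKernel (R := R) c.Mod)
    exact h.shortExact.mono_f
  · obtain ⟨_, _, _, h⟩ := exists_dwPureExact_freeMap (pureMono_of_isZero isZero_punit
      (0 : _ ⟶ ModuleCat.of R c.Mod))
    exact h.shortExact.mono_f
  · exact (dwPureExact_sphere (ModuleCat.of R R)).shortExact.mono_f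

instance : MorphismProperty.HasSmallObjectArgument.{u} (genCof R) :=
  hasSmallObjectArgument_of_le_monomorphisms _ genCof_le_monomorphisms

instance : MorphismProperty.HasSmallObjectArgument.{u} (genTrivCof R) :=
  hasSmallObjectArgument_of_le_monomorphisms _ (genTrivCof_le_genCof.trans genCof_le_monomorphisms)

end Generators

end KFlatModel

end
noncomputable section
namespace KFlatModel

open CochainComplex.HomComplex Opposite

/-! ### Acyclic complexes -/

section Acyclic

variable {A : Type u} [Category.{v} A] [Abelian A]

lemma isZero_of_retract {C : Type u} [Category.{v} C] [HasZeroMorphisms C] {X Y : C}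
    (r : Retract X Y) (hY : IsZero Y) : IsZero X := by
  rw [IsZero.iff_id_eq_zero, ← r.retract, hY.eq_of_tgt r.i 0, zero_comp]

lemma acyclic_of_retract {X Y : CochainComplex A ℤ} (r : Retract X Y) (hY : Y.Acyclic) :
    X.Acyclic := fun n => by
  have h := hY n
  rw [HomologicalComplex.exactAt_iff_isZero_homology] at h ⊢
  exact isZero_of_retract (r.map (HomologicalComplex.homologyFunctor A _ n)) h

lemma acyclic_shift {X : CochainComplex A ℤ} (hX : X.Acyclic) (n : ℤ) : (X⟦n⟧).Acyclic :=
  fun i => by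
    have h := hX (n + i)
    rw [HomologicalComplex.exactAt_iff_isZero_homology] at h ⊢
    exact h.of_iso ((CochainComplex.ShiftSequence.shiftIso A n i _ rfl).app X)

lemma quasiIso_of_acyclic {X Y : CochainComplex A ℤ} (f : X ⟶ Y) (hX : X.Acyclic)
    (hY : Y.Acyclic) : QuasiIso f :=
  ⟨fun n => by
    rw [quasiIsoAt_iff_exactAt f n (hX n)]
    exact hY n⟩

variable {S : ShortComplex (CochainComplex A ℤ)} (hS : S.ShortExact)

include hS

lemma quasiIso_f_iff_acyclic : QuasiIso S.f ↔ S.X₃.Acyclic := by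
  refine ⟨hS.acyclic_X₃, fun h => ⟨fun n => ?_⟩⟩
  rw [quasiIsoAt_iff_isIso_homologyMap]
  have h3 (i : ℤ) : IsZero (S.X₃.homology i) :=
    (HomologicalComplex.exactAt_iff_isZero_homology _ _).1 (h i)
  have h1 : Mono (HomologicalComplex.homologyMap S.f n) :=
    (hS.homology_exact₁ (n - 1) n (by simp)).mono_g ((h3 _).eq_of_src _ _)
  have h2 : Epi (HomologicalComplex.homologyMap S.f n) :=
    (hS.homology_exact₂ n).epi_f ((h3 _).eq_of_tgt _ _)
  exact isIso_of_mono_of_epi _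

lemma quasiIso_g_iff_acyclic : QuasiIso S.g ↔ S.X₁.Acyclic := by
  refine ⟨hS.acyclic_X₁, fun h => ⟨fun n => ?_⟩⟩
  rw [quasiIsoAt_iff_isIso_homologyMap]
  have h3 (i : ℤ) : IsZero (S.X₁.homology i) :=
    (HomologicalComplex.exactAt_iff_isZero_homology _ _).1 (h i)
  have h1 : Mono (HomologicalComplex.homologyMap S.g n) :=
    (hS.homology_exact₂ n).mono_g ((h3 _).eq_of_src _ _)
  have h2 : Epi (HomologicalComplex.homologyMap S.g n) :=
    (hS.homology_exact₃ n (n + 1) rfl).epi_f ((h3 _).eq_of_tgt _ _)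
  exact isIso_of_mono_of_epi _

end Acyclic

lemma isThick_acyclic (R : Type u) [Ring R] : IsThick (dwPureExact R) (acyclic R) where
  retract r h := acyclic_of_retract r h
  first S hS h₂ h₃ := (quasiIso_g_iff_acyclic hS.shortExact).1 (quasiIso_of_acyclic _ h₂ h₃)
  middle S hS h₁ h₃ := hS.shortExact.acyclic_X₂ h₁ h₃
  last S hS h₁ h₂ := (quasiIso_f_iff_acyclic hS.shortExact).1 (quasiIso_of_acyclic _ h₁ h₂)

/-! ### Extensions and cocycles -/

section Extension

variable {C : Type u} [Category.{v} C] [Preadditive C] [HasBinaryBiproducts C]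
  {Q K : CochainComplex C ℤ} (z : Cochain Q K 1)

/-- The extension of `Q` by `K` that corresponds to a cocycle of degree one. -/
abbrev twistedExt (hz : δ 1 2 z = 0) : CochainComplex C ℤ where
  X n := K.X n ⊞ Q.X n
  d i j := biprod.desc (K.d i j ≫ biprod.inl)
    ((if h : i + 1 = j then z.v i j h ≫ biprod.inl else 0) + Q.d i j ≫ biprod.inr)
  shape i j h := by
    have h' : ¬ i + 1 = j := h
    refine biprod.hom_ext' _ _ ?_ ?_ <;> simp [h']
  d_comp_d' i j k h h' := by
    obtain rfl : i + 1 = j := h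
    obtain rfl : i + 1 + 1 = k := h'
    have hz' := Cochain.congr_v hz i (i + 1 + 1) (by omega)
    rw [δ_v 1 2 rfl z i (i + 1 + 1) (by omega) (i + 1) (i + 1) (by omega) rfl] at hz'
    have hz'' : z.v i (i + 1) rfl ≫ K.d (i + 1) (i + 1 + 1) +
        Q.d i (i + 1) ≫ z.v (i + 1) (i + 1 + 1) rfl = 0 := by
      simpa [Int.negOnePow_even 2 ⟨1, rfl⟩] using hz'
    refine biprod.hom_ext' _ _ ?_ (biprod.hom_ext _ _ ?_ ?_) <;> simp [hz'']

variable (hz : δ 1 2 z = 0)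

/-- The inclusion of the kernel of the extension. -/
abbrev twistedExtInl : K ⟶ twistedExt z hz where
  f _ := biprod.inl

/-- The projection from the extension. -/
abbrev twistedExtSnd : twistedExt z hz ⟶ Q where
  f _ := biprod.snd
  comm' i j h := by
    have h' : i + 1 = j := h
    refine biprod.hom_ext' _ _ ?_ ?_ <;> simp [h']

lemma twistedExt_zero : twistedExtInl z hz ≫ twistedExtSnd z hz = 0 := by
  ext n : 1
  exact biprod.inl_snd

lemma exists_δ_eq_of_section (s : Q ⟶ twistedExt z hz) (hs : s ≫ twistedExtSnd z hz = 𝟙 Q) :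
    ∃ w : Cochain Q K 0, δ 0 1 w = z := by
  have h2 (n : ℤ) : s.f n ≫ biprod.snd = 𝟙 (Q.X n) := congr(($hs).f n)
  -- The section has the form `(σ, 1)`, and its compatibility with the differentials reads `z = -δ
  -- σ`.
  refine ⟨-Cochain.ofHoms fun n => s.f n ≫ biprod.fst, ?_⟩
  ext p q hpq : 1
  subst hpq
  have h3 := congr($(s.comm p (p + 1)) ≫ biprod.fst)
  have h4 : s.f p = (s.f p ≫ biprod.fst) ≫ biprod.inl + biprod.inr := by
    refine biprod.hom_ext _ _ ?_ ?_ <;> simp [h2]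
  rw [h4] at h3
  simp at h3
  rw [δ_neg, Cochain.neg_v, δ_v 0 1 rfl _ p (p + 1) rfl p (p + 1) (by omega) rfl]
  simp only [Cochain.ofHoms_v, Int.negOnePow_one, Category.assoc, Units.neg_smul, one_smul]
  rw [← h3]
  abel

end Extension

section Orthogonality

variable {R : Type u} [Ring R]

lemma dwPureExact_of_splitting {S : ShortComplex (Ch R)}
    (σ : ∀ n, (S.map (HomologicalComplex.eval _ _ n)).Splitting) : dwPureExact R S := by
  refine dwPureExact_iff.2 ⟨?_, fun n => pureMono_of_retraction (σ n).r (σ n).f_r⟩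
  rw [HomologicalComplex.shortExact_iff_degreewise_shortExact]
  exact fun n => (σ n).shortExact

lemma dwPureExact_twistedExt {Q K : Ch R} (z : Cochain Q K 1) (hz : δ 1 2 z = 0) :
    dwPureExact R (ShortComplex.mk _ _ (twistedExt_zero z hz)) :=
  dwPureExact_of_splitting fun n =>
    { r := biprod.fst
      s := biprod.inr
      f_r := biprod.inl_fst
      s_g := biprod.inr_snd
      id := biprod.total }

/-- A cocycle of degree `n` is a cocycle of degree one with values in a shift of `K`. It defines a
degreewise split extension, and a splitting of this extension is a primitive of the cocycle. Hence
the vanishing is needed for all shifts. -/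
lemma orth_of_extVanishes {Q K : Ch R}
    (h : ∀ n : ℤ, ExtVanishes (dwPureExact R) Q (K⟦n⟧)) : Orth Q K := by
  intro m n hmn z hz
  let z' : Cochain Q (K⟦m⟧) 1 := z.rightShift m 1 (by omega)
  have hz' : δ 1 2 z' = 0 := by
    rw [z.δ_rightShift m 1 2 (by omega) (n + 1) (by omega), hz, Cochain.rightShift_zero, smul_zero]
  obtain ⟨σ⟩ := h m _ _ _ (dwPureExact_twistedExt z' hz')
  obtain ⟨w, hw⟩ := exists_δ_eq_of_section z' hz' σ.s σ.s_g
  refine ⟨m.negOnePow • w.rightUnshift m (by omega), ?_⟩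
  rw [δ_units_smul, w.δ_rightUnshift m (by omega) n 1 (by omega), hw, smul_smul,
    Int.units_mul_self, one_smul, Cochain.rightUnshift_rightShift]

lemma pureInjective_biprod {A B : ModuleCat.{u} R} (hA : pureInjective R A)
    (hB : pureInjective R B) : pureInjective R (A ⊞ B) := by
  intro S hS g
  obtain ⟨h₁, hh₁⟩ := hA S hS (g ≫ biprod.fst)
  obtain ⟨h₂, hh₂⟩ := hB S hS (g ≫ biprod.snd)
  exact ⟨biprod.lift h₁ h₂, by refine biprod.hom_ext _ _ ?_ ?_ <;> simp [hh₁, hh₂]⟩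

lemma acyclic_of_homotopy {X : Ch R} (h : Homotopy (𝟙 X) 0) : acyclic R X :=
  (PureAcyclic.of_orth fun Y _ => Orth.of_homotopy_left h Y).acyclic

lemma dwPureInjective.shift {K : Ch R} (hK : dwPureInjective R K) (n : ℤ) :
    dwPureInjective R (K⟦n⟧) := fun m => hK (m + n)

/-- A map with the left lifting property with respect to the admissible epimorphisms with kernel in
a class `F` is an admissible monomorphism, and its cokernel is orthogonal to `F`. -/
lemma exists_cokernel_of_llp {F : ObjectProperty (Ch R)}
    (hfree : ∀ M, F (freeC (leftDual R M))) (hshift : ∀ K, F K → ∀ n : ℤ, F (K⟦n⟧))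
    {A B : Ch R} {i : A ⟶ B}
    (hi : ∀ ⦃X Y : Ch R⦄ (p : X ⟶ Y), AdmissibleEpi (dwPureExact R) F p →
      HasLiftingProperty i p) :
    dwPureExact R (ShortComplex.mk i (cokernel.π i) (cokernel.condition i)) ∧
      ∀ K, F K → Orth (cokernel i) K := by
  have hmono (n : ℤ) : PureMono (i.f n) := by
    intro M g
    have hz : IsZero (⊤_ (Ch R)) := terminalIsTerminal.isZero
    -- Lifting against the map from the free complex on `leftDual R M` to zero extends a map to
    -- `leftDual R M` in a single degree.
    have := hi _ ⟨_, _, _, dwPureExact_of_isZero_right hz (terminal.from _), hfree M⟩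
    have sq : CommSq (freeLift (X := A) (Pi.single n g)) i (terminal.from _)
      (terminal.from _) := ⟨Subsingleton.elim _ _⟩
    obtain ⟨⟨L, h₁, -⟩⟩ := (HasLiftingProperty.sq_hasLift sq).exists_lift
    exact ⟨L.f n ≫ biprod.snd, by simpa using congr(($h₁).f n ≫ biprod.snd)⟩
  have : Mono i := by
    have (n : ℤ) : Mono (i.f n) := (hmono n).mono
    exact HomologicalComplex.mono_of_mono_f _ inferInstance
  have hS : dwPureExact R (ShortComplex.mk i (cokernel.π i) (cokernel.condition i)) :=
    dwPureExact_iff.2 ⟨{ exact := ShortComplex.exact_of_g_is_cokernel _ (cokernelIsCokernel i) },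
      hmono⟩
  refine ⟨hS, fun K hK => orth_of_extVanishes fun n Z f g w hZ => ?_⟩
  -- The projection to the cokernel lifts to `Z` by a map that vanishes on `A`, so the lift descends
  -- to a section of `g`.
  have := hi _ ⟨_, _, _, hZ, hshift K hK n⟩
  have sq : CommSq 0 i g (cokernel.π i) := ⟨by simp⟩
  obtain ⟨⟨L, h₁, h₂⟩⟩ := (HasLiftingProperty.sq_hasLift sq).exists_lift
  have := hZ.shortExact.mono_f
  refine ⟨ShortComplex.Splitting.ofExactOfSection _ hZ.shortExact.exact (cokernel.desc i L h₁) ?_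
    (inferInstanceAs (Mono f))⟩
  rw [← cancel_epi (cokernel.π i)]
  simp [h₂]

lemma dwPureInjective_free (M : ModuleCat.{u} Rᵐᵒᵖ) :
    dwPureInjective R (freeC (leftDual R M)) := fun _ =>
  pureInjective_biprod (pureInjective_leftDual M) (pureInjective_leftDual M)

lemma exists_cokernel_of_llp_genTrivCof {A B : Ch R} {i : A ⟶ B} (hi : (genTrivCof R).rlp.llp i) :
    dwPureExact R (ShortComplex.mk i (cokernel.π i) (cokernel.condition i)) ∧
      ∀ K, dwPureInjective R K → Orth (cokernel i) K :=
  exists_cokernel_of_llp dwPureInjective_free (fun _ hK n => hK.shift n)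
    fun _ _ p hp => hi p ((rlp_genTrivCof_iff p).2 hp)

lemma exists_cokernel_of_llp_genCof {A B : Ch R} {i : A ⟶ B} (hi : (genCof R).rlp.llp i) :
    dwPureExact R (ShortComplex.mk i (cokernel.π i) (cokernel.condition i)) ∧
      ∀ K, acyclic R K → dwPureInjective R K → Orth (cokernel i) K := by
  have := exists_cokernel_of_llp (F := acyclic R ⊓ dwPureInjective R) (i := i)
    (fun M => ⟨acyclic_of_homotopy (freeHomotopy _), dwPureInjective_free M⟩)
    (fun _ hK n => ⟨acyclic_shift hK.1 n, hK.2.shift n⟩)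
    fun _ _ p hp => hi p ((rlp_genCof_iff p).2 hp)
  exact ⟨this.1, fun K h₁ h₂ => this.2 K ⟨h₁, h₂⟩⟩

lemma orth_of_iso {X X' Y : Ch R} (e : X' ≅ X) (h : Orth X Y) : Orth X' Y :=
  h.of_retract ⟨e.hom, e.inv, e.hom_inv_id⟩

lemma orth_of_orth_cokernel {A B Y : Ch R} {i : A ⟶ B} (hA : IsZero A)
    (h : Orth (cokernel i) Y) : Orth B Y := by
  obtain rfl : i = 0 := hA.eq_of_src _ _
  exact orth_of_iso cokernelZeroIsoTarget.symm h

/-- Pure acyclic complexes are orthogonal to complexes of pure-injective modules. -/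
theorem PureAcyclic.orth {X Y : Ch R} (hX : PureAcyclic X) (hY : dwPureInjective R Y) :
    Orth X Y := by
  let h := MorphismProperty.factorizationData (genTrivCof R).rlp.llp (genTrivCof R).rlp
    (initial.to X)
  obtain ⟨-, hC⟩ := exists_cokernel_of_llp_genTrivCof h.hi
  have hC' (K : Ch R) (hK : dwPureInjective R K) : Orth h.Z K :=
    orth_of_orth_cokernel initialIsInitial.isZero (hC K hK)
  obtain ⟨hS, hK⟩ := exists_kernel_of_rlp h.hp
  -- Both `h.Z` and `X` are pure acyclic, hence so is the kernel. As it is also degreewise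
  -- pure-injective, periodicity makes it contractible, and `X` inherits orthogonality from `h.Z`.
  obtain ⟨hc⟩ := (PureAcyclic.first hS (PureAcyclic.of_orth hC') hX).contractible hK
  exact Orth.last hS hY (Orth.of_homotopy_left hc Y) (hC' Y hY)

lemma PureAcyclic.kFlat {X : Ch R} (hX : PureAcyclic X) : kFlat R X :=
  (kFlat_iff_orth X).2 fun E _ => hX.orth (dwPureInjective_leftDualComplex E)

lemma kFlat_acyclic_iff (X : Ch R) : (kFlat R ⊓ acyclic R) X ↔ PureAcyclic X :=
  ⟨fun h => kFlat.pureAcyclic h.1 h.2, fun h => ⟨h.kFlat, h.acyclic⟩⟩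

lemma acyclic_leftDualComplex {E : CochainComplex (ModuleCat.{u} Rᵐᵒᵖ) ℤ} (hE : E.Acyclic) :
    acyclic R (leftDualComplex E) := by
  intro j
  rw [HomologicalComplex.exactAt_iff' _ (j - 1) j (j + 1) (by simp) (by simp),
    ShortComplex.moduleCat_exact_iff]
  intro (φ : RightHom R (E.X (-j)) (AddCircle (1 : ℚ)))
    (hφ : RightHom.map R (E.d (-(j + 1)) (-j)).hom (AddMonoidHom.id _) φ = 0)
  have h1 := hE (-j)
  rw [HomologicalComplex.exactAt_iff' E (-(j + 1)) (-j) (-(j - 1)) (by simp; omega)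
    (by simp; omega), ShortComplex.ShortExact.moduleCat_exact_iff_function_exact] at h1
  obtain ⟨ψ, hψ⟩ := (exact_iff_character (E.d (-(j + 1)) (-j)).hom.toAddMonoidHom
    (E.d (-j) (-(j - 1))).hom.toAddMonoidHom (fun a => congr($(E.d_comp_d _ _ _) a))).1 h1
      (φ : E.X (-j) →+ AddCircle (1 : ℚ)) (AddMonoidHom.ext fun m => DFunLike.congr_fun hφ m)
  let ψ' : RightHom R (E.X (-(j - 1))) (AddCircle (1 : ℚ)) := ψ
  have hψ' : RightHom.map R (E.d (-j) (-(j - 1))).hom (AddMonoidHom.id _) ψ' = φ :=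
    RightHom.ext R fun m => DFunLike.congr_fun hψ m
  exact ⟨ψ', hψ'⟩

lemma kFlat_of_orth {X : Ch R} (h : ∀ K, acyclic R K → dwPureInjective R K → Orth X K) :
    kFlat R X :=
  (kFlat_iff_orth X).2 fun E hE => h _ (acyclic_leftDualComplex hE)
    (dwPureInjective_leftDualComplex E)

/-- K-flat complexes are orthogonal to acyclic complexes of pure-injective modules. -/
lemma kFlat.orth {X Y : Ch R} (hX : kFlat R X) (hY : acyclic R Y) (hY' : dwPureInjective R Y) :
    Orth X Y := by
  obtain ⟨Z, i, p, -, hi, hp⟩ :=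
    MorphismProperty.factorizationData (genCof R).rlp.llp (genCof R).rlp (initial.to X)
  obtain ⟨-, hC⟩ := exists_cokernel_of_llp_genCof hi
  have hC' (K : Ch R) (hK : acyclic R K) (hK' : dwPureInjective R K) : Orth Z K :=
    orth_of_orth_cokernel initialIsInitial.isZero (hC K hK hK')
  have hK := acyclic_kernel_of_rlp hp
  obtain ⟨hS, hK'⟩ := exists_kernel_of_rlp
    (MorphismProperty.antitone_rlp genTrivCof_le_genCof _ hp)
  have hZ : kFlat R Z := kFlat_of_orth hC'
  have hK'' : kFlat R (kernel p) := by
    have h := @kFlat.first R _ _ hS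
    exact h hZ hX
  -- The kernel is K-flat and acyclic, hence pure acyclic, and periodicity applies once more.
  obtain ⟨hc⟩ := PureAcyclic.contractible (kFlat.pureAcyclic hK'' hK) hK'
  exact Orth.last hS hY' (Orth.of_homotopy_left hc Y) (hC' Y hY hY')

end Orthogonality

end KFlatModel

end
-- Part (1): the Hovey triple and its model structure.
noncomputable section
namespace KFlatModel

open CochainComplex.HomComplex Opposite

/-! ### The Hovey triple -/

section Hovey

variable {R : Type u} [Ring R]

lemma llp_genCof_iff {A B : Ch R} (i : A ⟶ B) :
    (genCof R).rlp.llp i ↔ AdmissibleMono (dwPureExact R) (kFlat R) i := by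
  constructor
  · intro hi
    obtain ⟨hS, h⟩ := exists_cokernel_of_llp_genCof hi
    exact ⟨_, _, _, hS, kFlat_of_orth h⟩
  · rintro ⟨Q, π, w, hS, hQ⟩ X Y p hp
    obtain ⟨K, k, w', hS', hK⟩ := (rlp_genCof_iff p).1 hp
    exact hasLift_of_orth hS hS' hK.2 (kFlat.orth hQ hK.1 hK.2)

lemma llp_genTrivCof_iff {A B : Ch R} (i : A ⟶ B) :
    (genTrivCof R).rlp.llp i ↔ AdmissibleMono (dwPureExact R) (kFlat R ⊓ acyclic R) i := by
  constructor
  · intro hi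
    obtain ⟨hS, h⟩ := exists_cokernel_of_llp_genTrivCof hi
    exact ⟨_, _, _, hS, (kFlat_acyclic_iff _).2 (PureAcyclic.of_orth h)⟩
  · rintro ⟨Q, π, w, hS, hQ⟩ X Y p hp
    obtain ⟨K, k, w', hS', hK⟩ := (rlp_genTrivCof_iff p).1 hp
    exact hasLift_of_orth hS hS' hK (((kFlat_acyclic_iff _).1 hQ).orth hK)

lemma pureInjective_of_retract {A B : ModuleCat.{u} R} (r : Retract A B) (hB : pureInjective R B) :
    pureInjective R A := fun S hS g => by
  obtain ⟨h, hh⟩ := hB S hS (g ≫ r.i)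
  exact ⟨h ≫ r.r, by rw [← Category.assoc, hh, Category.assoc, r.retract, Category.comp_id]⟩

lemma dwPureInjective_of_retract {A B : Ch R} (r : Retract A B) (hB : dwPureInjective R B) :
    dwPureInjective R A := fun n =>
  pureInjective_of_retract (r.map (HomologicalComplex.eval _ _ n)) (hB n)

lemma property_of_admissibleMono {P : ObjectProperty (Ch R)}
    (hP : ∀ {X Y : Ch R}, Retract X Y → P Y → P X) {Z X : Ch R} (hZ : IsZero Z) {f : Z ⟶ X}
    (hf : AdmissibleMono (dwPureExact R) P f) : P X := by
  obtain ⟨Q, g, w, hS, hQ⟩ := hf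
  have h1 : Mono g := (hS.shortExact.exact.mono_g_iff).2 (hZ.eq_of_src _ _)
  have h2 : Epi g := hS.shortExact.epi_g
  have : IsIso g := isIso_of_mono_of_epi g
  exact hP ⟨g, inv g, by simp⟩ hQ

lemma property_of_admissibleEpi {P : ObjectProperty (Ch R)}
    (hP : ∀ {X Y : Ch R}, Retract X Y → P Y → P X) {Z X : Ch R} (hZ : IsZero Z) {f : X ⟶ Z}
    (hf : AdmissibleEpi (dwPureExact R) P f) : P X := by
  obtain ⟨K, k, w, hS, hK⟩ := hf
  have h1 : Epi k := (hS.shortExact.exact.epi_f_iff).2 (hZ.eq_of_tgt _ _)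
  have h2 : Mono k := hS.shortExact.mono_f
  have : IsIso k := isIso_of_mono_of_epi k
  exact hP ⟨inv k, k, by simp⟩ hK

/-- A weak factorization system given by admissible monomorphisms and epimorphisms gives a complete
cotorsion pair. -/
lemma isCompleteCotorsionPair_of_factorization {A B : ObjectProperty (Ch R)}
    (hA : ∀ {X Y : Ch R}, Retract X Y → A Y → A X) (hB : ∀ {X Y : Ch R}, Retract X Y → B Y → B X)
    (hext : ∀ {X Y : Ch R}, A X → B Y → ExtVanishes (dwPureExact R) X Y)
    (hfac : ∀ {X Y : Ch R} (f : X ⟶ Y), ∃ (Z : Ch R) (i : X ⟶ Z) (p : Z ⟶ Y),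
      AdmissibleMono (dwPureExact R) A i ∧ AdmissibleEpi (dwPureExact R) B p) :
    IsCompleteCotorsionPair (dwPureExact R) A B := by
  have hproj (X : Ch R) : ∃ (b a : Ch R) (f : b ⟶ a) (g : a ⟶ X) (h : f ≫ g = 0),
      dwPureExact R (ShortComplex.mk f g h) ∧ A a ∧ B b := by
    obtain ⟨Z, i, p, hi, ⟨K, k, w, hS, hK⟩⟩ := hfac (initial.to X)
    exact ⟨K, Z, k, p, w, hS, property_of_admissibleMono hA initialIsInitial.isZero hi, hK⟩
  have hinj (X : Ch R) : ∃ (b a : Ch R) (f : X ⟶ b) (g : b ⟶ a) (h : f ≫ g = 0),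
      dwPureExact R (ShortComplex.mk f g h) ∧ A a ∧ B b := by
    obtain ⟨Z, i, p, ⟨Q, q, w, hS, hQ⟩, hp⟩ := hfac (terminal.from X)
    exact ⟨Z, Q, i, q, w, hS, hQ, property_of_admissibleEpi hB terminalIsTerminal.isZero hp⟩
  refine ⟨fun X => ⟨fun hX Y hY => hext hX hY, fun h => ?_⟩,
    fun Y => ⟨fun hY X hX => hext hX hY, fun h => ?_⟩, hproj, hinj⟩
  -- By orthogonality the approximation of `X` splits, so `X` is a retract of an object of `A`;
  -- dually for `B`.
  · obtain ⟨b, a, f, g, w, hS, ha, hb⟩ := hproj X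
    obtain ⟨σ⟩ := h b hb f g w hS
    exact hA ⟨σ.s, g, σ.s_g⟩ ha
  · obtain ⟨b, a, f, g, w, hS, ha, hb⟩ := hinj Y
    obtain ⟨σ⟩ := h a ha f g w hS
    exact hB ⟨f, σ.r, σ.f_r⟩ hb

variable (R)

theorem isHoveyTriple : IsHoveyTriple (dwPureExact R) (kFlat R) (acyclic R) (dwPureInjective R) where
  thick := isThick_acyclic R
  cotorsion := by
    refine isCompleteCotorsionPair_of_factorization (fun r h => kFlat.of_retract r h)
      (fun r h => ⟨acyclic_of_retract r h.1, dwPureInjective_of_retract r h.2⟩)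
      (fun hX hY => extVanishes_of_orth hY.2 (kFlat.orth hX hY.1 hY.2)) fun f => ?_
    obtain ⟨Z, i, p, -, hi, hp⟩ :=
      MorphismProperty.factorizationData (genCof R).rlp.llp (genCof R).rlp f
    exact ⟨Z, i, p, (llp_genCof_iff i).1 hi, (rlp_genCof_iff p).1 hp⟩
  cotorsion' := by
    refine isCompleteCotorsionPair_of_factorization
      (fun r h => ⟨kFlat.of_retract r h.1, acyclic_of_retract r h.2⟩)
      (fun r h => dwPureInjective_of_retract r h)
      (fun hX hY => extVanishes_of_orth hY (((kFlat_acyclic_iff _).1 hX).orth hY)) fun f => ?_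
    obtain ⟨Z, i, p, -, hi, hp⟩ :=
      MorphismProperty.factorizationData (genTrivCof R).rlp.llp (genTrivCof R).rlp f
    exact ⟨Z, i, p, (llp_genTrivCof_iff i).1 hi, (rlp_genTrivCof_iff p).1 hp⟩

end Hovey

/-! ### The model structure -/

section ModelStructure

variable {R : Type u} [Ring R]

lemma admissibleMono_inf_acyclic_iff {P : ObjectProperty (Ch R)} {A B : Ch R} (i : A ⟶ B) :
    AdmissibleMono (dwPureExact R) (P ⊓ acyclic R) i ↔
      AdmissibleMono (dwPureExact R) P i ∧ QuasiIso i := by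
  constructor
  · rintro ⟨Q, π, w, hS, hQ⟩
    exact ⟨⟨Q, π, w, hS, hQ.1⟩, (quasiIso_f_iff_acyclic hS.shortExact).2 hQ.2⟩
  · rintro ⟨⟨Q, π, w, hS, hQ⟩, h⟩
    exact ⟨Q, π, w, hS, hQ, (quasiIso_f_iff_acyclic hS.shortExact).1 h⟩

lemma admissibleEpi_acyclic_inf_iff {P : ObjectProperty (Ch R)} {A B : Ch R} (p : A ⟶ B) :
    AdmissibleEpi (dwPureExact R) (acyclic R ⊓ P) p ↔
      AdmissibleEpi (dwPureExact R) P p ∧ QuasiIso p := by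
  constructor
  · rintro ⟨Q, π, w, hS, hQ⟩
    exact ⟨⟨Q, π, w, hS, hQ.2⟩, (quasiIso_g_iff_acyclic hS.shortExact).2 hQ.1⟩
  · rintro ⟨⟨Q, π, w, hS, hQ⟩, h⟩
    exact ⟨Q, π, w, hS, (quasiIso_g_iff_acyclic hS.shortExact).1 h, hQ⟩

variable (R)

/-- The K-flat model structure. -/
@[reducible]
def kFlatModelCategory : ModelCategory (Ch R) :=
  let : CategoryWithWeakEquivalences (Ch R) := ⟨HomologicalComplex.quasiIso _ _⟩
  let : CategoryWithCofibrations (Ch R) :=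
    ⟨fun _ _ f => AdmissibleMono (dwPureExact R) (kFlat R) f⟩
  let : CategoryWithFibrations (Ch R) :=
    ⟨fun _ _ f => AdmissibleEpi (dwPureExact R) (dwPureInjective R) f⟩
  have hc : cofibrations (Ch R) = (genCof R).rlp.llp := by
    ext A B f
    exact (llp_genCof_iff f).symm
  have hf : fibrations (Ch R) = (genTrivCof R).rlp := by
    ext A B f
    exact (rlp_genTrivCof_iff f).symm
  have htc : trivialCofibrations (Ch R) = (genTrivCof R).rlp.llp := by
    ext A B f
    exact ((llp_genTrivCof_iff f).trans (admissibleMono_inf_acyclic_iff f)).symm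
  have htf : trivialFibrations (Ch R) = (genCof R).rlp := by
    ext A B f
    exact ((rlp_genCof_iff f).trans (admissibleEpi_acyclic_inf_iff f)).symm
  have : (weakEquivalences (Ch R)).HasTwoOutOfThreeProperty :=
    inferInstanceAs (HomologicalComplex.quasiIso (ModuleCat.{u} R)
      (ComplexShape.up ℤ)).HasTwoOutOfThreeProperty
  have : MorphismProperty.IsWeakFactorizationSystem (cofibrations (Ch R))
      (trivialFibrations (Ch R)) := by
    rw [hc, htf]
    exact ⟨MorphismProperty.rlp_llp_rlp _, rfl, inferInstance⟩
  have : MorphismProperty.IsWeakFactorizationSystem (trivialCofibrations (Ch R))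
      (fibrations (Ch R)) := by
    rw [htc, hf]
    exact ⟨MorphismProperty.rlp_llp_rlp _, rfl, inferInstance⟩
  ModelCategory.mk' _

lemma quasiIso_initial_iff {Z X : Ch R} (hZ : IsZero Z) (f : Z ⟶ X) : QuasiIso f ↔ acyclic R X :=
  quasiIso_f_iff_acyclic (dwPureExact_of_isZero_left hZ f).shortExact

theorem isAbelianModelStructure_kFlatModelCategory :
    let := kFlatModelCategory R
    IsAbelianModelStructure (dwPureExact R) (kFlat R) (acyclic R) (dwPureInjective R) := by
  let := kFlatModelCategory R
  have hcof {A B : Ch R} (i : A ⟶ B) :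
      cofibrations (Ch R) i ↔ AdmissibleMono (dwPureExact R) (kFlat R) i := Iff.rfl
  have hfib {A B : Ch R} (i : A ⟶ B) :
      fibrations (Ch R) i ↔ AdmissibleEpi (dwPureExact R) (dwPureInjective R) i := Iff.rfl
  exact
    { cofibrant_iff X := by
        rw [isCofibrant_iff, cofibration_iff, hcof]
        exact ⟨property_of_admissibleMono (fun r h => kFlat.of_retract r h)
          initialIsInitial.isZero, fun h => ⟨_, _, _,
          dwPureExact_of_isZero_left initialIsInitial.isZero _, h⟩⟩
      trivial_iff X := by
        rw [weakEquivalence_iff]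
        exact quasiIso_initial_iff R initialIsInitial.isZero _
      fibrant_iff X := by
        rw [isFibrant_iff, fibration_iff, hfib]
        exact ⟨property_of_admissibleEpi (fun r h => dwPureInjective_of_retract r h)
          terminalIsTerminal.isZero, fun h => ⟨_, _, _,
          dwPureExact_of_isZero_right terminalIsTerminal.isZero _, h⟩⟩
      cofibrations_iff f := hcof f
      trivialCofibrations_iff f := (admissibleMono_inf_acyclic_iff f).symm
      fibrations_iff f := hfib f
      trivialFibrations_iff f := (admissibleEpi_acyclic_inf_iff f).symm }

theorem isCofibrantlyGenerated_kFlatModelCategory :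
    let := kFlatModelCategory R
    IsCofibrantlyGenerated (Ch R) := by
  let := kFlatModelCategory R
  refine ⟨genCof R, genTrivCof R, inferInstance, inferInstance, ?_, ?_⟩
  · ext A B f
    exact (rlp_genTrivCof_iff f).symm
  · ext A B f
    exact ((rlp_genCof_iff f).trans (admissibleEpi_acyclic_inf_iff f)).symm

variable {R}

/-- The description of an abelian model structure identifies the weak equivalences among
cofibrations and among fibrations. The general case follows by factoring `f` and two-out-of-three
for both classes. -/
lemma IsAbelianModelStructure.weakEquivalence_iff_quasiIso [ModelCategory (Ch R)]
    (h : IsAbelianModelStructure (dwPureExact R) (kFlat R) (acyclic R) (dwPureInjective R))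
    {X Y : Ch R} (f : X ⟶ Y) : WeakEquivalence f ↔ QuasiIso f := by
  have hc {X Y : Ch R} (i : X ⟶ Y) (hi : trivialCofibrations (Ch R) i) : QuasiIso i :=
    ((admissibleMono_inf_acyclic_iff i).1 ((h.trivialCofibrations_iff i).1 hi)).2
  have hf {X Y : Ch R} (i : X ⟶ Y) (hi : trivialFibrations (Ch R) i) : QuasiIso i :=
    ((admissibleEpi_acyclic_inf_iff i).1 ((h.trivialFibrations_iff i).1 hi)).2
  obtain ⟨Z, i, p, fac, hi, hp⟩ := MorphismProperty.factorizationData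
    (trivialCofibrations (Ch R)) (fibrations (Ch R)) f
  have hi' := hc i hi
  have : WeakEquivalence i := (weakEquivalence_iff i).2 hi.2
  constructor
  · intro hw
    have : WeakEquivalence p := weakEquivalence_of_precomp_of_fac fac
    have := hf p ⟨hp, (weakEquivalence_iff p).1 this⟩
    rw [← fac]
    infer_instance
  · intro hw
    have : QuasiIso p := by
      rw [← fac] at hw
      exact quasiIso_of_comp_left i p
    have hp' := (h.trivialFibrations_iff p).2
      ((admissibleEpi_acyclic_inf_iff p).2 ⟨(h.fibrations_iff p).1 hp, this⟩)
    have : WeakEquivalence p := (weakEquivalence_iff p).2 hp'.2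
    rw [← fac]
    infer_instance

end ModelStructure

end KFlatModel

end
-- Part (2): the derived category and its model inside `K(R)`.
noncomputable section
namespace KFlatModel

open CochainComplex.HomComplex Opposite Pretriangulated

/-! ### The derived category as a localization -/

section Localization

variable (A : Type u) [Category.{v} A] [Abelian A]

/-- The triangulated structure on the localization at the quasi-isomorphisms. -/
@[reducible]
def quasiIsoTriangulatedLocalization :
    TriangulatedLocalization (HomologicalComplex.quasiIso A (ComplexShape.up ℤ)) :=
  @TriangulatedLocalization.mk A _ _ (HomologicalComplex.quasiIso A (ComplexShape.up ℤ))
    (@DerivedCategory.instPreadditive A _ _ (HasDerivedCategory.standard A))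
    (@DerivedCategory.instHasZeroObject A _ _ (HasDerivedCategory.standard A))
    (@DerivedCategory.instHasShiftInt A _ _ (HasDerivedCategory.standard A))
    (@DerivedCategory.instAdditiveShiftFunctorInt A _ _ (HasDerivedCategory.standard A))
    (@DerivedCategory.instPretriangulated A _ _ (HasDerivedCategory.standard A))
    (@DerivedCategory.instIsTriangulated A _ _ (HasDerivedCategory.standard A))
    (@DerivedCategory.instAdditiveCochainComplexIntQ A _ _ (HasDerivedCategory.standard A))
    (@DerivedCategory.instCommShiftCochainComplexIntQ A _ _ (HasDerivedCategory.standard A))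
    (@DerivedCategory.mem_distTriang_iff A _ _ (HasDerivedCategory.standard A))

variable {A} {W : MorphismProperty (CochainComplex A ℤ)}

/-- Both categories are localizations at the same class, hence equivalent. The equivalence is
triangulated because distinguished triangles on both sides are those isomorphic to images of mapping
cone triangles. -/
lemma exists_equivalence_derivedCategory [HasDerivedCategory.{w} A]
    [t : TriangulatedLocalization W]
    (hW : W = HomologicalComplex.quasiIso A (ComplexShape.up ℤ)) :
    ∃ (Φ : W.Localization ⥤ DerivedCategory A) (_ : Φ.CommShift ℤ),
      Φ.IsEquivalence ∧ Φ.IsTriangulated ∧ Nonempty (W.Q ⋙ Φ ≅ DerivedCategory.Q) := by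
  have hQ : (DerivedCategory.Q (C := A)).IsLocalization W := by
    rw [hW]
    infer_instance
  let Φ := (Localization.uniq W.Q (DerivedCategory.Q (C := A)) W).functor
  let e : W.Q ⋙ Φ ≅ DerivedCategory.Q := Localization.compUniqFunctor _ _ _
  let : Localization.Lifting W.Q W DerivedCategory.Q Φ := ⟨e⟩
  let : Φ.CommShift ℤ := Functor.commShiftOfLocalization W.Q W ℤ DerivedCategory.Q Φ
  have : NatTrans.CommShift e.hom ℤ :=
    NatTrans.commShift_iso_hom_of_localization W.Q W ℤ DerivedCategory.Q Φ
  refine ⟨Φ, inferInstance, inferInstance, ⟨fun T hT => ?_⟩, ⟨e⟩⟩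
  obtain ⟨X, Y, f, ⟨e'⟩⟩ := (t.mem_distTriang_iff T).1 hT
  exact (DerivedCategory.mem_distTriang_iff _).2 ⟨X, Y, f, ⟨Φ.mapTriangle.mapIso e' ≪≫
    (Functor.mapTriangleCompIso W.Q Φ).symm.app _ ≪≫ (Functor.mapTriangleIso e).app _⟩⟩

end Localization

end KFlatModel

end
noncomputable section
namespace KFlatModel

open CochainComplex.HomComplex Opposite Pretriangulated

/-! ### Shifts and mapping cones of K-flat complexes -/

section Cone

lemma Orth.shift_left {C : Type u} [Category.{v} C] [Preadditive C] {X Y : CochainComplex C ℤ}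
    (h : Orth X Y) (a : ℤ) : Orth (X⟦a⟧) Y := by
  intro m n hmn z hz
  obtain ⟨w, hw⟩ := h (m - a) (n - a) (by omega) (z.leftUnshift (n - a) (by omega)) fun k => by
    rw [z.δ_leftUnshift (n - a) (by omega) k (k + a) rfl, hz, Cochain.leftUnshift_zero, smul_zero]
  refine ⟨a.negOnePow • w.leftShift a m (by omega), ?_⟩
  rw [δ_units_smul, w.δ_leftShift a m n (by omega) (n - a) (by omega), hw, smul_smul,
    Int.units_mul_self, one_smul, Cochain.leftShift_leftUnshift]

variable {R : Type u} [Ring R]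

lemma kFlat.shift {X : Ch R} (hX : kFlat R X) (n : ℤ) : kFlat R (X⟦n⟧) :=
  (kFlat_iff_orth _).2 fun E hE => Orth.shift_left ((kFlat_iff_orth _).1 hX E hE) n

variable {K L : Ch R} (φ : K ⟶ L)

/-- The projection from the mapping cone of `φ : K ⟶ L` to `K⟦1⟧`. -/
def coneProj : CochainComplex.mappingCone φ ⟶ K⟦(1 : ℤ)⟧ :=
  (CochainComplex.mappingCone.triangle φ).mor₃

lemma inr_coneProj : CochainComplex.mappingCone.inr φ ≫ coneProj φ = 0 :=
  CochainComplex.mappingCone.inr_triangleδ φ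

lemma inl_coneProj_f (n : ℤ) :
    (CochainComplex.mappingCone.inl φ).v (n + 1) n (by omega) ≫ (coneProj φ).f n =
      -𝟙 (K.X (n + 1)) :=
  CochainComplex.mappingCone.inl_v_triangle_mor₃_f φ (n + 1) n (by omega)

lemma inr_f_coneProj_f (n : ℤ) :
    (CochainComplex.mappingCone.inr φ).f n ≫ (coneProj φ).f n = 0 :=
  CochainComplex.mappingCone.inr_f_triangle_mor₃_f φ n

lemma coneProj_f (n : ℤ) :
    (coneProj φ).f n = -(CochainComplex.mappingCone.fst φ).1.v n (n + 1) rfl := by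
  refine CochainComplex.mappingCone.ext_from φ (n + 1) n rfl ?_ ?_
  · exact (inl_coneProj_f φ n).trans ((congrArg Neg.neg
      (CochainComplex.mappingCone.inl_v_fst_v φ (n + 1) n (by omega))).symm.trans
        (Preadditive.comp_neg _ _).symm)
  · exact (inr_f_coneProj_f φ n).trans ((neg_zero.symm.trans (congrArg Neg.neg
      (CochainComplex.mappingCone.inr_f_fst_v φ n (n + 1) rfl)).symm).trans
        (Preadditive.comp_neg _ _).symm)

/-- The degreewise splitting of the mapping cone. -/
def coneSplitting (n : ℤ) :
    ((ShortComplex.mk _ _ (inr_coneProj φ)).map (HomologicalComplex.eval _ _ n)).Splitting where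
  r := (CochainComplex.mappingCone.snd φ).v n n (add_zero n)
  s := -(CochainComplex.mappingCone.inl φ).v (n + 1) n (by omega)
  f_r := CochainComplex.mappingCone.inr_f_snd_v φ n
  s_g := (Preadditive.neg_comp _ _).trans
    ((congrArg Neg.neg (inl_coneProj_f φ n)).trans (neg_neg _))
  id := by
    have h : (CochainComplex.mappingCone.snd φ).v n n (add_zero n) ≫
        (CochainComplex.mappingCone.inr φ).f n + (coneProj φ).f n ≫
        (-(CochainComplex.mappingCone.inl φ).v (n + 1) n (by omega)) =
        𝟙 ((CochainComplex.mappingCone φ).X n) := by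
      rw [coneProj_f, ← CochainComplex.mappingCone.id_X φ n (n + 1) rfl, add_comm]
      exact congrArg (· + _) (Preadditive.neg_comp_neg _ _)
    exact h

lemma dwPureExact_mappingCone : dwPureExact R (ShortComplex.mk _ _ (inr_coneProj φ)) :=
  dwPureExact_of_splitting (coneSplitting φ)

variable {φ}

lemma kFlat.mappingCone (hK : kFlat R K) (hL : kFlat R L) :
    kFlat R (CochainComplex.mappingCone φ) :=
  kFlat.middle (S := ShortComplex.mk _ _ (inr_coneProj φ)) (dwPureExact_mappingCone φ) hL
    (hK.shift 1)

lemma dwPureInjective.mappingCone (hK : dwPureInjective R K) (hL : dwPureInjective R L) :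
    dwPureInjective R (CochainComplex.mappingCone φ) := fun n => by
  refine pureInjective_of_retract ?_ (pureInjective_biprod (hK (n + 1)) (hL n))
  refine ⟨biprod.lift ((CochainComplex.mappingCone.fst φ).1.v n (n + 1) rfl)
    ((CochainComplex.mappingCone.snd φ).v n n (add_zero n)),
    biprod.desc ((CochainComplex.mappingCone.inl φ).v (n + 1) n (by omega))
      ((CochainComplex.mappingCone.inr φ).f n), ?_⟩
  rw [biprod.lift_desc, CochainComplex.mappingCone.id_X φ n (n + 1) rfl]

lemma acyclic_mappingCone [QuasiIso φ] : acyclic R (CochainComplex.mappingCone φ) := by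
  have h : HomotopyCategory.quasiIso _ _ ((HomotopyCategory.quotient _ _).map φ) :=
    (HomotopyCategory.quotient_map_mem_quasiIso_iff φ).2 ‹_›
  rw [HomotopyCategory.quasiIso_eq_trW_subcategoryAcyclic] at h
  exact (HomotopyCategory.quotient_obj_mem_subcategoryAcyclic_iff_acyclic _).1
    (((HomotopyCategory.subcategoryAcyclic _).trW_iff_of_distinguished _
      (HomotopyCategory.mappingCone_triangleh_distinguished φ)).1 h)

end Cone

/-! ### Replacements by K-flat complexes with pure-injective components -/

section Replacement

variable {R : Type u} [Ring R]

lemma exists_kFlat_quasiIso (X : Ch R) : ∃ (A : Ch R) (p : A ⟶ X), kFlat R A ∧ QuasiIso p := by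
  obtain ⟨A, i, p, -, hi, hp⟩ :=
    MorphismProperty.factorizationData (genCof R).rlp.llp (genCof R).rlp (initial.to X)
  obtain ⟨-, hC⟩ := exists_cokernel_of_llp_genCof hi
  obtain ⟨_, _, _, hS, hK⟩ := (rlp_genCof_iff p).1 hp
  exact ⟨A, p, kFlat_of_orth fun K hK hK' =>
    orth_of_orth_cokernel initialIsInitial.isZero (hC K hK hK'),
    (quasiIso_g_iff_acyclic hS.shortExact).2 hK.1⟩

/-- The special embedding into a degreewise pure-injective complex has an acyclic K-flat cokernel:
acyclicity gives the quasi-isomorphism, and an extension of K-flat complexes is K-flat. -/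
lemma exists_quasiIso_dwPureInjective {A : Ch R} (hA : kFlat R A) :
    ∃ (B : Ch R) (i : A ⟶ B), kFlat R B ∧ dwPureInjective R B ∧ QuasiIso i := by
  obtain ⟨b, a, f, g, h, hS, ha, hb⟩ := (isHoveyTriple R).cotorsion'.enough_injectives A
  exact ⟨b, f, kFlat.middle (S := ShortComplex.mk f g h) hS hA ha.1, hb, (quasiIso_f_iff_acyclic hS.shortExact).2 ha.2⟩

lemma exists_kFlatPureInjective (X : Ch R) :
    ∃ (A B : Ch R) (p : A ⟶ X) (i : A ⟶ B), (kFlat R ⊓ dwPureInjective R) B ∧ QuasiIso p ∧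
      QuasiIso i := by
  obtain ⟨A, p, hA, hp⟩ := exists_kFlat_quasiIso X
  obtain ⟨B, i, hB, hB', hi⟩ := exists_quasiIso_dwPureInjective hA
  exact ⟨A, B, p, i, ⟨hB, hB'⟩, hp, hi⟩

end Replacement

/-! ### The homotopy category of K-flat complexes with pure-injective components -/

section Homotopy

variable (R : Type u) [Ring R]

instance : (kFlatPureInjective R).IsClosedUnderIsomorphisms :=
  inferInstanceAs (ObjectProperty.map _ _).IsClosedUnderIsomorphisms

/-- A morphism between such objects is represented by a chain map, and the mapping cone of the
latter is again K-flat with pure-injective components. -/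
instance isTriangulated_kFlatPureInjective : (kFlatPureInjective R).IsTriangulated := by
  have : (kFlatPureInjective R).ContainsZero := by
    have h : IsZero (⊥_ (Ch R)) := initialIsInitial.isZero
    refine ⟨⟨_, (HomotopyCategory.quotient _ _).map_isZero h, ⊥_ _, ⟨?_, fun n S _ g => ⟨0, ?_⟩⟩,
      ⟨Iso.refl _⟩⟩⟩
    · exact kFlat_of_homotopy (Homotopy.ofEq (h.eq_of_src _ _))
    · exact ((HomologicalComplex.eval _ _ n).map_isZero h).eq_of_tgt _ _
  have : (kFlatPureInjective R).IsStableUnderShift ℤ := ⟨fun n => ⟨by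
    rintro X ⟨Y, hY, ⟨e⟩⟩
    exact ⟨Y⟦n⟧, ⟨hY.1.shift n, hY.2.shift n⟩,
      ⟨((HomotopyCategory.quotient _ _).commShiftIso n).app Y ≪≫
        (shiftFunctor _ n).mapIso e⟩⟩⟩⟩
  have : (kFlatPureInjective R).IsTriangulatedClosed₃ := by
    refine ObjectProperty.IsTriangulatedClosed₃.mk' fun T hT h₁ h₂ => ?_
    obtain ⟨X, hX, ⟨e₁⟩⟩ := h₁
    obtain ⟨Y, hY, ⟨e₂⟩⟩ := h₂
    obtain ⟨φ, hφ⟩ := (HomotopyCategory.quotient _ _).map_surjective (e₁.hom ≫ T.mor₁ ≫ e₂.inv)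
    refine ⟨CochainComplex.mappingCone φ, ⟨hX.1.mappingCone hY.1, hX.2.mappingCone hY.2⟩,
      ⟨Triangle.π₃.mapIso (isoTriangleOfIso₁₂ _ _
        (HomotopyCategory.mappingCone_triangleh_distinguished φ) hT e₁ e₂ ?_)⟩⟩
    change (HomotopyCategory.quotient _ _).map φ ≫ e₂.hom = e₁.hom ≫ T.mor₁
    rw [hφ, Category.assoc, Category.assoc, e₂.inv_hom_id, Category.comp_id]
  have := ObjectProperty.IsTriangulatedClosed₂.of_isTriangulatedClosed₃ (P := kFlatPureInjective R)
  constructor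

variable {R}

lemma quotient_hom_eq_zero {K L : Ch R} (hK : (kFlat R ⊓ acyclic R) K) (hL : dwPureInjective R L)
    (f : (HomotopyCategory.quotient _ _).obj K ⟶ (HomotopyCategory.quotient _ _).obj L) :
    f = 0 := by
  obtain ⟨f, rfl⟩ := (HomotopyCategory.quotient _ _).map_surjective f
  obtain ⟨h⟩ := Orth.homotopy (((kFlat_acyclic_iff K).1 hK).orth hL) f 0
  rw [HomotopyCategory.eq_of_homotopy _ _ h, Functor.map_zero]

variable {A K L : Ch R} {φ : A ⟶ K}

/-- The cone of `φ` and its shifts are acyclic and K-flat, so they have no nonzero maps to `L` in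
the homotopy category. The long exact sequence of the cone triangle shows that precomposition with
`φ` is injective here, and surjective in the next lemma. -/
lemma quotient_map_precomp_injective [QuasiIso φ] (hA : kFlat R A) (hK : kFlat R K)
    (hL : dwPureInjective R L)
    {f g : (HomotopyCategory.quotient _ _).obj K ⟶ (HomotopyCategory.quotient _ _).obj L}
    (h : (HomotopyCategory.quotient _ _).map φ ≫ f = (HomotopyCategory.quotient _ _).map φ ≫ g) :
    f = g := by
  obtain ⟨v, hv⟩ := Triangle.yoneda_exact₂ _
    (HomotopyCategory.mappingCone_triangleh_distinguished φ) (f - g)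
    ((Preadditive.comp_sub _ _ _).trans (sub_eq_zero.2 h))
  have hv0 : v = 0 := quotient_hom_eq_zero ⟨hA.mappingCone hK, acyclic_mappingCone⟩ hL v
  exact sub_eq_zero.1 (hv.trans ((congrArg (_ ≫ ·) hv0).trans comp_zero))

lemma quotient_map_precomp_surjective [QuasiIso φ] (hA : kFlat R A) (hK : kFlat R K)
    (hL : dwPureInjective R L)
    (f : (HomotopyCategory.quotient _ _).obj A ⟶ (HomotopyCategory.quotient _ _).obj L) :
    ∃ g, (HomotopyCategory.quotient _ _).map φ ≫ g = f := by
  obtain ⟨v, hv⟩ := Triangle.yoneda_exact₂ _ (inv_rot_of_distTriang _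
    (HomotopyCategory.mappingCone_triangleh_distinguished φ)) f (by
      let e := ((HomotopyCategory.quotient _ _).commShiftIso (-1 : ℤ)).app
        (CochainComplex.mappingCone φ)
      refine (cancel_epi e.hom).1 ((quotient_hom_eq_zero ?_ hL _).trans comp_zero.symm)
      exact ⟨(hA.mappingCone hK).shift (-1), acyclic_shift acyclic_mappingCone (-1)⟩)
  exact ⟨v, hv.symm⟩

/-- Fractions can thus be represented with a K-flat apex. -/
lemma exists_kFlat_precomp {Z : HomotopyCategory (ModuleCat.{u} R) (ComplexShape.up ℤ)}
    (s : Z ⟶ (HomotopyCategory.quotient _ _).obj K) (hs : HomotopyCategory.quasiIso _ _ s) :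
    ∃ (A : Ch R) (φ : A ⟶ K) (t : (HomotopyCategory.quotient _ _).obj A ⟶ Z),
      kFlat R A ∧ QuasiIso φ ∧ t ≫ s = (HomotopyCategory.quotient _ _).map φ := by
  obtain ⟨Z, rfl⟩ := HomotopyCategory.quotient_obj_surjective Z
  obtain ⟨s, rfl⟩ := (HomotopyCategory.quotient _ _).map_surjective s
  obtain ⟨A, p, hA, hp⟩ := exists_kFlat_quasiIso Z
  have : QuasiIso s := (HomotopyCategory.quotient_map_mem_quasiIso_iff s).1 hs
  exact ⟨A, p ≫ s, (HomotopyCategory.quotient _ _).map p, hA, inferInstance,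
    ((HomotopyCategory.quotient _ _).map_comp p s).symm⟩

variable [HasDerivedCategory.{w} (ModuleCat.{u} R)]

lemma Qh_map_injective (hK : kFlat R K) (hL : dwPureInjective R L)
    {f g : (HomotopyCategory.quotient _ _).obj K ⟶ (HomotopyCategory.quotient _ _).obj L}
    (h : DerivedCategory.Qh.map f = DerivedCategory.Qh.map g) : f = g := by
  obtain ⟨Z, s, hs, hfg⟩ := (MorphismProperty.map_eq_iff_precomp DerivedCategory.Qh
    (HomotopyCategory.quasiIso (ModuleCat.{u} R) (ComplexShape.up ℤ)) f g).1 h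
  obtain ⟨A, φ, t, hA, hφ, ht⟩ := exists_kFlat_precomp s hs
  refine quotient_map_precomp_injective (φ := φ) hA hK hL ?_
  rw [← ht, Category.assoc, Category.assoc, hfg]

lemma Qh_map_surjective (hK : kFlat R K) (hL : dwPureInjective R L)
    (f : DerivedCategory.Qh.obj ((HomotopyCategory.quotient _ _).obj K) ⟶
      DerivedCategory.Qh.obj ((HomotopyCategory.quotient _ _).obj L)) :
    ∃ g, DerivedCategory.Qh.map g = f := by
  obtain ⟨φ, hφ⟩ := Localization.exists_rightFraction DerivedCategory.Qh
    (HomotopyCategory.quasiIso (ModuleCat.{u} R) (ComplexShape.up ℤ)) f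
  obtain ⟨Z, s, hs, g, rfl⟩ := φ.cases
  obtain ⟨A, φ, t, hA, hφ', ht⟩ := exists_kFlat_precomp s hs
  -- The leg of the refined fraction from `A` to `L` extends along the quasi-isomorphism `φ` to a
  -- genuine morphism on `K`.
  obtain ⟨v, hv⟩ := quotient_map_precomp_surjective (φ := φ) hA hK hL (t ≫ g)
  have hφ'' : HomotopyCategory.quasiIso _ _ ((HomotopyCategory.quotient _ _).map φ) :=
    (HomotopyCategory.quotient_map_mem_quasiIso_iff φ).2 hφ'
  have := Localization.inverts DerivedCategory.Qh
    (HomotopyCategory.quasiIso (ModuleCat.{u} R) (ComplexShape.up ℤ)) _ hφ''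
  refine ⟨v, (cancel_epi (DerivedCategory.Qh.map ((HomotopyCategory.quotient _ _).map φ))).1 ?_⟩
  have h := MorphismProperty.RightFraction.map_s_comp_map
    (MorphismProperty.RightFraction.mk s hs g) DerivedCategory.Qh (Localization.inverts _ _)
  rw [← hφ] at h
  rw [← Functor.map_comp, hv, ← ht, Functor.map_comp, Functor.map_comp, Category.assoc]
  exact congrArg (_ ≫ ·) h.symm

instance : ((kFlatPureInjective R).ι ⋙ DerivedCategory.Qh).Faithful where
  map_injective {X Y f g} h := by
    obtain ⟨K, hK, ⟨e⟩⟩ := X.property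
    obtain ⟨L, hL, ⟨e'⟩⟩ := Y.property
    have h' : e.hom ≫ f.hom ≫ e'.inv = e.hom ≫ g.hom ≫ e'.inv :=
      Qh_map_injective hK.1 hL.2 (by
        simp only [Functor.map_comp]
        exact congrArg (fun t => _ ≫ t ≫ _) h)
    rw [cancel_epi, cancel_mono] at h'
    exact ObjectProperty.hom_ext _ h'

instance : ((kFlatPureInjective R).ι ⋙ DerivedCategory.Qh).Full where
  map_surjective {X Y} f := by
    obtain ⟨K, hK, ⟨e⟩⟩ := X.property
    obtain ⟨L, hL, ⟨e'⟩⟩ := Y.property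
    obtain ⟨g, hg⟩ := Qh_map_surjective hK.1 hL.2
      (DerivedCategory.Qh.map e.hom ≫ f ≫ DerivedCategory.Qh.map e'.inv)
    refine ⟨ObjectProperty.homMk (e.inv ≫ g ≫ e'.hom), ?_⟩
    change DerivedCategory.Qh.map (e.inv ≫ g ≫ e'.hom) = f
    rw [Functor.map_comp, Functor.map_comp, hg, Category.assoc, Category.assoc,
      ← Functor.map_comp DerivedCategory.Qh e'.inv e'.hom, ← Functor.map_comp_assoc,
      e.inv_hom_id, e'.inv_hom_id, CategoryTheory.Functor.map_id, CategoryTheory.Functor.map_id,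
      Category.id_comp]
    exact Category.comp_id _

instance : ((kFlatPureInjective R).ι ⋙ DerivedCategory.Qh).EssSurj where
  mem_essImage Y := by
    obtain ⟨A, B, p, i, hB, hp, hi⟩ := exists_kFlatPureInjective (DerivedCategory.Q.objPreimage Y)
    exact ⟨⟨(HomotopyCategory.quotient _ _).obj B, B, hB, ⟨Iso.refl _⟩⟩,
      ⟨(DerivedCategory.quotientCompQhIso _).app B ≪≫ (asIso (DerivedCategory.Q.map i)).symm ≪≫
        asIso (DerivedCategory.Q.map p) ≪≫ DerivedCategory.Q.objObjPreimageIso Y⟩⟩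

instance : ((kFlatPureInjective R).ι ⋙ DerivedCategory.Qh).IsEquivalence where

/-- A triangulated equivalence to the derived category lifts the functor from the homotopy category
of K-flat complexes with pure-injective components. -/
lemma exists_equivalence_kFlatPureInjective {D : Type*} [Category D] [HasShift D ℤ]
    [Preadditive D] [HasZeroObject D] [∀ n : ℤ, (shiftFunctor D n).Additive] [Pretriangulated D]
    (E : D ≌ DerivedCategory (ModuleCat.{u} R)) [E.functor.CommShift ℤ]
    [E.functor.IsTriangulated] :
    ∃ (Ψ : (kFlatPureInjective R).FullSubcategory ⥤ D) (_ : Ψ.CommShift ℤ),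
      Ψ.IsEquivalence ∧ Ψ.IsTriangulated ∧
      Nonempty (Ψ ⋙ E.functor ≅ (kFlatPureInjective R).ι ⋙ DerivedCategory.Qh) := by
  let : E.inverse.CommShift ℤ := E.commShiftInverse ℤ
  have : E.CommShift ℤ := E.commShift_of_functor ℤ
  have : E.inverse.IsTriangulated := E.toAdjunction.isTriangulated_rightAdjoint
  exact ⟨((kFlatPureInjective R).ι ⋙ DerivedCategory.Qh) ⋙ E.inverse, inferInstance,
    inferInstance, inferInstance, ⟨Functor.associator _ _ _ ≪≫
      Functor.isoWhiskerLeft _ E.counitIso ≪≫ Functor.rightUnitor _⟩⟩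

end Homotopy

end KFlatModel

end
-- Part (3): K-flat complexes and tensor products over a commutative ring.
noncomputable section
namespace KFlatModel

open CochainComplex.HomComplex Opposite

/-! ### K-flat complexes over a commutative ring -/

section Commutative

variable (R : Type u) [CommRing R]

/-- Modules over a commutative ring as right modules. -/
abbrev toRight : ModuleCat.{u} R ⥤ ModuleCat.{u} Rᵐᵒᵖ :=
  ModuleCat.restrictScalars ((RingEquiv.toOpposite R).symm : Rᵐᵒᵖ →+* R)

/-- Right modules over a commutative ring as left modules. -/
abbrev ofRight : ModuleCat.{u} Rᵐᵒᵖ ⥤ ModuleCat.{u} R :=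
  ModuleCat.restrictScalars (RingEquiv.toOpposite R : R →+* Rᵐᵒᵖ)

/-- The character modules over a commutative ring. -/
abbrev charFunctor : (ModuleCat.{u} R)ᵒᵖ ⥤ ModuleCat.{u} R :=
  (toRight R).op ⋙ leftDualFunctor R

variable {R}

/-- Characters of `M ⊗ N` are the homomorphisms from `N` to the character module of `M`. -/
def tensorCharEquiv (M N : ModuleCat.{u} R) :
    ((M ⊗ N : ModuleCat.{u} R) →+ AddCircle (1 : ℚ)) ≃+ (N ⟶ (charFunctor R).obj (op M)) where
  toFun φ := ModuleCat.ofHom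
    { toFun n := (φ.comp (((TensorProduct.mk R M N).flip n).toAddMonoidHom) :)
      map_add' x y := by
        refine RightHom.ext R (M := (toRight R).obj M) fun (m : M) => ?_
        change φ (m ⊗ₜ[R] (x + y)) = φ (m ⊗ₜ[R] x) + φ (m ⊗ₜ[R] y)
        rw [TensorProduct.tmul_add, map_add]
      map_smul' r x := by
        refine RightHom.ext R (M := (toRight R).obj M) fun (m : M) => ?_
        change φ (m ⊗ₜ[R] (r • x)) = φ ((r • m) ⊗ₜ[R] x)
        rw [TensorProduct.smul_tmul] }
  invFun g := TensorProduct.liftAddHom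
    (AddMonoidHom.flip
      { toFun n := (g.hom n : M →+ AddCircle (1 : ℚ))
        map_zero' := map_zero g.hom
        map_add' := map_add g.hom }) fun r m n => by
    exact congrArg (fun t : RightHom R ((toRight R).obj M) (AddCircle (1 : ℚ)) => t m)
      (map_smul g.hom r n).symm
  left_inv φ := by
    refine DFunLike.ext _ _ fun t => ?_
    induction t using TensorProduct.induction_on with
    | zero => rw [map_zero, map_zero]
    | tmul m n => rfl
    | add x y hx hy => rw [map_add, map_add, hx, hy]
  right_inv g := by
    refine ModuleCat.hom_ext (LinearMap.ext fun n => RightHom.ext R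
      (M := (toRight R).obj M) fun (m : M) => ?_)
    rfl
  map_add' _ _ := rfl

variable (R) in
/-- The tensor product over a commutative ring is dual to the character modules. -/
def monoidalDuality : BifunctorDuality (curriedTensor (ModuleCat.{u} R))
    (leftDual R (ModuleCat.of Rᵐᵒᵖ R)) (charFunctor R) where
  equiv M N := ((ringCharacterObject R).equiv _).trans (tensorCharEquiv M N)
  nat_right f φ := rfl
  nat_left g φ := rfl

variable (R) in
/-- The flipped tensor product over a commutative ring is dual to the character modules. -/
def monoidalDualityFlip : BifunctorDuality (curriedTensor (ModuleCat.{u} R)).flip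
    (leftDual R (ModuleCat.of Rᵐᵒᵖ R)) (charFunctor R) where
  equiv M N := (show ((N ⊗ M : ModuleCat.{u} R) ⟶ leftDual R (ModuleCat.of Rᵐᵒᵖ R)) ≃+
      ((M ⊗ N : ModuleCat.{u} R) ⟶ leftDual R (ModuleCat.of Rᵐᵒᵖ R)) from
    { toFun φ := (β_ M N).hom ≫ φ
      invFun φ := (β_ M N).inv ≫ φ
      left_inv φ := (β_ M N).inv_hom_id_assoc φ
      right_inv φ := (β_ M N).hom_inv_id_assoc φ
      map_add' φ ψ := Preadditive.comp_add _ _ _ _ _ _ }).trans ((monoidalDuality R).equiv M N)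
  nat_right f φ := rfl
  nat_left g φ := rfl

lemma acyclic_map {A B : Type*} [Category* A] [Category* B] [Abelian A] [Abelian B] (F : A ⥤ B)
    [F.Additive] [PreservesFiniteLimits F] [PreservesFiniteColimits F] {E : CochainComplex A ℤ}
    (hE : E.Acyclic) : ((F.mapHomologicalComplex (ComplexShape.up ℤ)).obj E).Acyclic :=
  fun n => (hE n).map F

lemma tensor_acyclic_iff_orth (E W : Ch R) :
    (E ⊗ W).Acyclic ↔ Orth W (dualComplex (charFunctor R) E) :=
  mapBifunctor_acyclic_iff_orth E W (ringCharacterObject R) (monoidalDuality R)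

/-- The order of the factors is reversed by the symmetry of modules, applied to the components.
Acyclicity of `W ⊗ E` and of `E ⊗ W` thus amount to the same orthogonality. -/
lemma tensor_acyclic_iff_orth' (E W : Ch R) :
    (W ⊗ E).Acyclic ↔ Orth W (dualComplex (charFunctor R) E) := by
  rw [← mapBifunctor_acyclic_iff_orth E W (ringCharacterObject R) (monoidalDualityFlip R)]
  let e := HomologicalComplex.mapBifunctorFlipIso W E (curriedTensor (ModuleCat.{u} R))
    (ComplexShape.up ℤ)
  exact ⟨acyclic_of_retract ⟨e.hom, e.inv, e.hom_inv_id⟩,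
    acyclic_of_retract ⟨e.inv, e.hom, e.inv_hom_id⟩⟩

/-- Restriction of scalars along `R ≃ Rᵐᵒᵖ` is exact in both directions and matches the dual
complexes, so both conditions are the same orthogonality. -/
lemma kFlat_iff_tensor (W : Ch R) : kFlat R W ↔ ∀ E : Ch R, E.Acyclic → (E ⊗ W).Acyclic := by
  rw [kFlat_iff_orth]
  simp only [tensor_acyclic_iff_orth]
  refine ⟨fun h E hE => h _ (acyclic_map (toRight R) hE), fun h E hE => ?_⟩
  refine Orth.of_retract_right ?_ (h _ (acyclic_map (ofRight R) hE))
  let e : leftDualComplex E ≅ dualComplex (charFunctor R)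
      (((ofRight R).mapHomologicalComplex (ComplexShape.up ℤ)).obj E) :=
    HomologicalComplex.Hom.isoOfComponents (fun n => Iso.refl _) fun i j _ => rfl
  exact ⟨e.hom, e.inv, e.hom_inv_id⟩

lemma kFlat.tensor_acyclic {W E : Ch R} (hW : kFlat R W) (hE : acyclic R E) :
    acyclic R (E ⊗ W) :=
  (kFlat_iff_tensor W).1 hW E hE

lemma kFlat.acyclic_tensor {W E : Ch R} (hW : kFlat R W) (hE : acyclic R E) :
    acyclic R (W ⊗ E) :=
  (tensor_acyclic_iff_orth' E W).2 ((tensor_acyclic_iff_orth E W).1 (hW.tensor_acyclic hE))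

lemma kFlat.tensor {W W' : Ch R} (hW : kFlat R W) (hW' : kFlat R W') : kFlat R (W ⊗ W') :=
  (kFlat_iff_tensor _).2 fun E hE =>
    acyclic_of_retract ⟨(α_ E W W').inv, (α_ E W W').hom, (α_ E W W').inv_hom_id⟩
      (hW'.tensor_acyclic (hW.tensor_acyclic hE))

end Commutative

end KFlatModel

end
noncomputable section
namespace KFlatModel

open CochainComplex.HomComplex Opposite

/-! ### The components of a tensor product of complexes -/

section Components

variable {R : Type u} [CommRing R]

section

variable (X Y : Ch R) (i j n : ℤ) (h : i + j = n)

/-- The inclusion of a summand in the tensor product of complexes. -/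
abbrev tensorι : X.X i ⊗ Y.X j ⟶ (X ⊗ Y).X n :=
  HomologicalComplex.ιTensorObj X Y i j n h

end

variable {X X' Y Y' : Ch R} {n : ℤ} {Z : ModuleCat.{u} R}

lemma tensor_hom_ext {f g : (X ⊗ Y).X n ⟶ Z}
    (h : ∀ i j h, tensorι X Y i j n h ≫ f = tensorι X Y i j n h ≫ g) : f = g :=
  HomologicalComplex.mapBifunctor.hom_ext h

lemma exists_tensorDesc (f : ∀ (i j : ℤ) (_ : i + j = n), (X.X i ⊗ Y.X j ⟶ Z)) :
    ∃ g : (X ⊗ Y).X n ⟶ Z, ∀ i j h, tensorι X Y i j n h ≫ g = f i j h :=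
  ⟨HomologicalComplex.mapBifunctorDesc f, fun i j h =>
    HomologicalComplex.ι_mapBifunctorDesc _ i j h⟩

lemma tensorι_whiskerLeft (g : Y ⟶ Y') (i j : ℤ) (h : i + j = n) :
    tensorι X Y i j n h ≫ (X ◁ g).f n = X.X i ◁ g.f j ≫ tensorι X Y' i j n h :=
  (HomologicalComplex.ι_mapBifunctorMap (𝟙 X) g (curriedTensor (ModuleCat.{u} R))
    (ComplexShape.up ℤ) i j n h).trans (by
      rw [HomologicalComplex.id_f, CategoryTheory.Functor.map_id]
      exact Category.id_comp _)

lemma tensorι_whiskerRight (f : X ⟶ X') (i j : ℤ) (h : i + j = n) :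
    tensorι X Y i j n h ≫ (f ▷ Y).f n = f.f i ▷ Y.X j ≫ tensorι X' Y i j n h :=
  (HomologicalComplex.ι_mapBifunctorMap f (𝟙 Y) (curriedTensor (ModuleCat.{u} R))
    (ComplexShape.up ℤ) i j n h).trans (by
      rw [HomologicalComplex.id_f, CategoryTheory.Functor.map_id]
      exact congrArg (_ ≫ ·) (Category.id_comp _))

lemma tensorι_whiskerLeft_assoc (g : Y ⟶ Y') (φ : (X ⊗ Y').X n ⟶ Z) (i j : ℤ) (h : i + j = n) :
    tensorι X Y i j n h ≫ (X ◁ g).f n ≫ φ = X.X i ◁ g.f j ≫ tensorι X Y' i j n h ≫ φ := by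
  rw [← Category.assoc, tensorι_whiskerLeft, Category.assoc]

lemma tensorι_whiskerRight_assoc (f : X ⟶ X') (φ : (X' ⊗ Y).X n ⟶ Z) (i j : ℤ) (h : i + j = n) :
    tensorι X Y i j n h ≫ (f ▷ Y).f n ≫ φ = f.f i ▷ Y.X j ≫ tensorι X' Y i j n h ≫ φ := by
  rw [← Category.assoc, tensorι_whiskerRight, Category.assoc]

end Components

/-! ### Exactness and purity of the tensor product -/

section Exactness

variable {R : Type u} [CommRing R]

/-- In degree `n` the tensor product is the direct sum of the modules `X.X i ⊗ Y.X j` with `i + j =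
n`, and each summand preserves colimits in `Y`; descent maps are assembled from the summands. -/
instance preservesColimitsOfShape_tensorLeft (X : Ch R) (J : Type*) [Category* J]
    [HasColimitsOfShape J (ModuleCat.{u} R)] :
    PreservesColimitsOfShape J (tensorLeft X) := by
  refine HomologicalComplex.preservesColimitsOfShape_of_eval _
    fun n => ⟨fun {K} => ⟨fun {c} hc => ?_⟩⟩
  have hc' (i j : ℤ) : IsColimit
      ((HomologicalComplex.eval (ModuleCat.{u} R) (ComplexShape.up ℤ) j ⋙
        tensorLeft (X.X i)).mapCocone c) := isColimitOfPreserves _ hc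
  have key (s : Cocone (K ⋙ tensorLeft X ⋙ HomologicalComplex.eval _ _ n)) :
      ∃ g : (X ⊗ c.pt).X n ⟶ s.pt, ∀ k, (X ◁ c.ι.app k).f n ≫ g = s.ι.app k := by
    let s' (i j : ℤ) (h : i + j = n) : Cocone (K ⋙
        HomologicalComplex.eval (ModuleCat.{u} R) (ComplexShape.up ℤ) j ⋙ tensorLeft (X.X i)) :=
      ⟨s.pt,
        { app k := tensorι X (K.obj k) i j n h ≫ s.ι.app k
          naturality k l f := by
            refine Eq.trans ?_ (Category.comp_id _).symm
            refine Eq.trans (Category.assoc _ _ _).symm ?_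
            refine Eq.trans (congrArg (· ≫ s.ι.app l)
              (tensorι_whiskerLeft (K.map f) i j h).symm) ?_
            exact (Category.assoc _ _ _).trans (congrArg (_ ≫ ·) (s.w f)) }⟩
    obtain ⟨g, hg⟩ := exists_tensorDesc fun i j h => (hc' i j).desc (s' i j h)
    refine ⟨g, fun k => tensor_hom_ext fun i j h => ?_⟩
    exact (tensorι_whiskerLeft_assoc (c.ι.app k) g i j h).trans
      ((congrArg (_ ≫ ·) (hg i j h)).trans ((hc' i j).fac (s' i j h) k))
  choose g hg using key
  refine ⟨⟨g, hg, fun s m hm => tensor_hom_ext fun i j h => (hc' i j).hom_ext fun k => ?_⟩⟩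
  have h₁ (m' : (X ⊗ c.pt).X n ⟶ s.pt) (hm' : ∀ k, (X ◁ c.ι.app k).f n ≫ m' = s.ι.app k) :
      (X.X i ◁ (c.ι.app k).f j) ≫ tensorι X c.pt i j n h ≫ m' =
        tensorι X (K.obj k) i j n h ≫ s.ι.app k :=
    (tensorι_whiskerLeft_assoc (c.ι.app k) m' i j h).symm.trans (congrArg (_ ≫ ·) (hm' k))
  exact (h₁ m hm).trans (h₁ (g s) (hg s)).symm

instance preservesColimitsOfShape_tensorRight (X : Ch R) (J : Type*) [Category* J]
    [HasColimitsOfShape J (ModuleCat.{u} R)] :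
    PreservesColimitsOfShape J (tensorRight X) := by
  refine HomologicalComplex.preservesColimitsOfShape_of_eval _
    fun n => ⟨fun {K} => ⟨fun {c} hc => ?_⟩⟩
  have hc' (i j : ℤ) : IsColimit
      ((HomologicalComplex.eval (ModuleCat.{u} R) (ComplexShape.up ℤ) i ⋙
        tensorRight (X.X j)).mapCocone c) := isColimitOfPreserves _ hc
  have key (s : Cocone (K ⋙ tensorRight X ⋙ HomologicalComplex.eval _ _ n)) :
      ∃ g : (c.pt ⊗ X).X n ⟶ s.pt, ∀ k, (c.ι.app k ▷ X).f n ≫ g = s.ι.app k := by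
    let s' (i j : ℤ) (h : i + j = n) : Cocone (K ⋙
        HomologicalComplex.eval (ModuleCat.{u} R) (ComplexShape.up ℤ) i ⋙ tensorRight (X.X j)) :=
      ⟨s.pt,
        { app k := tensorι (K.obj k) X i j n h ≫ s.ι.app k
          naturality k l f := by
            refine Eq.trans ?_ (Category.comp_id _).symm
            refine Eq.trans (Category.assoc _ _ _).symm ?_
            refine Eq.trans (congrArg (· ≫ s.ι.app l)
              (tensorι_whiskerRight (K.map f) i j h).symm) ?_
            exact (Category.assoc _ _ _).trans (congrArg (_ ≫ ·) (s.w f)) }⟩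
    obtain ⟨g, hg⟩ := exists_tensorDesc fun i j h => (hc' i j).desc (s' i j h)
    refine ⟨g, fun k => tensor_hom_ext fun i j h => ?_⟩
    exact (tensorι_whiskerRight_assoc (c.ι.app k) g i j h).trans
      ((congrArg (_ ≫ ·) (hg i j h)).trans ((hc' i j).fac (s' i j h) k))
  choose g hg using key
  refine ⟨⟨g, hg, fun s m hm => tensor_hom_ext fun i j h => (hc' i j).hom_ext fun k => ?_⟩⟩
  have h₁ (m' : (c.pt ⊗ X).X n ⟶ s.pt) (hm' : ∀ k, (c.ι.app k ▷ X).f n ≫ m' = s.ι.app k) :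
      ((c.ι.app k).f i ▷ X.X j) ≫ tensorι c.pt X i j n h ≫ m' =
        tensorι (K.obj k) X i j n h ≫ s.ι.app k :=
    (tensorι_whiskerRight_assoc (c.ι.app k) m' i j h).symm.trans (congrArg (_ ≫ ·) (hm' k))
  exact (h₁ m hm).trans (h₁ (g s) (hg s)).symm

variable {A B : ModuleCat.{u} R} {f : A ⟶ B}

/-- By associativity a character of `N' ⊗ (M ⊗ A)` is one of `(N' ⊗ M) ⊗ A`, and it extends along
`f` because purity of `f` is applied to the module `N' ⊗ M`. -/
lemma PureMono.whiskerLeft (hf : PureMono f) (M : ModuleCat.{u} R) : PureMono (M ◁ f) := by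
  intro N g
  let Δ := monoidalDuality R
  let N' : ModuleCat.{u} R := (ofRight R).obj N
  let φ : N' ⊗ M ⊗ A ⟶ leftDual R (ModuleCat.of Rᵐᵒᵖ R) := (Δ.equiv N' (M ⊗ A)).symm g
  obtain ⟨h, hh⟩ := hf _ (Δ.equiv (N' ⊗ M) A ((α_ N' M A).hom ≫ φ))
  let ψ : (N' ⊗ M) ⊗ B ⟶ leftDual R (ModuleCat.of Rᵐᵒᵖ R) := (Δ.equiv (N' ⊗ M) B).symm h
  have hψ : (N' ⊗ M) ◁ f ≫ ψ = (α_ N' M A).hom ≫ φ := by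
    refine (Δ.equiv (N' ⊗ M) A).injective ((Δ.nat_right f ψ).trans (Eq.trans ?_ hh))
    exact congrArg (f ≫ ·) ((Δ.equiv (N' ⊗ M) B).apply_symm_apply h)
  refine ⟨Δ.equiv N' (M ⊗ B) ((α_ N' M B).inv ≫ ψ), ?_⟩
  refine (Δ.nat_right (M ◁ f) _).symm.trans ?_
  refine Eq.trans (congrArg _ ?_) ((Δ.equiv N' (M ⊗ A)).apply_symm_apply g)
  change N' ◁ M ◁ f ≫ (α_ N' M B).inv ≫ ψ = φ
  rw [associator_inv_naturality_right_assoc, hψ, Iso.inv_hom_id_assoc]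

lemma PureMono.whiskerRight (hf : PureMono f) (M : ModuleCat.{u} R) : PureMono (f ▷ M) := by
  have h : f ▷ M = (β_ A M).hom ≫ M ◁ f ≫ (β_ B M).inv := by
    rw [← BraidedCategory.braiding_naturality_left_assoc, Iso.hom_inv_id, Category.comp_id]
  rw [h]
  exact (PureMono.of_isIso _).comp ((hf.whiskerLeft M).comp (PureMono.of_isIso _))

variable {X Y : Ch R} {g : X ⟶ Y}

lemma pureMono_whiskerLeft_f (hg : ∀ n, PureMono (g.f n)) (Z : Ch R) (n : ℤ) :
    PureMono ((Z ◁ g).f n) := fun N φ => by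
  choose k hk using fun (i j : ℤ) (h : i + j = n) =>
    (hg j).whiskerLeft (Z.X i) N (tensorι Z X i j n h ≫ φ)
  obtain ⟨ψ, hψ⟩ := exists_tensorDesc k
  refine ⟨ψ, tensor_hom_ext fun i j h => ?_⟩
  rw [tensorι_whiskerLeft_assoc, hψ, hk]

lemma pureMono_whiskerRight_f (hg : ∀ n, PureMono (g.f n)) (Z : Ch R) (n : ℤ) :
    PureMono ((g ▷ Z).f n) := fun N φ => by
  choose k hk using fun (i j : ℤ) (h : i + j = n) =>
    (hg i).whiskerRight (Z.X j) N (tensorι X Z i j n h ≫ φ)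
  obtain ⟨ψ, hψ⟩ := exists_tensorDesc k
  refine ⟨ψ, tensor_hom_ext fun i j h => ?_⟩
  rw [tensorι_whiskerRight_assoc, hψ, hk]

end Exactness

end KFlatModel

end
noncomputable section
namespace KFlatModel

open CochainComplex.HomComplex Opposite

/-! ### The monoidal model structure -/

section Monoidal

variable {R : Type u} [CommRing R]

instance (X : Ch R) : PreservesColimits (tensorLeft X) where

instance (X : Ch R) : PreservesColimits (tensorRight X) where

variable (R) in
-- The adjoint functor theorem applies: tensoring preserves colimits, and the category of complexes
-- has a separator.
lemma nonempty_monoidalClosed : Nonempty (MonoidalClosed (Ch R)) := by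
  refine ⟨⟨fun X => ?_⟩⟩
  have : (tensorLeft X).IsLeftAdjoint :=
    isLeftAdjoint_of_preservesColimits_of_isSeparating (isSeparator_separator (Ch R)) _
  exact Closed.mk _ (Adjunction.ofIsLeftAdjoint (tensorLeft X))

lemma shortExact_map_of_mono {C D : Type*} [Category* C] [Category* D] [Abelian C]
    [Abelian D] (F : C ⥤ D) [F.PreservesZeroMorphisms] [PreservesFiniteColimits F]
    {S : ShortComplex C} (hS : S.ShortExact) [Mono (F.map S.f)] : (S.map F).ShortExact := by
  have := hS.epi_g
  have : Epi (S.map F).g := inferInstanceAs (Epi (F.map S.g))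
  have : Mono (S.map F).f := inferInstanceAs (Mono (F.map S.f))
  exact ShortComplex.ShortExact.mk' (hS.exact.map_of_epi_of_preservesCokernel F ‹_› inferInstance)
    ‹_› ‹_›

variable {S : ShortComplex (Ch R)}

lemma mono_of_pureMono {X Y : Ch R} {f : X ⟶ Y} (hf : ∀ n, PureMono (f.f n)) : Mono f := by
  have (n : ℤ) : Mono (f.f n) := (hf n).mono
  exact HomologicalComplex.mono_of_mono_f _ inferInstance

lemma dwPureExact.tensorLeft (hS : dwPureExact R S) (X : Ch R) :
    dwPureExact R (S.map (tensorLeft X)) := by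
  have h := pureMono_whiskerLeft_f hS.pureMono X
  have : Mono ((MonoidalCategory.tensorLeft X).map S.f) := mono_of_pureMono h
  exact dwPureExact_iff.2 ⟨shortExact_map_of_mono _ hS.shortExact, h⟩

lemma dwPureExact.tensorRight (hS : dwPureExact R S) (X : Ch R) :
    dwPureExact R (S.map (tensorRight X)) := by
  have h := pureMono_whiskerRight_f hS.pureMono X
  have : Mono ((MonoidalCategory.tensorRight X).map S.f) := mono_of_pureMono h
  exact dwPureExact_iff.2 ⟨shortExact_map_of_mono _ hS.shortExact, h⟩

section QuasiIso

/-- The maps of complexes factor as admissible monomorphisms followed by admissible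
epimorphisms with acyclic kernels. -/
lemma exists_factorization {X Y : Ch R} (f : X ⟶ Y) :
    ∃ (Z : Ch R) (i : X ⟶ Z) (p : Z ⟶ Y), i ≫ p = f ∧ AdmissibleMono (dwPureExact R) (kFlat R) i ∧
      AdmissibleEpi (dwPureExact R) (acyclic R ⊓ dwPureInjective R) p := by
  obtain ⟨Z, i, p, fac, hi, hp⟩ :=
    MorphismProperty.factorizationData (genCof R).rlp.llp (genCof R).rlp f
  exact ⟨Z, i, p, fac, (llp_genCof_iff i).1 hi, (rlp_genCof_iff p).1 hp⟩

/-- Tensoring with a K-flat complex preserves quasi-isomorphisms. -/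
lemma kFlat.quasiIso_whiskerRight {W X Y : Ch R} (hW : kFlat R W) (f : X ⟶ Y) [QuasiIso f] :
    QuasiIso (f ▷ W) := by
  obtain ⟨Z, i, p, rfl, ⟨C, g, w, hS, hC⟩, ⟨K, k, w', hS', hK⟩⟩ := exists_factorization f
  have hp : QuasiIso p := (quasiIso_g_iff_acyclic hS'.shortExact).2 hK.1
  have hi : QuasiIso i := quasiIso_of_comp_right i p
  have hi' : QuasiIso (i ▷ W) := (quasiIso_f_iff_acyclic (hS.tensorRight W).shortExact).2
    (hW.tensor_acyclic ((quasiIso_f_iff_acyclic hS.shortExact).1 hi))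
  have hp' : QuasiIso (p ▷ W) := (quasiIso_g_iff_acyclic (hS'.tensorRight W).shortExact).2
    (hW.tensor_acyclic hK.1)
  rw [comp_whiskerRight]
  infer_instance

/-- Tensoring with a K-flat complex preserves quasi-isomorphisms. -/
lemma kFlat.quasiIso_whiskerLeft {W X Y : Ch R} (hW : kFlat R W) (f : X ⟶ Y) [QuasiIso f] :
    QuasiIso (W ◁ f) := by
  obtain ⟨Z, i, p, rfl, ⟨C, g, w, hS, hC⟩, ⟨K, k, w', hS', hK⟩⟩ := exists_factorization f
  have hp : QuasiIso p := (quasiIso_g_iff_acyclic hS'.shortExact).2 hK.1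
  have hi : QuasiIso i := quasiIso_of_comp_right i p
  have hi' : QuasiIso (W ◁ i) := (quasiIso_f_iff_acyclic (hS.tensorLeft W).shortExact).2
    (hW.acyclic_tensor ((quasiIso_f_iff_acyclic hS.shortExact).1 hi))
  have hp' : QuasiIso (W ◁ p) := (quasiIso_g_iff_acyclic (hS'.tensorLeft W).shortExact).2
    (hW.acyclic_tensor hK.1)
  rw [MonoidalCategory.whiskerLeft_comp]
  infer_instance

end QuasiIso

section PushoutProduct

variable {A B P X Y Q T : Ch R} {i : A ⟶ B} {g : B ⟶ P} {j : X ⟶ Y} {h : Y ⟶ Q}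
  {wi : i ≫ g = 0} {wj : j ≫ h = 0} (hi : dwPureExact R (ShortComplex.mk i g wi))
  (hj : dwPureExact R (ShortComplex.mk j h wj))
  {inl : B ⊗ X ⟶ T} {inr : A ⊗ Y ⟶ T} (sq : IsPushout (i ▷ X) (A ◁ j) inl inr)
  {ι : T ⟶ B ⊗ Y} (hinl : inl ≫ ι = B ◁ j) (hinr : inr ≫ ι = i ▷ Y)

include hi hj sq hinl hinr

/-- The restriction of `φ` to `A ⊗ Y` extends to `β` on `B ⊗ Y`. The error of `β` on `B ⊗ X`
vanishes on `A ⊗ X`, so it descends to `P ⊗ X` and extends to `ψ` on `P ⊗ Y`. Subtracting the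
pullback of `ψ` corrects `β` on `B ⊗ X` and does not affect it on `A ⊗ Y`. -/
lemma pureMono_pushoutProduct (n : ℤ) : PureMono (ι.f n) := by
  intro N φ
  have e₁ : (i ▷ X).f n ≫ inl.f n = (A ◁ j).f n ≫ inr.f n := congr($(sq.w).f n)
  have e₂ : inl.f n ≫ ι.f n = (B ◁ j).f n := congr($(hinl).f n)
  have e₃ : inr.f n ≫ ι.f n = (i ▷ Y).f n := congr($(hinr).f n)
  have e₄ : (i ▷ X).f n ≫ (B ◁ j).f n = (A ◁ j).f n ≫ (i ▷ Y).f n :=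
    congr($(whisker_exchange i j).f n).symm
  have e₅ : (g ▷ X).f n ≫ (P ◁ j).f n = (B ◁ j).f n ≫ (g ▷ Y).f n :=
    congr($(whisker_exchange g j).f n).symm
  have e₆ : (i ▷ Y).f n ≫ (g ▷ Y).f n = 0 :=
    congr($(((ShortComplex.mk i g wi).map (tensorRight Y)).zero).f n)
  obtain ⟨β, hβ⟩ : ∃ β, (i ▷ Y).f n ≫ β = inr.f n ≫ φ :=
    pureMono_whiskerRight_f hi.pureMono Y n N (inr.f n ≫ φ)
  have hX := ((hi.tensorRight X) n).1
  have := hX.epi_g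
  have hθ : (i ▷ X).f n ≫ ((B ◁ j).f n ≫ β - inl.f n ≫ φ) = 0 := by
    rw [Preadditive.comp_sub, ← Category.assoc, e₄, ← Category.assoc, e₁, Category.assoc,
      Category.assoc, hβ, sub_self]
  obtain ⟨θ, hθ'⟩ : ∃ θ, (g ▷ X).f n ≫ θ = (B ◁ j).f n ≫ β - inl.f n ≫ φ :=
    ⟨hX.exact.desc _ hθ, hX.exact.g_desc _ hθ⟩
  obtain ⟨ψ, hψ⟩ : ∃ ψ, (P ◁ j).f n ≫ ψ = θ :=
    pureMono_whiskerLeft_f hj.pureMono P n N θ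
  refine ⟨β - (g ▷ Y).f n ≫ ψ, (sq.map (HomologicalComplex.eval _ _ n)).hom_ext ?_ ?_⟩
  · change inl.f n ≫ ι.f n ≫ _ = inl.f n ≫ φ
    rw [← Category.assoc, e₂, Preadditive.comp_sub, ← Category.assoc, ← e₅,
      Category.assoc, hψ, hθ', sub_sub_cancel]
  · change inr.f n ≫ ι.f n ≫ _ = inr.f n ≫ φ
    rw [← Category.assoc, e₃, Preadditive.comp_sub, hβ, ← Category.assoc, e₆, zero_comp, sub_zero]

/-- A map on `B ⊗ Y` that kills the pushout kills `A ⊗ Y`, so it factors through `P ⊗ Y`. It also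
kills `B ⊗ X`, which surjects onto `P ⊗ X`, so it factors further through `P ⊗ Q`. -/
lemma exists_dwPureExact_pushoutProduct :
    ∃ (π : B ⊗ Y ⟶ P ⊗ Q) (w : ι ≫ π = 0), dwPureExact R (ShortComplex.mk ι π w) := by
  have hY := (hi.tensorRight Y).shortExact
  have hP := (hj.tensorLeft P).shortExact
  have := hY.epi_g
  have := hP.epi_g
  have : Epi (g ▷ Y) := hY.epi_g
  have : Epi (g ▷ X) := (hi.tensorRight X).shortExact.epi_g
  have : Epi (P ◁ h) := hP.epi_g
  have e₁ : i ▷ Y ≫ g ▷ Y = 0 := ((ShortComplex.mk i g wi).map (tensorRight Y)).zero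
  have e₂ : P ◁ j ≫ P ◁ h = 0 := ((ShortComplex.mk j h wj).map (tensorLeft P)).zero
  have w : ι ≫ g ▷ Y ≫ P ◁ h = 0 := by
    refine sq.hom_ext ?_ ?_
    · rw [reassoc_of% hinl, whisker_exchange_assoc, e₂, comp_zero, comp_zero]
    · rw [reassoc_of% hinr, reassoc_of% e₁, zero_comp, comp_zero]
  refine ⟨g ▷ Y ≫ P ◁ h, w, dwPureExact_iff.2 ⟨?_, pureMono_pushoutProduct hi hj sq hinl hinr⟩⟩
  have : Mono ι := mono_of_pureMono (pureMono_pushoutProduct hi hj sq hinl hinr)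
  have : Epi (g ▷ Y ≫ P ◁ h) := epi_comp _ _
  refine ShortComplex.ShortExact.mk' (ShortComplex.exact_of_g_is_cokernel _
    (CokernelCofork.IsColimit.ofπ' _ _ fun {Z} k hk => ?_)) ‹_› ‹_›
  have h₁ : i ▷ Y ≫ k = 0 := by rw [← hinr, Category.assoc, hk, comp_zero]
  let k' : P ⊗ Y ⟶ Z := hY.exact.desc k h₁
  have hk' : g ▷ Y ≫ k' = k := hY.exact.g_desc k h₁
  have h₂ : P ◁ j ≫ k' = 0 := by
    rw [← cancel_epi (g ▷ X), ← whisker_exchange_assoc, hk', ← hinl, Category.assoc, hk, comp_zero,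
      comp_zero]
  have hk'' : P ◁ h ≫ hP.exact.desc k' h₂ = k' := hP.exact.g_desc k' h₂
  exact ⟨hP.exact.desc k' h₂,
    (Category.assoc _ _ _).trans ((congrArg (g ▷ Y ≫ ·) hk'').trans hk')⟩

end PushoutProduct

lemma AdmissibleMono.pushoutProduct {C₁ C₂ C₃ : ObjectProperty (Ch R)}
    (hC : ∀ ⦃P Q⦄, C₁ P → C₂ Q → C₃ (P ⊗ Q)) {A B X Y : Ch R} {i : A ⟶ B} {j : X ⟶ Y}
    (hi : AdmissibleMono (dwPureExact R) C₁ i) (hj : AdmissibleMono (dwPureExact R) C₂ j) :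
    AdmissibleMono (dwPureExact R) C₃
      ((MonoidalCategory.Arrow.pushoutProduct.obj (Arrow.mk i)).obj (Arrow.mk j)).hom := by
  obtain ⟨P, g, wi, hi, hP⟩ := hi
  obtain ⟨Q, h, wj, hj, hQ⟩ := hj
  let sq := Functor.PushoutObjObj.ofHasPushout (curriedTensor (Ch R)) i j
  obtain ⟨π, w, hπ⟩ := exists_dwPureExact_pushoutProduct hi hj sq.isPushout sq.inl_ι sq.inr_ι
  exact ⟨P ⊗ Q, π, w, hπ, hC hP hQ⟩

lemma IsAbelianModelStructure.isMonoidalModelCategory [ModelCategory (Ch R)]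
    (h : IsAbelianModelStructure (dwPureExact R) (kFlat R) (acyclic R) (dwPureInjective R)) :
    IsMonoidalModelCategory (Ch R) where
  closed := nonempty_monoidalClosed R
  pushoutProduct i j hi hj := (h.cofibrations_iff _).2 <|
    AdmissibleMono.pushoutProduct (fun _ _ hP hQ => hP.tensor hQ)
      ((h.cofibrations_iff i).1 hi) ((h.cofibrations_iff j).1 hj)
  pushoutProduct_left i j hi hj := (h.trivialCofibrations_iff _).2 <|
    AdmissibleMono.pushoutProduct (fun _ _ hP hQ => ⟨hP.1.tensor hQ, hQ.tensor_acyclic hP.2⟩)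
      ((h.trivialCofibrations_iff i).1 hi) ((h.cofibrations_iff j).1 hj)
  pushoutProduct_right i j hi hj := (h.trivialCofibrations_iff _).2 <|
    AdmissibleMono.pushoutProduct (fun _ _ hP hQ => ⟨hP.tensor hQ.1, hP.acyclic_tensor hQ.2⟩)
      ((h.cofibrations_iff i).1 hi) ((h.trivialCofibrations_iff j).1 hj)
  unit_left {U X} q _ hq hX := by
    have : QuasiIso q := (h.weakEquivalence_iff_quasiIso q).1 hq
    exact (h.weakEquivalence_iff_quasiIso _).2
      (((h.cofibrant_iff X).1 hX).quasiIso_whiskerRight q)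
  unit_right {U X} q _ hq hX := by
    have : QuasiIso q := (h.weakEquivalence_iff_quasiIso q).1 hq
    exact (h.weakEquivalence_iff_quasiIso _).2
      (((h.cofibrant_iff X).1 hX).quasiIso_whiskerLeft q)

end Monoidal

end KFlatModel

end

/-- The monoidal statement is made for every model structure with the given description: the
description determines all three classes of maps, so nothing depends on the construction. -/
theorem mainTheorem1 :
    (∀ (R : Type u) [Ring R], ∃ _ : ModelCategory (KFlatModel.Ch R),
      KFlatModel.IsHoveyTriple (KFlatModel.dwPureExact R) (KFlatModel.kFlat R)
        (KFlatModel.acyclic R) (KFlatModel.dwPureInjective R) ∧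
      KFlatModel.IsAbelianModelStructure (KFlatModel.dwPureExact R) (KFlatModel.kFlat R)
        (KFlatModel.acyclic R) (KFlatModel.dwPureInjective R) ∧
      KFlatModel.IsCofibrantlyGenerated (KFlatModel.Ch R) ∧
      ∃ (_ : KFlatModel.TriangulatedLocalization (weakEquivalences (KFlatModel.Ch R)))
        (_ : (KFlatModel.kFlatPureInjective R).IsTriangulated),
        ∀ [HasDerivedCategory.{w} (ModuleCat.{u} R)],
          ∃ (Φ : KFlatModel.Ho (KFlatModel.Ch R) ⥤ DerivedCategory (ModuleCat.{u} R))
            (_ : Φ.CommShift ℤ)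
            (Ψ : (KFlatModel.kFlatPureInjective R).FullSubcategory ⥤
              KFlatModel.Ho (KFlatModel.Ch R))
            (_ : Ψ.CommShift ℤ),
            Φ.IsEquivalence ∧ Φ.IsTriangulated ∧ Ψ.IsEquivalence ∧ Ψ.IsTriangulated ∧
            Nonempty ((weakEquivalences (KFlatModel.Ch R)).Q ⋙ Φ ≅ DerivedCategory.Q) ∧
            Nonempty (Ψ ⋙ Φ ≅ (KFlatModel.kFlatPureInjective R).ι ⋙ DerivedCategory.Qh)) ∧
    (∀ (R : Type u) [CommRing R] [ModelCategory (KFlatModel.Ch R)],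
      KFlatModel.IsAbelianModelStructure (KFlatModel.dwPureExact R) (KFlatModel.kFlat R)
        (KFlatModel.acyclic R) (KFlatModel.dwPureInjective R) →
      KFlatModel.IsMonoidalModelCategory (KFlatModel.Ch R)) := by
  refine ⟨fun R _ => ?_, fun R _ _ h => ?_⟩
  · let := KFlatModel.kFlatModelCategory R
    let t : KFlatModel.TriangulatedLocalization (weakEquivalences (KFlatModel.Ch R)) :=
      KFlatModel.quasiIsoTriangulatedLocalization (ModuleCat.{u} R)
    refine ⟨inferInstance, KFlatModel.isHoveyTriple R,
      KFlatModel.isAbelianModelStructure_kFlatModelCategory R,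
      KFlatModel.isCofibrantlyGenerated_kFlatModelCategory R, t,
      KFlatModel.isTriangulated_kFlatPureInjective R, ?_⟩
    intro _
    -- The weak equivalences of the constructed model structure are the quasi-isomorphisms by
    -- definition, hence `rfl`.
    obtain ⟨Φ, hΦ, hΦ', hΦ'', e⟩ := KFlatModel.exists_equivalence_derivedCategory
      (W := weakEquivalences (KFlatModel.Ch R)) (A := ModuleCat.{u} R) rfl
    let : Φ.asEquivalence.functor.CommShift ℤ := hΦ
    have : Φ.asEquivalence.functor.IsTriangulated := hΦ''
    obtain ⟨Ψ, hΨ, hΨ', hΨ'', e'⟩ :=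
      KFlatModel.exists_equivalence_kFlatPureInjective Φ.asEquivalence
    exact ⟨Φ, hΦ, Ψ, hΨ, hΦ', hΦ'', hΨ', hΨ'', e, e'⟩
  · exact KFlatModel.IsAbelianModelStructure.isMonoidalModelCategory h
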